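/- Write $\lg=\log_2$. Consider the word RAM with $w$-bit words, $w\ge 2$, in which reading or writing a memory word, comparisons and jumps, bit shifts, bitwise logical operations and arithmetic operations on words (including multiplication) take one step each. There are a constant $C>0$ and a query program on this machine, both independent of $w$, $u$ and $n$, with the following property. Let $u<2^w$ (every key fits in a machine word) and let $S\subseteq[1,u]$ be a set of $n$ keys. Then there is a data structure for $S$, that is, a sequence of $w$-bit words that queries only read, which occupies at most $$C\bigl(n\cdot\max(1,\lg(u/n))+w\bigr)$$ bits, that is, $O(n\lg(u/n))$ bits if $u\ge 2n$ and $O(n)$ bits if $u<2n$, plus a constant number of machine words for systemwide pointers and parameters, such that for every $x\in[1,u]$ the program answers the predecessor query $x$ in at most $$C\cdot\max\Bigl(1,\ \lg\frac{\lg(u/n)}{\lg w}\Bigr)$$ steps, where the maximum is read as $1$ if $n=0$ or $u=n$. The answer to the query $x$ is the pair $(y,r)$ where $y$ is the largest element of $S$ with $y\le x$ and $r$ is the number of elements of $S$ that are at most $y$; it is $(0,0)$ if no element of $S$ is at most $x$. For $n=0$ the space bound reads $Cw$ bits. -/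

import Mathlib

namespace WordRAM

/-- Binary word operations of unit cost. On `w`-bit words, arithmetic is modulo `2 ^ w`,
`div` is the floor quotient (with quotient `0` for divisor `0`), and `shl`, `shr` are the logical
shifts of the first operand by the number in the second operand. -/
inductive BinOp
  | add | sub | mul | div | and | or | xor | shl | shr

/-- Value of a binary operation on two `w`-bit words. -/
def BinOp.eval {w : ℕ} : BinOp → BitVec w → BitVec w → BitVec w
  | .add, a, b => a + b
  | .sub, a, b => a - b
  | .mul, a, b => a * b
  | .div, a, b => a / b
  | .and, a, b => a &&& b
  | .or, a, b => a ||| b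
  | .xor, a, b => a ^^^ b
  | .shl, a, b => a <<< b
  | .shr, a, b => a >>> b

/-- Instructions of the word RAM. The arguments `d`, `a`, `b` are indices of registers; instructions
do not mention the word size, so that one program runs on machines of every word size. -/
inductive Instr
  /-- register `d` receives the constant `k` (modulo `2 ^ w`) -/
  | const (d k : ℕ)
  /-- register `d` receives the value of the operation on registers `a` and `b` -/
  | op (o : BinOp) (d a b : ℕ)
  /-- register `d` receives the word of the data structure at the address in register `a` -/
  | read (d a : ℕ)
  /-- register `d` receives the word of the working memory at the address in register `a` -/
  | load (d a : ℕ)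
  /-- the working memory at the address in register `a` receives the content of register `b` -/
  | store (a b : ℕ)
  /-- jump to the instruction `target` -/
  | jump (target : ℕ)
  /-- jump to the instruction `target` if the registers `a` and `b` are equal -/
  | jumpEq (a b target : ℕ)
  /-- jump to the instruction `target` if register `a` is less than register `b` (unsigned) -/
  | jumpLt (a b target : ℕ)
  /-- stop -/
  | halt

/-- A program is a finite list of instructions; it therefore uses finitely many registers. -/
abbrev Program := List Instr

/-- A configuration of the machine with `w`-bit words: program counter, registers and working
memory. The data structure is kept in a separate memory that queries cannot modify. -/
structure Config (w : ℕ) where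
  pc : ℕ
  reg : ℕ → BitVec w
  mem : BitVec w → BitVec w

/-- Next configuration after an instruction other than `halt`; `D` is the sequence of words of
the data structure (reading beyond its end yields `0`). -/
def Instr.exec {w : ℕ} (D : List (BitVec w)) (c : Config w) : Instr → Config w
  | .const d k => { c with pc := c.pc + 1, reg := Function.update c.reg d (BitVec.ofNat w k) }
  | .op o d a b =>
      { c with pc := c.pc + 1, reg := Function.update c.reg d (o.eval (c.reg a) (c.reg b)) }
  | .read d a =>
      { c with pc := c.pc + 1, reg := Function.update c.reg d (D.getD (c.reg a).toNat 0) }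
  | .load d a => { c with pc := c.pc + 1, reg := Function.update c.reg d (c.mem (c.reg a)) }
  | .store a b => { c with pc := c.pc + 1, mem := Function.update c.mem (c.reg a) (c.reg b) }
  | .jump t => { c with pc := t }
  | .jumpEq a b t => { c with pc := if c.reg a = c.reg b then t else c.pc + 1 }
  | .jumpLt a b t => { c with pc := if c.reg a < c.reg b then t else c.pc + 1 }
  | .halt => c

/-- One step of the program `P`; nothing changes once the program counter has left the program
or points to `halt`. -/
def step {w : ℕ} (P : Program) (D : List (BitVec w)) (c : Config w) : Config w :=
  match P[c.pc]? with
  | none => c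
  | some i => i.exec D c

/-- The program has stopped: the program counter points to a `halt` instruction. -/
def Halted {w : ℕ} (P : Program) (c : Config w) : Prop :=
  P[c.pc]? = some Instr.halt

/-- Initial configuration for the query `x`: the query is in register `0`, and all other
registers and the working memory are zero. -/
def init {w : ℕ} (x : BitVec w) : Config w where
  pc := 0
  reg := Function.update (fun _ => 0) 0 x
  mem := fun _ => 0

/-- On the data structure `D`, the program `P` started with query `x` stops after at most `T` steps
with the numbers `y` and `r` in its registers `0` and `1`. -/
def Returns {w : ℕ} (P : Program) (D : List (BitVec w)) (x : ℕ) (T : ℝ) (y r : ℕ) : Prop :=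
  ∃ t : ℕ, (t : ℝ) ≤ T ∧
    Halted P ((step P D)^[t] (init (BitVec.ofNat w x))) ∧
    (((step P D)^[t] (init (BitVec.ofNat w x))).reg 0).toNat = y ∧
    (((step P D)^[t] (init (BitVec.ofNat w x))).reg 1).toNat = r

/-- Number of bits occupied by a sequence of `w`-bit words. -/
def bits {w : ℕ} (D : List (BitVec w)) : ℕ := D.length * w

end WordRAM

/-- `(y, r)` is the answer to the predecessor query `x` on `S`: `y` is the largest element of `S`
that is at most `x` and `r` is its rank in `S`, or `(y, r) = (0, 0)` if there is no such element. -/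
def IsPredecessorAnswer (S : Finset ℕ) (x y r : ℕ) : Prop :=
  (IsGreatest {s | s ∈ S ∧ s ≤ x} y ∧ r = (S.filter (· ≤ y)).card) ∨
    ((∀ s ∈ S, x < s) ∧ y = 0 ∧ r = 0)

/-! Let `n` be the number of keys, `l ≥ 1` the rounded-up value of `lg (u / n)` and `lam` the floor
of `lg w`. The task is a structure of `O(n l / w + 1)` words with query time `O(1 + lg (l / lam))`;
`exists_structure` proves this integer form, and `exists_log` and `log_div_le` translate it into
real logarithms. For `w < 2 ^ 64` all quantities that depend on `w` alone are bounded, and scanning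
a bit vector suffices (`solves_scan`). Otherwise there are two regimes. Both treat a word as an
array of small fields: with one spare bit per field, one subtraction compares all fields, and one
multiplication by the word of ones sums the outcomes (`Expr.eval_count`).

Sparse regime, `lam < 8 * l` (`exists_sparse`). The universe is cut into blocks and the ranks into
runs of length `k`, about `w / lam`; keys in the same block and the same run form a group. The group
index is a monotone function `G` with `O(n lam / w + 1)` values, so it is determined by few jump
points. These are stored in a trie with `J = O(l / lam)` levels and about `√w` children per node,
few enough for one word. All nodes lie in a perfect hash table keyed by their prefixes
(`exists_dictionary`), so a binary search over the depth finds the deepest node above `x` in `O(1 +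
lg J)` lookups, and one packed comparison there yields `G x` (`nodeValue_eq`, `runs_trieSearch`).
Keys of one group agree in their high bits; their `O(l)` low bits are packed into `O(l / lam + 1)`
words, in which a binary search and one last comparison find the answer (`runs_groupSearch`).

Dense regime, `8 * l ≤ lam` (`exists_dense`). This is an Elias–Fano code: the low `l` bits of the
keys are stored verbatim, the remaining high parts (bucket numbers) in unary. The `O(n / w + 1)`
superblocks store the rank and the predecessor in front of them, and single words hold such data for
all blocks of a superblock. A block is so small that the square of the length of its unary code is
below `w`; its bits can be spread over the fields of one word and selection becomes packed counting
(`select_zero`, `select_one`). Queries take constant time (`runs_denseSearch`).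

Query programs are written in a small while language. `Runs.reach_code` verifies its compiler, so
that correctness and running time only concern values of expressions over natural numbers. -/

namespace WordRAM

/-! ### A structured language on top of the machine -/

/-- Loop-free expressions over numbered variables; `ite a b c d` is `c` if `a < b`, else `d`. -/
inductive Expr
  | var (i : ℕ)
  | const (k : ℕ)
  | op (o : BinOp) (a b : Expr)
  | read (a : Expr)
  | ite (a b c d : Expr)

/-- Commands; the tests of `ite` and `while` are of the form `a < b`. -/
inductive Cmd
  | assign (d : ℕ) (e : Expr)
  | seq (c₁ c₂ : Cmd)
  | ite (a b : Expr) (c₁ c₂ : Cmd)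
  | while (a b : Expr) (c : Cmd)

/-- Word operations on natural numbers. -/
def BinOp.natEval (w : ℕ) : BinOp → ℕ → ℕ → ℕ
  | .add, a, b => (a + b) % 2 ^ w
  | .sub, a, b => (2 ^ w - b + a) % 2 ^ w
  | .mul, a, b => a * b % 2 ^ w
  | .div, a, b => a / b
  | .and, a, b => a &&& b
  | .or, a, b => a ||| b
  | .xor, a, b => a ^^^ b
  | .shl, a, b => (a <<< b) % 2 ^ w
  | .shr, a, b => a >>> b

theorem BinOp.toNat_eval {w : ℕ} (o : BinOp) (a b : BitVec w) :
    (o.eval a b).toNat = o.natEval w a.toNat b.toNat := by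
  cases o <;> simp [BinOp.eval, BinOp.natEval]

namespace Expr

/-- Value of an expression for the memory contents `M` and the variables `σ`. -/
def eval (w : ℕ) (M : ℕ → ℕ) (σ : ℕ → ℕ) : Expr → ℕ
  | var i => σ i
  | const k => k % 2 ^ w
  | op o a b => o.natEval w (a.eval w M σ) (b.eval w M σ)
  | read a => M (a.eval w M σ)
  | ite a b c d => if a.eval w M σ < b.eval w M σ then c.eval w M σ else d.eval w M σ

/-- Number of machine steps that suffice to evaluate an expression. -/
def cost : Expr → ℕ
  | var _ => 1
  | const _ => 1
  | op _ a b => a.cost + b.cost + 1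
  | read a => a.cost + 1
  | ite a b c d => a.cost + b.cost + c.cost + d.cost + 2

/-- A strict upper bound for the variables of an expression. -/
def bound : Expr → ℕ
  | var i => i + 1
  | const _ => 0
  | op _ a b => max a.bound b.bound
  | read a => a.bound
  | ite a b c d => max (max a.bound b.bound) (max c.bound d.bound)

/-- Code placed at address `p` that leaves the value of the expression in register `r`. -/
def code : Expr → ℕ → ℕ → List Instr
  -- There is no move instruction; the disjunction of a register with itself is a copy.
  | var i, r, _ => [.op .or r i i]
  | const k, r, _ => [.const r k]
  | op o a b, r, p =>
      a.code r p ++ (b.code (r + 1) (p + (a.code r p).length) ++ [.op o r r (r + 1)])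
  | read a, r, p => a.code r p ++ [.read r r]
  | ite a b c d, r, p =>
      let ca := a.code r p
      let cb := b.code (r + 1) (p + ca.length)
      let q := p + ca.length + cb.length
      let cd := d.code r (q + 1)
      let q' := q + 1 + cd.length
      let cc := c.code r (q' + 1)
      ca ++ (cb ++ ([.jumpLt r (r + 1) (q' + 1)] ++
        (cd ++ ([.jump (q' + 1 + cc.length)] ++ cc))))

end Expr

/-- The instructions `l` stand in the program `P` from address `p` on. -/
def CodeAt (P : Program) (p : ℕ) (l : List Instr) : Prop :=
  ∀ i, ∀ h : i < l.length, P[p + i]? = some l[i]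

theorem CodeAt.left {P : Program} {p : ℕ} {a b : List Instr} (h : CodeAt P p (a ++ b)) :
    CodeAt P p a := by
  intro i hi
  rw [h i (by simp; omega), List.getElem_append_left hi]

theorem CodeAt.right {P : Program} {p : ℕ} {a b : List Instr} (h : CodeAt P p (a ++ b)) :
    CodeAt P (p + a.length) b := by
  intro i hi
  rw [Nat.add_assoc, h (a.length + i) (by simp; omega)]
  simp

theorem CodeAt.single {P : Program} {p : ℕ} {i : Instr} (h : CodeAt P p [i]) :
    P[p]? = some i := by
  simpa using h 0 (by simp)

/-- `c'` is reached from `c` within `T` steps. -/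
def Reach {w : ℕ} (P : Program) (D : List (BitVec w)) (c c' : Config w) (T : ℕ) : Prop :=
  ∃ t ≤ T, (step P D)^[t] c = c'

section Reach
variable {w : ℕ} {P : Program} {D : List (BitVec w)} {c c' c'' : Config w} {T T' : ℕ}

theorem Reach.refl : Reach P D c c 0 := ⟨0, le_rfl, rfl⟩

theorem Reach.trans (h : Reach P D c c' T) (h' : Reach P D c' c'' T') :
    Reach P D c c'' (T + T') := by
  obtain ⟨t, ht, e⟩ := h
  obtain ⟨t', ht', e'⟩ := h'
  refine ⟨t' + t, by omega, ?_⟩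
  rw [Function.iterate_add_apply, e, e']

theorem Reach.mono (h : Reach P D c c' T) (hT : T ≤ T') : Reach P D c c' T' := by
  obtain ⟨t, ht, e⟩ := h
  exact ⟨t, ht.trans hT, e⟩

theorem Reach.single {i : Instr} (h : P[c.pc]? = some i) (e : i.exec D c = c') :
    Reach P D c c' 1 := by
  refine ⟨1, le_rfl, ?_⟩
  simp [step, h, e]

end Reach

/-- Memory contents as a function on natural numbers. -/
def memory {w : ℕ} (D : List (BitVec w)) (i : ℕ) : ℕ := (D.getD i 0).toNat

/-- The registers from `r` on serve as an evaluation stack. Nothing below `r` changes, so the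
variables survive, and a first operand in `r` survives the evaluation of the second one, which
starts at `r + 1`. -/
theorem Expr.reach_code {w : ℕ} {P : Program} {D : List (BitVec w)} {mem : BitVec w → BitVec w}
    {σ : ℕ → ℕ} (e : Expr) : ∀ (r p : ℕ) (reg : ℕ → BitVec w), e.bound ≤ r →
    (∀ i < e.bound, (reg i).toNat = σ i) → CodeAt P p (e.code r p) →
    ∃ reg' : ℕ → BitVec w,
      Reach P D ⟨p, reg, mem⟩ ⟨p + (e.code r p).length, reg', mem⟩ e.cost ∧
      (reg' r).toNat = e.eval w (memory D) σ ∧ ∀ i < r, reg' i = reg i := by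
  induction e with
  | var i =>
    intro r p reg hr hσ hc
    refine ⟨Function.update reg r (reg i), Reach.single hc.single ?_, ?_, ?_⟩
    · simp [Instr.exec, BinOp.eval, Expr.code]
    · simpa [Expr.eval] using hσ i (by simp [Expr.bound])
    · intro j hj
      simp [Function.update_of_ne hj.ne]
  | const k =>
    intro r p reg hr hσ hc
    refine ⟨Function.update reg r (BitVec.ofNat w k), Reach.single hc.single ?_, ?_, ?_⟩
    · simp [Instr.exec, Expr.code]
    · simp [Expr.eval]
    · intro j hj
      simp [Function.update_of_ne hj.ne]
  | op o a b iha ihb =>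
    intro r p reg hr hσ hc
    simp only [Expr.bound, max_le_iff] at hr
    obtain ⟨reg₁, h₁, e₁, f₁⟩ := iha r p reg hr.1
      (fun i hi => hσ i (lt_of_lt_of_le hi (le_max_left _ _))) hc.left
    obtain ⟨reg₂, h₂, e₂, f₂⟩ := ihb (r + 1) _ reg₁ (by omega)
      (fun i hi => by
        rw [f₁ i (by omega)]
        exact hσ i (lt_of_lt_of_le hi (le_max_right _ _))) hc.right.left
    refine ⟨Function.update reg₂ r (o.eval (reg₂ r) (reg₂ (r + 1))),
      (h₁.trans h₂).trans (Reach.single hc.right.right.single ?_), ?_, ?_⟩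
    · simp [Instr.exec, Expr.code, Nat.add_assoc]
    · simp [Expr.eval, BinOp.toNat_eval, e₂, f₂ r (by omega), e₁]
    · intro j hj
      rw [Function.update_of_ne hj.ne, f₂ j (by omega), f₁ j hj]
  | read a iha =>
    intro r p reg hr hσ hc
    obtain ⟨reg₁, h₁, e₁, f₁⟩ := iha r p reg hr hσ hc.left
    refine ⟨Function.update reg₁ r (D.getD (reg₁ r).toNat 0),
      h₁.trans (Reach.single hc.right.single ?_), ?_, ?_⟩
    · simp [Instr.exec, Expr.code, Nat.add_assoc]
    · simp [Expr.eval, memory, e₁]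
    · intro j hj
      rw [Function.update_of_ne hj.ne, f₁ j hj]
  | ite a b c d iha ihb ihc ihd =>
    intro r p reg hr hσ hc
    simp only [Expr.bound, max_le_iff] at hr
    simp only [Expr.bound] at hσ
    obtain ⟨⟨hra, hrb⟩, hrc, hrd⟩ := hr
    have Ha := iha r p reg hra (fun i hi => hσ i (by simp [hi]))
    simp only [Expr.code] at hc ⊢
    generalize a.code r p = ca at hc Ha ⊢
    obtain ⟨reg₁, h₁, e₁, f₁⟩ := Ha hc.left
    have Hb := ihb (r + 1) (p + ca.length) reg₁ (by omega)
      (fun i hi => by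
        rw [f₁ i (by omega)]
        exact hσ i (by simp [hi]))
    generalize b.code (r + 1) (p + ca.length) = cb at hc Hb ⊢
    obtain ⟨reg₂, h₂, e₂, f₂⟩ := Hb hc.right.left
    generalize hq : p + ca.length + cb.length = q at hc h₂ ⊢
    have e₃ : (reg₂ r).toNat = a.eval w (memory D) σ := by rw [f₂ r (by omega), e₁]
    have f₃ : ∀ i < r, reg₂ i = reg i := fun i hi => by rw [f₂ i (by omega), f₁ i hi]
    have hlt : reg₂ r < reg₂ (r + 1) ↔ a.eval w (memory D) σ < b.eval w (memory D) σ := by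
      rw [BitVec.lt_def, e₂, e₃]
    have Hd := ihd r (q + 1) reg₂ hrd
      (fun i hi => by
        rw [f₃ i (by omega)]
        exact hσ i (by simp [hi]))
    generalize d.code r (q + 1) = cd at hc Hd ⊢
    have Hc := ihc r (q + 1 + cd.length + 1) reg₂ hrc
      (fun i hi => by
        rw [f₃ i (by omega)]
        exact hσ i (by simp [hi]))
    generalize c.code r (q + 1 + cd.length + 1) = cc at hc Hc ⊢
    have hc₂ := hc.right.right
    rw [hq] at hc₂
    have hj := hc₂.left.single
    have hlen : p + (ca ++ (cb ++ ([Instr.jumpLt r (r + 1) (q + 1 + cd.length + 1)] ++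
        (cd ++ ([Instr.jump (q + 1 + cd.length + 1 + cc.length)] ++ cc))))).length =
        q + 1 + cd.length + 1 + cc.length := by
      simp only [List.length_append, List.length_cons, List.length_nil]; omega
    rw [hlen]
    by_cases hab : a.eval w (memory D) σ < b.eval w (memory D) σ
    · obtain ⟨reg₃, h₃, e₄, f₄⟩ := Hc hc₂.right.right.right
      refine ⟨reg₃, ((h₁.trans h₂).trans ((Reach.single hj ?_).trans h₃)).mono ?_, ?_, ?_⟩
      · simp [Instr.exec, hlt, hab]
      · simp only [Expr.cost]; omega
      · simp [Expr.eval, hab, e₄]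
      · intro i hi
        rw [f₄ i hi, f₃ i hi]
    · obtain ⟨reg₃, h₃, e₄, f₄⟩ := Hd hc₂.right.left
      have hj' := hc₂.right.right.left.single
      refine ⟨reg₃, ((h₁.trans h₂).trans ((Reach.single hj ?_).trans
        (h₃.trans (Reach.single hj' ?_)))).mono ?_, ?_, ?_⟩
      · simp [Instr.exec, hlt, hab]
      · simp [Instr.exec]
      · simp only [Expr.cost]; omega
      · simp [Expr.eval, hab, e₄]
      · intro i hi
        rw [f₄ i hi, f₃ i hi]

namespace Cmd

/-- A strict upper bound for the variables of a command. -/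
def bound : Cmd → ℕ
  | assign d e => max (d + 1) e.bound
  | seq c₁ c₂ => max c₁.bound c₂.bound
  | ite a b c₁ c₂ => max (max a.bound b.bound) (max c₁.bound c₂.bound)
  | .while a b c => max (max a.bound b.bound) c.bound

/-- Code of a command, placed at address `p`; registers from `r` on hold temporary values. -/
def code (r : ℕ) : Cmd → ℕ → List Instr
  | assign d e, p => e.code r p ++ [.op .or d r r]
  | seq c₁ c₂, p => c₁.code r p ++ c₂.code r (p + (c₁.code r p).length)
  | ite a b c₁ c₂, p =>
      let ca := a.code r p
      let cb := b.code (r + 1) (p + ca.length)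
      let q := p + ca.length + cb.length
      let cd := c₂.code r (q + 1)
      let q' := q + 1 + cd.length
      let cc := c₁.code r (q' + 1)
      ca ++ (cb ++ ([.jumpLt r (r + 1) (q' + 1)] ++
        (cd ++ ([.jump (q' + 1 + cc.length)] ++ cc))))
  | .while a b c, p =>
      let ca := a.code r p
      let cb := b.code (r + 1) (p + ca.length)
      let q := p + ca.length + cb.length
      let cc := c.code r (q + 2)
      ca ++ (cb ++ ([.jumpLt r (r + 1) (q + 2)] ++
        ([.jump (q + 2 + cc.length + 1)] ++ (cc ++ [.jump p]))))

end Cmd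

/-- `Runs w M c σ σ' t`: the command `c` transforms the variables `σ` into `σ'` at cost `t`. -/
inductive Runs (w : ℕ) (M : ℕ → ℕ) : Cmd → (ℕ → ℕ) → (ℕ → ℕ) → ℕ → Prop
  | assign (d : ℕ) (e : Expr) (σ : ℕ → ℕ) :
      Runs w M (.assign d e) σ (Function.update σ d (e.eval w M σ)) (e.cost + 1)
  | seq {c₁ c₂ σ σ' σ'' t t'} : Runs w M c₁ σ σ' t → Runs w M c₂ σ' σ'' t' →
      Runs w M (.seq c₁ c₂) σ σ'' (t + t')
  | iteTrue {a b c₁ c₂ σ σ' t} : a.eval w M σ < b.eval w M σ → Runs w M c₁ σ σ' t →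
      Runs w M (.ite a b c₁ c₂) σ σ' (a.cost + b.cost + 2 + t)
  | iteFalse {a b c₁ c₂ σ σ' t} : ¬ a.eval w M σ < b.eval w M σ → Runs w M c₂ σ σ' t →
      Runs w M (.ite a b c₁ c₂) σ σ' (a.cost + b.cost + 2 + t)
  | whileTrue {a b c σ σ' σ'' t t'} : a.eval w M σ < b.eval w M σ → Runs w M c σ σ' t →
      Runs w M (.while a b c) σ' σ'' t' →
      Runs w M (.while a b c) σ σ'' (a.cost + b.cost + 2 + t + t')
  | whileFalse {a b c σ} : ¬ a.eval w M σ < b.eval w M σ →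
      Runs w M (.while a b c) σ σ (a.cost + b.cost + 2)

theorem Expr.reach_test {w : ℕ} {P : Program} {D : List (BitVec w)}
    {mem : BitVec w → BitVec w} {σ : ℕ → ℕ} (a b : Expr) (r p : ℕ) (reg : ℕ → BitVec w)
    (hσ : ∀ i < r, (reg i).toNat = σ i)
    (ha : a.bound ≤ r) (hb : b.bound ≤ r) (hca : CodeAt P p (a.code r p))
    (hcb : CodeAt P (p + (a.code r p).length) (b.code (r + 1) (p + (a.code r p).length))) :
    ∃ reg' : ℕ → BitVec w,
      Reach P D ⟨p, reg, mem⟩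
        ⟨p + (a.code r p).length + (b.code (r + 1) (p + (a.code r p).length)).length, reg', mem⟩
        (a.cost + b.cost) ∧
      (reg' r < reg' (r + 1) ↔ a.eval w (memory D) σ < b.eval w (memory D) σ) ∧
      ∀ i < r, (reg' i).toNat = σ i := by
  obtain ⟨reg₁, h₁, e₁, f₁⟩ := a.reach_code (σ := σ) (mem := mem) r p reg ha
    (fun i hi => hσ i (by omega)) hca
  obtain ⟨reg₂, h₂, e₂, f₂⟩ := b.reach_code (σ := σ) (mem := mem) (r + 1) _ reg₁ (by omega)
    (fun i hi => by rw [f₁ i (by omega)]; exact hσ i (by omega)) hcb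
  refine ⟨reg₂, h₁.trans h₂, ?_, ?_⟩
  · rw [BitVec.lt_def, e₂, f₂ r (by omega), e₁]
  · intro i hi
    rw [f₂ i (by omega), f₁ i hi, hσ i hi]

/-- The induction is on the derivation of the run and not on the command: after one round a loop
jumps back to its own address `p`, where the hypothesis for the remaining rounds applies to the same
code. -/
theorem Runs.reach_code {w : ℕ} {P : Program} {D : List (BitVec w)}
    {mem : BitVec w → BitVec w} {r : ℕ} {c : Cmd} {σ σ' : ℕ → ℕ} {t : ℕ}
    (h : Runs w (memory D) c σ σ' t) : ∀ (p : ℕ) (reg : ℕ → BitVec w), c.bound ≤ r →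
    (∀ i < r, (reg i).toNat = σ i) → CodeAt P p (c.code r p) →
    ∃ reg' : ℕ → BitVec w,
      Reach P D ⟨p, reg, mem⟩ ⟨p + (c.code r p).length, reg', mem⟩ t ∧
      ∀ i < r, (reg' i).toNat = σ' i := by
  induction h with
  | assign d e σ =>
    intro p reg hr hσ hc
    simp only [Cmd.bound, max_le_iff] at hr
    obtain ⟨reg₁, h₁, e₁, f₁⟩ := e.reach_code (σ := σ) (mem := mem) r p reg hr.2
      (fun i hi => hσ i (by omega)) hc.left
    refine ⟨Function.update reg₁ d (reg₁ r), h₁.trans (Reach.single hc.right.single ?_), ?_⟩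
    · simp [Instr.exec, BinOp.eval, Cmd.code, Nat.add_assoc]
    · intro i hi
      by_cases hid : i = d
      · subst hid; simp [e₁]
      · rw [Function.update_of_ne hid, Function.update_of_ne hid, f₁ i hi, hσ i hi]
  | seq _ _ ih₁ ih₂ =>
    intro p reg hr hσ hc
    simp only [Cmd.bound, max_le_iff] at hr
    obtain ⟨reg₁, h₁, f₁⟩ := ih₁ p reg hr.1 hσ hc.left
    obtain ⟨reg₂, h₂, f₂⟩ := ih₂ _ reg₁ hr.2 f₁ hc.right
    refine ⟨reg₂, ?_, f₂⟩
    simpa [Cmd.code, Nat.add_assoc] using h₁.trans h₂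
  | @iteTrue a b c₁ c₂ σ σ' t hab _ ih =>
    intro p reg hr hσ hc
    simp only [Cmd.bound, max_le_iff] at hr
    obtain ⟨⟨hra, hrb⟩, hr₁, hr₂⟩ := hr
    simp only [Cmd.code] at hc ⊢
    obtain ⟨reg₁, h₁, e₁, f₁⟩ := Expr.reach_test (D := D) (mem := mem) a b r p reg hσ hra hrb
      hc.left hc.right.left
    generalize a.code r p = ca at *
    generalize b.code (r + 1) (p + ca.length) = cb at *
    have hc₂ := hc.right.right
    generalize hq : p + ca.length + cb.length = q at *
    have Hc := ih (q + 1 + (c₂.code r (q + 1)).length + 1) reg₁ hr₁ f₁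
    generalize c₂.code r (q + 1) = cd at *
    generalize c₁.code r (q + 1 + cd.length + 1) = cc at *
    obtain ⟨reg₂, h₂, f₂⟩ := Hc hc₂.right.right.right
    refine ⟨reg₂, ?_, f₂⟩
    have := (h₁.trans (Reach.single hc₂.left.single (by simp [Instr.exec, e₁, hab]))).trans h₂
    convert this.mono (T' := a.cost + b.cost + 2 + t) (by omega) using 2
    simp only [List.length_append, List.length_cons, List.length_nil]; omega
  | @iteFalse a b c₁ c₂ σ σ' t hab _ ih =>
    intro p reg hr hσ hc
    simp only [Cmd.bound, max_le_iff] at hr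
    obtain ⟨⟨hra, hrb⟩, hr₁, hr₂⟩ := hr
    simp only [Cmd.code] at hc ⊢
    obtain ⟨reg₁, h₁, e₁, f₁⟩ := Expr.reach_test (D := D) (mem := mem) a b r p reg hσ hra hrb
      hc.left hc.right.left
    generalize a.code r p = ca at *
    generalize b.code (r + 1) (p + ca.length) = cb at *
    have hc₂ := hc.right.right
    generalize hq : p + ca.length + cb.length = q at *
    have Hc := ih (q + 1) reg₁ hr₂ f₁
    generalize c₂.code r (q + 1) = cd at *
    generalize c₁.code r (q + 1 + cd.length + 1) = cc at *
    obtain ⟨reg₂, h₂, f₂⟩ := Hc hc₂.right.left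
    refine ⟨reg₂, ?_, f₂⟩
    have h₃ : Reach P D ⟨q + 1 + cd.length, reg₂, mem⟩
        ⟨q + 1 + cd.length + 1 + cc.length, reg₂, mem⟩ 1 :=
      Reach.single hc₂.right.right.left.single (by simp [Instr.exec])
    have := ((h₁.trans (Reach.single hc₂.left.single (by simp [Instr.exec, e₁, hab]))).trans
      h₂).trans h₃
    convert this.mono (T' := a.cost + b.cost + 2 + t) (by omega) using 2
    simp only [List.length_append, List.length_cons, List.length_nil]; omega
  | @whileTrue a b c σ σ' σ'' t t' hab _ _ ih ih' =>
    intro p reg hr hσ hc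
    have hr' := hr
    have hc' := hc
    simp only [Cmd.bound, max_le_iff] at hr
    obtain ⟨⟨hra, hrb⟩, hr₁⟩ := hr
    simp only [Cmd.code] at hc
    obtain ⟨reg₁, h₁, e₁, f₁⟩ := Expr.reach_test (D := D) (mem := mem) a b r p reg hσ hra hrb
      hc.left hc.right.left
    have hc₂ := hc.right.right
    obtain ⟨reg₂, h₂, f₂⟩ := ih (p + (a.code r p).length +
      (b.code (r + 1) (p + (a.code r p).length)).length + 2) reg₁ hr₁ f₁ hc₂.right.right.left
    obtain ⟨reg₃, h₃, f₃⟩ := ih' p reg₂ hr' f₂ hc'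
    refine ⟨reg₃, ?_, f₃⟩
    have := ((h₁.trans (Reach.single hc₂.left.single (by simp [Instr.exec, e₁, hab]))).trans
      h₂).trans ((Reach.single hc₂.right.right.right.single (by simp [Instr.exec])).trans h₃)
    exact this.mono (by omega)
  | @whileFalse a b c σ hab =>
    intro p reg hr hσ hc
    simp only [Cmd.bound, max_le_iff] at hr
    obtain ⟨⟨hra, hrb⟩, hr₁⟩ := hr
    simp only [Cmd.code] at hc ⊢
    obtain ⟨reg₁, h₁, e₁, f₁⟩ := Expr.reach_test (D := D) (mem := mem) a b r p reg hσ hra hrb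
      hc.left hc.right.left
    generalize a.code r p = ca at *
    generalize b.code (r + 1) (p + ca.length) = cb at *
    have hc₂ := hc.right.right
    generalize hq : p + ca.length + cb.length = q at *
    generalize c.code r (q + 2) = cc at *
    refine ⟨reg₁, ?_, f₁⟩
    have h₃ : Reach P D ⟨q + 1, reg₁, mem⟩ ⟨q + 2 + cc.length + 1, reg₁, mem⟩ 1 :=
      Reach.single hc₂.right.left.single (by simp [Instr.exec])
    have := (h₁.trans (Reach.single hc₂.left.single (by simp [Instr.exec, e₁, hab]))).trans h₃
    convert this using 2
    simp only [List.length_append, List.length_cons, List.length_nil]; omega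

/-- The machine program of a command. -/
def Cmd.program (c : Cmd) : Program := c.code (c.bound + 2) 0 ++ [Instr.halt]

/-- Initial values of the variables for the query `x`. -/
def start (x : ℕ) : ℕ → ℕ := Function.update (fun _ => 0) 0 x

theorem Runs.returns {w : ℕ} {D : List (BitVec w)} {c : Cmd} {x t : ℕ} {σ' : ℕ → ℕ} {T : ℝ}
    (hx : x < 2 ^ w) (h : Runs w (memory D) c (start x) σ' t) (hT : (t : ℝ) ≤ T) :
    Returns c.program D x T (σ' 0) (σ' 1) := by
  have hcode : CodeAt c.program 0 (c.code (c.bound + 2) 0) := by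
    intro i hi
    simp [Cmd.program, List.getElem?_append_left hi]
  -- The summand `2` keeps the output registers `0` and `1` below the temporaries even if `c` does
  -- not mention them.
  obtain ⟨reg', ⟨s, hs, e⟩, f⟩ := h.reach_code (r := c.bound + 2) (mem := fun _ => 0) 0
    (init (BitVec.ofNat w x)).reg (by omega) (by
      intro i hi
      by_cases h0 : i = 0
      · subst h0; simp [init, start, Nat.mod_eq_of_lt hx]
      · simp [init, start, h0]) hcode
  have e' : (step c.program D)^[s] (init (BitVec.ofNat w x)) =
      ⟨0 + (c.code (c.bound + 2) 0).length, reg', fun _ => 0⟩ := e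
  refine ⟨s, le_trans (by exact_mod_cast hs) hT, ?_, ?_, ?_⟩
  · rw [e']; simp [Halted, Cmd.program]
  · rw [e']; exact f 0 (by omega)
  · rw [e']; exact f 1 (by omega)

end WordRAM

/-! ### Evaluation of expressions without overflow, and binary search. -/

namespace WordRAM

namespace Expr

instance (n : ℕ) : OfNat Expr n := ⟨.const n⟩
instance : Add Expr := ⟨.op .add⟩
instance : Sub Expr := ⟨.op .sub⟩
instance : Mul Expr := ⟨.op .mul⟩
instance : Div Expr := ⟨.op .div⟩
instance : AndOp Expr := ⟨.op .and⟩
instance : OrOp Expr := ⟨.op .or⟩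
instance : HShiftLeft Expr Expr Expr := ⟨.op .shl⟩
instance : HShiftRight Expr Expr Expr := ⟨.op .shr⟩

section Eval
variable {w : ℕ} {M σ : ℕ → ℕ} {a b c d : Expr} {x y z : ℕ}

theorem eval_var (i : ℕ) (h : σ i = x) : (var i).eval w M σ = x := h

theorem eval_lit (k : ℕ) (h : k < 2 ^ w) : (OfNat.ofNat k : Expr).eval w M σ = k :=
  Nat.mod_eq_of_lt h

theorem eval_add (ha : a.eval w M σ = x) (hb : b.eval w M σ = y) (h : x + y < 2 ^ w) :
    (a + b).eval w M σ = x + y := by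
  change (a.eval w M σ + b.eval w M σ) % 2 ^ w = x + y
  rw [ha, hb, Nat.mod_eq_of_lt h]

theorem eval_sub (ha : a.eval w M σ = x) (hb : b.eval w M σ = y) (h : y ≤ x) (hx : x < 2 ^ w) :
    (a - b).eval w M σ = x - y := by
  change (2 ^ w - b.eval w M σ + a.eval w M σ) % 2 ^ w = x - y
  rw [ha, hb, show 2 ^ w - y + x = x - y + 2 ^ w by omega, Nat.add_mod_right,
    Nat.mod_eq_of_lt (by omega)]

theorem eval_mul_mod (ha : a.eval w M σ = x) (hb : b.eval w M σ = y) :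
    (a * b).eval w M σ = x * y % 2 ^ w := by
  change (a.eval w M σ * b.eval w M σ) % 2 ^ w = _
  rw [ha, hb]

theorem eval_mul (ha : a.eval w M σ = x) (hb : b.eval w M σ = y) (h : x * y < 2 ^ w) :
    (a * b).eval w M σ = x * y := by
  rw [eval_mul_mod ha hb, Nat.mod_eq_of_lt h]

theorem eval_div (ha : a.eval w M σ = x) (hb : b.eval w M σ = y) :
    (a / b).eval w M σ = x / y := by
  change a.eval w M σ / b.eval w M σ = _
  rw [ha, hb]

theorem eval_and (ha : a.eval w M σ = x) (hb : b.eval w M σ = y) :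
    (a &&& b).eval w M σ = x &&& y := by
  change a.eval w M σ &&& b.eval w M σ = _
  rw [ha, hb]

theorem eval_or (ha : a.eval w M σ = x) (hb : b.eval w M σ = y) :
    (a ||| b).eval w M σ = x ||| y := by
  change a.eval w M σ ||| b.eval w M σ = _
  rw [ha, hb]

theorem eval_mask (ha : a.eval w M σ = x) (hb : b.eval w M σ = 2 ^ y - 1) :
    (a &&& b).eval w M σ = x % 2 ^ y := by
  rw [eval_and ha hb, Nat.and_two_pow_sub_one_eq_mod]

theorem eval_shl_mod (ha : a.eval w M σ = x) (hb : b.eval w M σ = y) :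
    (a <<< b).eval w M σ = x * 2 ^ y % 2 ^ w := by
  change (a.eval w M σ <<< b.eval w M σ) % 2 ^ w = _
  rw [ha, hb, Nat.shiftLeft_eq]

theorem eval_shl (ha : a.eval w M σ = x) (hb : b.eval w M σ = y) (h : x * 2 ^ y < 2 ^ w) :
    (a <<< b).eval w M σ = x * 2 ^ y := by
  rw [eval_shl_mod ha hb, Nat.mod_eq_of_lt h]

theorem eval_shr (ha : a.eval w M σ = x) (hb : b.eval w M σ = y) :
    (a >>> b).eval w M σ = x / 2 ^ y := by
  change a.eval w M σ >>> b.eval w M σ = _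
  rw [ha, hb, Nat.shiftRight_eq_div_pow]

theorem eval_read (ha : a.eval w M σ = x) (h : M x = y) : (read a).eval w M σ = y := by
  simp [eval, ha, h]

theorem eval_ite (ha : a.eval w M σ = x) (hb : b.eval w M σ = y)
    (hc : x < y → c.eval w M σ = z) (hd : ¬ x < y → d.eval w M σ = z) :
    (ite a b c d).eval w M σ = z := by
  simp only [eval, ha, hb]
  split_ifs with h
  exacts [hc h, hd h]

theorem eval_read_lit (k : ℕ) (h : k < 2 ^ w) : (read (OfNat.ofNat k)).eval w M σ = M k :=
  eval_read (eval_lit k h) rfl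

end Eval

end Expr

theorem Runs.assign_of_eq {w : ℕ} {M σ : ℕ → ℕ} {d v : ℕ} {e : Expr} (h : e.eval w M σ = v) :
    Runs w M (.assign d e) σ (Function.update σ d v) (e.cost + 1) :=
  h ▸ Runs.assign d e σ

/-- Binary search for the boundary between `lo` and `hi` of the predicate `0 < p`, evaluated with
the candidate in the variable `mid`. -/
def Cmd.bsearch (lo hi mid : ℕ) (p : Expr) : Cmd :=
  .while (.var lo + 1) (.var hi)
    (.seq (.assign mid ((.var lo + .var hi) / 2))
      (.ite 0 p (.assign lo (.var mid)) (.assign hi (.var mid))))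

/-- The invariant is that `lo` is the initial `a` or satisfies `P`, and `hi` is the initial `b` or
violates `P`, while the gap is at most `2 ^ s`. Hence `P` need not be monotone: any place where it
changes is an admissible result. The test is required to be correct for all values of the variables
`lo` and `hi`, since the loop alters them; `2 * b < 2 ^ w` keeps `lo + hi` within a word. -/
theorem runs_bsearch_aux {w : ℕ} (hw : 2 ≤ w) {M σ : ℕ → ℕ} {lo hi mid : ℕ} {p : Expr}
    (h₁ : lo ≠ hi) (h₂ : lo ≠ mid) (h₃ : hi ≠ mid) {P : ℕ → Prop} {a b : ℕ}
    (hb : 2 * b < 2 ^ w)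
    (hp : ∀ m a' b', a < m → m < b →
      (0 < p.eval w M (Function.update (Function.update (Function.update σ lo a') hi b') mid m) ↔
        P m)) (s : ℕ) : ∀ a₁ b₁ m₁, a ≤ a₁ → a₁ < b₁ → b₁ ≤ b → b₁ ≤ a₁ + 2 ^ s →
    (a₁ = a ∨ P a₁) → (b₁ = b ∨ ¬ P b₁) →
    ∃ a' b' m' t, Runs w M (Cmd.bsearch lo hi mid p)
      (Function.update (Function.update (Function.update σ lo a₁) hi b₁) mid m₁)
      (Function.update (Function.update (Function.update σ lo a') hi b') mid m') t ∧
      a ≤ a' ∧ a' < b ∧ (a' = a ∨ P a') ∧ (a' + 1 = b ∨ ¬ P (a' + 1)) ∧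
      t ≤ (p.cost + 30) * (s + 1) := by
  have h1 : (1 : ℕ) < 2 ^ w := Nat.one_lt_two_pow (by omega)
  have h2 : (2 : ℕ) < 2 ^ w := by
    calc 2 < 2 ^ 2 := by norm_num
      _ ≤ 2 ^ w := Nat.pow_le_pow_right (by norm_num) hw
  have test : ∀ a₁ b₁ m₁, a₁ < b → ((Expr.var lo + 1).eval w M
      (Function.update (Function.update (Function.update σ lo a₁) hi b₁) mid m₁) = a₁ + 1 ∧
      (Expr.var hi).eval w M
        (Function.update (Function.update (Function.update σ lo a₁) hi b₁) mid m₁) = b₁) := by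
    intro a₁ b₁ m₁ h
    refine ⟨Expr.eval_add (Expr.eval_var lo ?_) (Expr.eval_lit 1 h1) (by omega),
      Expr.eval_var hi ?_⟩
    · simp [h₁, h₂]
    · simp [h₃]
  have done : ∀ s a₁ b₁ m₁, a ≤ a₁ → a₁ + 1 = b₁ → b₁ ≤ b →
      (a₁ = a ∨ P a₁) → (b₁ = b ∨ ¬ P b₁) →
      ∃ a' b' m' t, Runs w M (Cmd.bsearch lo hi mid p)
      (Function.update (Function.update (Function.update σ lo a₁) hi b₁) mid m₁)
      (Function.update (Function.update (Function.update σ lo a') hi b') mid m') t ∧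
      a ≤ a' ∧ a' < b ∧ (a' = a ∨ P a') ∧ (a' + 1 = b ∨ ¬ P (a' + 1)) ∧
      t ≤ (p.cost + 30) * (s + 1) := by
    intro s a₁ b₁ m₁ ha hab hb' hPa hPb
    refine ⟨a₁, b₁, m₁, _, Runs.whileFalse ?_, ha, by omega, hPa, hab ▸ hPb, ?_⟩
    · rw [(test a₁ b₁ m₁ (by omega)).1, (test a₁ b₁ m₁ (by omega)).2]; omega
    · change 1 + 1 + 1 + 1 + 2 ≤ _
      nlinarith
  induction s with
  | zero =>
    intro a₁ b₁ m₁ ha hab hb' hs hPa hPb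
    exact done 0 a₁ b₁ m₁ ha (by omega) hb' hPa hPb
  | succ s ih =>
    intro a₁ b₁ m₁ ha hab hb' hs hPa hPb
    by_cases hlt : a₁ + 1 < b₁
    swap
    · exact done _ a₁ b₁ m₁ ha (by omega) hb' hPa hPb
    set σ₁ := Function.update (Function.update (Function.update σ lo a₁) hi b₁) mid m₁ with hσ₁
    set m := (a₁ + b₁) / 2 with hm
    have hmid : ((Expr.var lo + Expr.var hi) / 2).eval w M σ₁ = m := by
      refine Expr.eval_div (Expr.eval_add (Expr.eval_var lo ?_) (Expr.eval_var hi ?_) (by omega))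
        (Expr.eval_lit 2 h2)
      · simp [hσ₁, h₁, h₂]
      · simp [hσ₁, h₃]
    have hσ₂ : Function.update σ₁ mid m =
        Function.update (Function.update (Function.update σ lo a₁) hi b₁) mid m := by
      simp [hσ₁]
    have hpow : 2 ^ (s + 1) = 2 * 2 ^ s := by ring
    have hPm := hp m a₁ b₁ (by omega) (by omega)
    have hzero : (0 : Expr).eval w M (Function.update σ₁ mid m) = 0 :=
      Expr.eval_lit 0 (by omega)
    have hr₁ := Runs.assign (w := w) (M := M) mid ((Expr.var lo + Expr.var hi) / 2) σ₁
    rw [hmid] at hr₁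
    have hloop : (Expr.var lo + 1).eval w M σ₁ < (Expr.var hi).eval w M σ₁ := by
      rw [(test a₁ b₁ m₁ (by omega)).1, (test a₁ b₁ m₁ (by omega)).2]; exact hlt
    by_cases hP : P m
    · have hr₂ := Runs.assign (w := w) (M := M) lo (Expr.var mid) (Function.update σ₁ mid m)
      have e : Function.update (Function.update σ₁ mid m) lo
          ((Expr.var mid).eval w M (Function.update σ₁ mid m)) =
          Function.update (Function.update (Function.update σ lo m) hi b₁) mid m := by
        rw [Expr.eval_var (x := m) mid (by simp), hσ₂]
        funext i
        simp only [Function.update_apply]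
        split_ifs <;> simp_all
      rw [e] at hr₂
      have hr₃ := Runs.seq hr₁ (Runs.iteTrue (a := 0) (b := p) (c₁ := .assign lo (.var mid))
        (c₂ := .assign hi (.var mid)) (by rw [hzero, hσ₂]; exact hPm.2 hP) hr₂)
      obtain ⟨a', b', m', t, hr, c₁, c₂, c₃, c₄, ht⟩ :=
        ih m b₁ m (by omega) (by omega) hb' (by omega) (Or.inr hP) hPb
      refine ⟨a', b', m', _, Runs.whileTrue hloop hr₃ hr, c₁, c₂, c₃, c₄, ?_⟩
      change 1 + 1 + 1 + 1 + 2 + (1 + 1 + 1 + 1 + 1 + 1 + (1 + p.cost + 2 + (1 + 1))) + t ≤ _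
      nlinarith
    · have hr₂ := Runs.assign (w := w) (M := M) hi (Expr.var mid) (Function.update σ₁ mid m)
      have e : Function.update (Function.update σ₁ mid m) hi
          ((Expr.var mid).eval w M (Function.update σ₁ mid m)) =
          Function.update (Function.update (Function.update σ lo a₁) hi m) mid m := by
        rw [Expr.eval_var (x := m) mid (by simp), hσ₂]
        funext i
        simp only [Function.update_apply]
        split_ifs <;> simp_all
      rw [e] at hr₂
      have hr₃ := Runs.seq hr₁ (Runs.iteFalse (a := 0) (b := p) (c₁ := .assign lo (.var mid))
        (c₂ := .assign hi (.var mid)) (by rw [hzero, hσ₂]; exact fun h => hP (hPm.1 h)) hr₂)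
      obtain ⟨a', b', m', t, hr, c₁, c₂, c₃, c₄, ht⟩ :=
        ih a₁ m m ha (by omega) (by omega) (by omega) hPa (Or.inr hP)
      refine ⟨a', b', m', _, Runs.whileTrue hloop hr₃ hr, c₁, c₂, c₃, c₄, ?_⟩
      change 1 + 1 + 1 + 1 + 2 + (1 + 1 + 1 + 1 + 1 + 1 + (1 + p.cost + 2 + (1 + 1))) + t ≤ _
      nlinarith

theorem runs_bsearch {w : ℕ} (hw : 2 ≤ w) {M σ : ℕ → ℕ} {lo hi mid : ℕ} {p : Expr}
    (h₁ : lo ≠ hi) (h₂ : lo ≠ mid) (h₃ : hi ≠ mid) (P : ℕ → Prop) {a b : ℕ}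
    (hlo : σ lo = a) (hhi : σ hi = b) (hab : a < b) (hb : 2 * b < 2 ^ w)
    (hp : ∀ m a' b', a < m → m < b →
      (0 < p.eval w M (Function.update (Function.update (Function.update σ lo a') hi b') mid m) ↔
        P m)) :
    ∃ a' b' m' t, Runs w M (Cmd.bsearch lo hi mid p) σ
      (Function.update (Function.update (Function.update σ lo a') hi b') mid m') t ∧
      a ≤ a' ∧ a' < b ∧ (a' = a ∨ P a') ∧ (a' + 1 = b ∨ ¬ P (a' + 1)) ∧
      t ≤ (p.cost + 30) * (Nat.clog 2 b + 1) := by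
  have hs : b ≤ a + 2 ^ Nat.clog 2 b :=
    (Nat.le_pow_clog (by norm_num) b).trans (Nat.le_add_left _ _)
  have := runs_bsearch_aux hw h₁ h₂ h₃ hb hp (Nat.clog 2 b) a b (σ mid) le_rfl hab le_rfl hs
    (Or.inl rfl) (Or.inl rfl)
  rwa [show Function.update (Function.update (Function.update σ lo a) hi b) mid (σ mid) = σ by
    subst hlo hhi; simp] at this

end WordRAM

/-! ### Words as arrays of fields: parallel comparison, counting and extraction. -/

namespace WordRAM
open Finset

/-- The number with the `s` fields `a 0, …, a (s - 1)` of width `f`, lowest first. -/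
def pack (f s : ℕ) (a : ℕ → ℕ) : ℕ := ∑ i ∈ range s, a i * 2 ^ (f * i)

theorem pack_zero (f : ℕ) (a : ℕ → ℕ) : pack f 0 a = 0 := by simp [pack]

theorem pack_succ (f s : ℕ) (a : ℕ → ℕ) : pack f (s + 1) a = pack f s a + a s * 2 ^ (f * s) := by
  simp [pack, sum_range_succ]

theorem pack_succ_left (f s : ℕ) (a : ℕ → ℕ) :
    pack f (s + 1) a = 2 ^ f * pack f s (fun i => a (i + 1)) + a 0 := by
  simp only [pack, sum_range_succ', mul_sum, Nat.mul_zero, pow_zero, Nat.mul_one]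
  congr 1
  refine sum_congr rfl fun i _ => ?_
  rw [Nat.mul_add, pow_add]; ring

theorem pack_congr {f s : ℕ} {a b : ℕ → ℕ} (h : ∀ i < s, a i = b i) : pack f s a = pack f s b :=
  sum_congr rfl fun i hi => by rw [h i (mem_range.1 hi)]

theorem pack_lt {f s : ℕ} {a : ℕ → ℕ} (h : ∀ i < s, a i < 2 ^ f) : pack f s a < 2 ^ (f * s) := by
  induction s with
  | zero => simp [pack_zero]
  | succ s ih =>
    rw [pack_succ, Nat.mul_succ, pow_add]
    have h₁ := ih fun i hi => h i (by omega)
    have h₂ := h s (by omega)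
    nlinarith [Nat.mul_le_mul_right (2 ^ (f * s)) (Nat.succ_le_of_lt h₂)]

theorem pack_add (f s : ℕ) (a b : ℕ → ℕ) :
    pack f s a + pack f s b = pack f s fun i => a i + b i := by
  simp [pack, ← sum_add_distrib, Nat.add_mul]

theorem pack_sub {f s : ℕ} {a b : ℕ → ℕ} (h : ∀ i < s, b i ≤ a i) :
    pack f s a - pack f s b = pack f s fun i => a i - b i := by
  rw [Nat.sub_eq_iff_eq_add, pack_add]
  · exact pack_congr fun i hi => by have := h i hi; omega
  · exact sum_le_sum fun i hi => Nat.mul_le_mul_right _ (h i (mem_range.1 hi))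

theorem mul_pack (f s q : ℕ) (a : ℕ → ℕ) : q * pack f s a = pack f s fun i => q * a i := by
  simp [pack, mul_sum, Nat.mul_assoc]

theorem pack_mul (f s q : ℕ) (a : ℕ → ℕ) : pack f s a * q = pack f s fun i => a i * q := by
  rw [Nat.mul_comm, mul_pack]
  exact pack_congr fun i _ => Nat.mul_comm _ _

theorem pack_append (f s t : ℕ) (a : ℕ → ℕ) :
    pack f (s + t) a = 2 ^ (f * s) * pack f t (fun i => a (s + i)) + pack f s a := by
  simp only [pack, sum_range_add, mul_sum]
  rw [Nat.add_comm]
  congr 1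
  refine sum_congr rfl fun i _ => ?_
  rw [Nat.mul_add, pow_add]; ring

theorem pack_div {f s t : ℕ} {a : ℕ → ℕ} (h : ∀ i < s, a i < 2 ^ f) (ht : t ≤ s) :
    pack f s a / 2 ^ (f * t) = pack f (s - t) fun i => a (t + i) := by
  obtain ⟨r, rfl⟩ := Nat.exists_eq_add_of_le ht
  rw [pack_append, Nat.mul_add_div (by positivity),
    Nat.div_eq_of_lt (pack_lt fun i hi => h i (by omega))]
  simp

theorem pack_mod {f s t : ℕ} {a : ℕ → ℕ} (h : ∀ i < s, a i < 2 ^ f) (ht : t ≤ s) :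
    pack f s a % 2 ^ (f * t) = pack f t a := by
  obtain ⟨r, rfl⟩ := Nat.exists_eq_add_of_le ht
  rw [pack_append, Nat.mul_add_mod,
    Nat.mod_eq_of_lt (pack_lt fun i hi => h i (by omega))]

theorem pack_one (f : ℕ) (a : ℕ → ℕ) : pack f 1 a = a 0 := by simp [pack]

theorem pack_field {f s i : ℕ} {a : ℕ → ℕ} (h : ∀ i < s, a i < 2 ^ f) (hi : i < s) :
    pack f s a / 2 ^ (f * i) % 2 ^ f = a i := by
  rw [pack_div h hi.le]
  have := pack_mod (f := f) (s := s - i) (t := 1) (a := fun j => a (i + j))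
    (fun j hj => h _ (by omega)) (by omega)
  rw [Nat.mul_one] at this
  rw [this, pack_one, Nat.add_zero]

theorem testBit_pack {f : ℕ} (hf : 0 < f) {s : ℕ} : ∀ {a : ℕ → ℕ}, (∀ i < s, a i < 2 ^ f) →
    ∀ j, (pack f s a).testBit j = (decide (j < f * s) && (a (j / f)).testBit (j % f)) := by
  induction s with
  | zero => intro a _ j; simp [pack_zero]
  | succ s ih =>
    intro a h j
    rw [pack_succ_left, Nat.testBit_two_pow_mul_add _ (h 0 (by omega))]
    by_cases hj : j < f
    · have : j < f * (s + 1) := lt_of_lt_of_le hj (Nat.le_mul_of_pos_right _ (by omega))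
      simp [hj, this, Nat.div_eq_of_lt hj, Nat.mod_eq_of_lt hj]
    · rw [if_neg hj, ih fun i hi => h _ (by omega)]
      have e : j = j - f + f := by omega
      have e₁ : j / f = (j - f) / f + 1 := by
        conv_lhs => rw [e]
        exact Nat.add_div_right _ hf
      have e₂ : j % f = (j - f) % f := by
        conv_lhs => rw [e]
        exact Nat.add_mod_right _ _
      have e₃ : j - f < f * s ↔ j < f * (s + 1) := by rw [Nat.mul_succ]; omega
      rw [e₁, e₂]
      simp [e₃]

theorem pack_and {f s : ℕ} (hf : 0 < f) {a b : ℕ → ℕ} (ha : ∀ i < s, a i < 2 ^ f)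
    (hb : ∀ i < s, b i < 2 ^ f) :
    pack f s a &&& pack f s b = pack f s fun i => a i &&& b i := by
  refine Nat.eq_of_testBit_eq fun j => ?_
  rw [Nat.testBit_and, testBit_pack hf ha, testBit_pack hf hb,
    testBit_pack hf fun i hi => lt_of_le_of_lt Nat.and_le_left (ha i hi), Nat.testBit_and]
  cases decide (j < f * s) <;> simp

theorem pack_div_pow {f g s : ℕ} {a : ℕ → ℕ} (h : ∀ i < s, 2 ^ g ∣ a i) :
    pack f s a / 2 ^ g = pack f s fun i => a i / 2 ^ g := by
  rw [Nat.div_eq_iff_eq_mul_left (by positivity)]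
  · rw [pack_mul]
    exact pack_congr fun i hi => (Nat.div_mul_cancel (h i hi)).symm
  · exact dvd_sum fun i hi => Dvd.dvd.mul_right (h i (mem_range.1 hi)) _

/-- Multiplication by the number with all fields `1` yields the prefix sums of the fields. -/
theorem pack_mul_ones_mod (f : ℕ) (s : ℕ) : ∀ z : ℕ → ℕ,
    pack f s z * pack f s (fun _ => 1) ≡ pack f s (fun i => ∑ j ∈ range (i + 1), z j)
      [MOD 2 ^ (f * s)] := by
  induction s with
  | zero => intro z; simp [pack_zero, Nat.ModEq]
  | succ s ih =>
    intro z
    have e₁ : pack f (s + 1) z * pack f (s + 1) (fun _ => 1) =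
        z 0 * pack f (s + 1) (fun _ => 1) + 2 ^ f * (pack f s (fun i => z (i + 1)) *
          pack f s (fun _ => 1)) + 2 ^ (f * (s + 1)) * pack f s (fun i => z (i + 1)) := by
      rw [pack_succ_left f s z, Nat.add_mul, pack_succ f s (fun _ => 1), Nat.mul_succ, pow_add]
      ring
    have e₂ : pack f (s + 1) (fun i => ∑ j ∈ range (i + 1), z j) =
        z 0 * pack f (s + 1) (fun _ => 1) +
          2 ^ f * pack f s (fun i => ∑ j ∈ range (i + 1), z (j + 1)) := by
      rw [pack_succ_left f s, pack_succ_left f s]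
      have : pack f s (fun i => ∑ j ∈ range (i + 1 + 1), z j) =
          z 0 * pack f s (fun _ => 1) + pack f s (fun i => ∑ j ∈ range (i + 1), z (j + 1)) := by
        rw [mul_pack, pack_add]
        refine pack_congr fun i _ => ?_
        rw [sum_range_succ' _ (i + 1)]; ring
      rw [this]
      simp
      ring
    rw [e₁, e₂]
    have e₃ : 2 ^ (f * (s + 1)) = 2 ^ f * 2 ^ (f * s) := by rw [Nat.mul_succ, pow_add]; ring
    have h := (ih fun i => z (i + 1)).mul_left' (2 ^ f)
    rw [← e₃] at h
    have h₂ : 2 ^ (f * (s + 1)) * pack f s (fun i => z (i + 1)) ≡ 0 [MOD 2 ^ (f * (s + 1))] := by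
      simp [Nat.ModEq]
    simpa using ((Nat.ModEq.refl (z 0 * pack f (s + 1) fun _ => 1)).add h).add h₂

/-- The product also has fields above the `s` prefix sums; reduction modulo `2 ^ (f * s)` removes
them, and the machine's truncation modulo `2 ^ w` before it is harmless. -/
theorem prefixSum_mod {f s w : ℕ} {z : ℕ → ℕ} (hw : f * s ≤ w)
    (hz : ∀ i < s, ∑ j ∈ range (i + 1), z j < 2 ^ f) :
    pack f s z * pack f s (fun _ => 1) % 2 ^ w % 2 ^ (f * s) =
      pack f s fun i => ∑ j ∈ range (i + 1), z j := by
  rw [Nat.mod_mod_of_dvd _ (pow_dvd_pow 2 hw), pack_mul_ones_mod f s z]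
  exact Nat.mod_eq_of_lt (pack_lt hz)

/-- Fieldwise comparison. -/
theorem pack_compare {g s : ℕ} {a b : ℕ → ℕ} (ha : ∀ i < s, a i ≤ 2 ^ g)
    (hb : ∀ i < s, b i < 2 ^ g) :
    ((pack (g + 1) s b + pack (g + 1) s fun _ => 2 ^ g) - pack (g + 1) s a) &&&
      (pack (g + 1) s fun _ => 2 ^ g) =
    pack (g + 1) s fun i => if a i ≤ b i then 2 ^ g else 0 := by
  have hp : 2 ^ (g + 1) = 2 * 2 ^ g := by ring
  -- With the spare top bit of every field of `b` set, the subtraction borrows nothing across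
  -- fields, and the top bit survives exactly where `a i ≤ b i`.
  rw [pack_add, pack_sub (fun i hi => by have := ha i hi; omega), pack_and (by omega)
    (fun i hi => by have := hb i hi; omega) (fun i hi => by have := Nat.two_pow_pos g; omega)]
  refine pack_congr fun i hi => ?_
  have h₁ := ha i hi
  have h₂ := hb i hi
  rw [Nat.and_two_pow]
  split_ifs with h
  · rw [show b i + 2 ^ g - a i = 2 ^ g + (b i - a i) by omega, Nat.testBit_two_pow_add_eq,
      Nat.testBit_lt_two_pow (by omega)]
    simp
  · rw [Nat.testBit_lt_two_pow (by omega)]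
    simp

/-- Counts the fields of `word` that are at most `q`. -/
def Expr.count (ones tops f₁ fs mask word q : Expr) : Expr :=
  ((((((q * ones + tops) - word) &&& tops) >>> f₁) * ones) >>> fs) &&& mask

/-- The multiplication `q * ones` copies the query into every field, the comparison leaves one
indicator bit per field, and the second multiplication by `ones` collects their sum in the highest
of the `s` fields. The value `2 ^ g` is allowed for `a i` but not for `v`, so it can serve as
padding that is never counted. -/
theorem Expr.eval_count {w : ℕ} {M σ : ℕ → ℕ} {ones tops f₁ fs mask word q : Expr}
    {g s v : ℕ} {a : ℕ → ℕ} (hs : 0 < s) (hw : (g + 1) * s ≤ w) (hsg : s < 2 ^ (g + 1))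
    (hones : ones.eval w M σ = pack (g + 1) s fun _ => 1)
    (htops : tops.eval w M σ = pack (g + 1) s fun _ => 2 ^ g)
    (hf₁ : f₁.eval w M σ = g) (hfs : fs.eval w M σ = (g + 1) * (s - 1))
    (hmask : mask.eval w M σ = 2 ^ (g + 1) - 1)
    (hword : word.eval w M σ = pack (g + 1) s a) (hq : q.eval w M σ = v)
    (ha : ∀ i < s, a i ≤ 2 ^ g) (hv : v < 2 ^ g) :
    (Expr.count ones tops f₁ fs mask word q).eval w M σ = #{i ∈ range s | a i ≤ v} := by
  have hp : 2 ^ (g + 1) = 2 * 2 ^ g := by ring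
  have hpw : 2 ^ ((g + 1) * s) ≤ 2 ^ w := Nat.pow_le_pow_right (by norm_num) hw
  have hvo : v * pack (g + 1) s (fun _ => 1) = pack (g + 1) s fun _ => v := by
    rw [mul_pack]; simp
  have hlt₁ : pack (g + 1) s (fun _ => v) < 2 ^ w :=
    (pack_lt fun i _ => by omega).trans_le hpw
  have hlt₂ : pack (g + 1) s (fun _ => v + 2 ^ g) < 2 ^ w :=
    (pack_lt fun i _ => by omega).trans_le hpw
  have h₁ : (q * ones).eval w M σ = pack (g + 1) s fun _ => v := by
    rw [eval_mul hq hones (by rw [hvo]; exact hlt₁), hvo]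
  have h₂ := eval_add h₁ htops (by rw [pack_add]; exact hlt₂)
  have h₃ := eval_and (eval_sub h₂ hword (by
    rw [pack_add]
    exact sum_le_sum fun i hi => Nat.mul_le_mul_right _
      ((ha i (mem_range.1 hi)).trans (Nat.le_add_left _ _))) (by rw [pack_add]; exact hlt₂)) htops
  rw [pack_compare ha fun _ _ => hv] at h₃
  have h₄ := eval_mul_mod (eval_shr h₃ hf₁) hones
  rw [pack_div_pow (fun i _ => by split_ifs <;> simp)] at h₄
  have e : (fun i => (if a i ≤ v then 2 ^ g else 0) / 2 ^ g) =
      fun i => if a i ≤ v then 1 else 0 := by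
    funext i; split_ifs <;> simp
  rw [e] at h₄
  have h₅ := eval_mask (eval_shr h₄ hfs) hmask
  rw [Expr.count, h₅]
  have hsum : ∀ i < s, ∑ j ∈ range (i + 1), (if a j ≤ v then 1 else 0) < 2 ^ (g + 1) := by
    intro i hi
    rw [← card_filter]
    calc _ ≤ #(range (i + 1)) := card_filter_le _ _
      _ ≤ s := by simp; omega
      _ < _ := hsg
  have key := pack_field (f := g + 1) (s := s) (i := s - 1) hsum (by omega)
  rw [← prefixSum_mod hw hsum] at key
  rw [card_filter, show range s = range (s - 1 + 1) by congr 1; omega, ← key]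
  obtain ⟨t, rfl⟩ : ∃ t, s = t + 1 := ⟨s - 1, by omega⟩
  simp only [Nat.add_sub_cancel]
  rw [Nat.mul_succ, pow_add _ ((g + 1) * t), Nat.mod_mul_right_div_self, Nat.mod_mod]

/-- The word whose field `i` is the number of zeros among the bits `0, …, i` of `h`. -/
def Expr.zeroCounts (ones tops pow f₁ full h : Expr) : Expr :=
  ((((((pow - ((h * ones) &&& pow)) + tops) - pow) &&& tops) >>> f₁) * ones) &&& full

/-- Field `i` of the copied word is masked with `2 ^ i`, which isolates bit `i`. The difference from
`2 ^ i` is `2 ^ i` for a zero bit and `0` for a one, so comparing it with `2 ^ i` normalises the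
outcome to an indicator bit; the multiplication then forms prefix sums. -/
theorem Expr.eval_zeroCounts {w : ℕ} {M σ : ℕ → ℕ} {ones tops pow f₁ full h : Expr} {s v : ℕ}
    (hw : (s + 1) * s ≤ w)
    (hones : ones.eval w M σ = pack (s + 1) s fun _ => 1)
    (htops : tops.eval w M σ = pack (s + 1) s fun _ => 2 ^ s)
    (hpow : pow.eval w M σ = pack (s + 1) s fun i => 2 ^ i)
    (hf₁ : f₁.eval w M σ = s) (hfull : full.eval w M σ = 2 ^ ((s + 1) * s) - 1)
    (hh : h.eval w M σ = v) (hv : v < 2 ^ s) :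
    (Expr.zeroCounts ones tops pow f₁ full h).eval w M σ =
      pack (s + 1) s fun i => #{j ∈ range (i + 1) | v.testBit j = false} := by
  have hp : 2 ^ (s + 1) = 2 * 2 ^ s := by ring
  have hpw : 2 ^ ((s + 1) * s) ≤ 2 ^ w := Nat.pow_le_pow_right (by norm_num) hw
  have hi2 : ∀ i < s, 2 ^ i < 2 ^ s := fun i hi => Nat.pow_lt_pow_right (by norm_num) hi
  have hlt : ∀ a : ℕ → ℕ, (∀ i < s, a i < 2 ^ (s + 1)) → pack (s + 1) s a < 2 ^ w :=
    fun a ha => (pack_lt ha).trans_le hpw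
  have hvo : v * pack (s + 1) s (fun _ => 1) = pack (s + 1) s fun _ => v := by
    rw [mul_pack]; simp
  have h₁ : (h * ones).eval w M σ = pack (s + 1) s fun _ => v := by
    rw [eval_mul hh hones (by rw [hvo]; exact hlt _ fun _ _ => by omega), hvo]
  have h₂ := eval_and h₁ hpow
  rw [pack_and (by omega) (fun _ _ => by omega) (fun i hi => by have := hi2 i hi; omega)] at h₂
  have hle : ∀ i < s, v &&& 2 ^ i ≤ 2 ^ i := fun i _ => Nat.and_le_right
  have h₃ := eval_sub hpow h₂ (sum_le_sum fun i hi =>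
    Nat.mul_le_mul_right _ (hle i (mem_range.1 hi)))
    (hlt _ fun i hi => by have := hi2 i hi; omega)
  rw [pack_sub hle] at h₃
  have hb : ∀ i < s, 2 ^ i - (v &&& 2 ^ i) < 2 ^ s := fun i hi => by have := hi2 i hi; omega
  have h₄ := eval_add h₃ htops (by
    rw [pack_add]; exact hlt _ fun i hi => by have := hb i hi; omega)
  have h₅ := eval_and (eval_sub h₄ hpow (by
      rw [pack_add]
      exact sum_le_sum fun i hi => Nat.mul_le_mul_right _
        ((hi2 i (mem_range.1 hi)).le.trans (Nat.le_add_left _ _)))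
    (by rw [pack_add]; exact hlt _ fun i hi => by have := hb i hi; omega)) htops
  rw [pack_compare (fun i hi => (hi2 i hi).le) hb] at h₅
  have h₆ := eval_mask (eval_mul_mod (eval_shr h₅ hf₁) hones) hfull
  rw [pack_div_pow (fun i _ => by split_ifs <;> simp)] at h₆
  have e : ∀ i, (if 2 ^ i ≤ 2 ^ i - (v &&& 2 ^ i) then 2 ^ s else 0) / 2 ^ s =
      if v.testBit i = false then 1 else 0 := by
    intro i
    have := Nat.two_pow_pos i
    rw [Nat.and_two_pow]
    cases v.testBit i <;> simp
  simp only [e] at h₆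
  have hcard : ∀ i, ∑ j ∈ range (i + 1), (if v.testBit j = false then 1 else 0) =
      #{j ∈ range (i + 1) | v.testBit j = false} := fun i => (card_filter _ _).symm
  rw [prefixSum_mod hw (by
    intro i hi
    rw [hcard]
    have h₁ : #{j ∈ range (i + 1) | v.testBit j = false} ≤ #(range (i + 1)) := card_filter_le _ _
    have h₂ : s < 2 ^ s := Nat.lt_two_pow_self
    rw [card_range] at h₁
    omega)] at h₆
  simp only [hcard] at h₆
  exact h₆

/-- The bits from position `p` on of the number stored at `base` in words of `wd` bits. -/
def Expr.window (wd base p mask : Expr) : Expr :=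
  ((Expr.read (base + p / wd) >>> (p - p / wd * wd)) |||
    (Expr.read (base + p / wd + 1) <<< (wd - (p - p / wd * wd)))) &&& mask

/-- A window of at most `w` bits meets at most two consecutive words. If it starts at a word
boundary, the second word is shifted by `w` and vanishes modulo `2 ^ w`, so no case distinction is
needed. -/
theorem Expr.eval_window {w : ℕ} {M σ : ℕ → ℕ} {wd base p mask : Expr} {N B v len : ℕ}
    (hw : 0 < w)
    (hwd : wd.eval w M σ = w) (hbase : base.eval w M σ = B) (hp : p.eval w M σ = v)
    (hmask : mask.eval w M σ = 2 ^ len - 1) (hlen : len ≤ w) (hv : v < 2 ^ w)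
    (hB : B + v / w + 1 < 2 ^ w)
    (h₀ : M (B + v / w) = N / 2 ^ (w * (v / w)) % 2 ^ w)
    (h₁ : M (B + v / w + 1) = N / 2 ^ (w * (v / w + 1)) % 2 ^ w) :
    (Expr.window wd base p mask).eval w M σ = N / 2 ^ v % 2 ^ len := by
  have hww : w < 2 ^ w := Nat.lt_two_pow_self
  have hone : (1 : ℕ) < 2 ^ w := by omega
  have hle : v / w * w ≤ v := Nat.div_mul_le_self _ _
  have hq := eval_div hp hwd
  have ho := eval_sub hp (eval_mul hq hwd (by omega)) hle hv
  have ho' : v - v / w * w = v % w := by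
    have := Nat.div_add_mod v w
    rw [Nat.mul_comm] at this; omega
  rw [ho'] at ho
  have hmod : v % w < w := Nat.mod_lt _ hw
  have hadr := eval_add hbase hq (by omega)
  have e₀ := eval_shr (eval_read hadr h₀) ho
  have e₁ := eval_shl_mod (eval_read (eval_add hadr (eval_lit 1 hone) hB) h₁)
    (eval_sub hwd ho hmod.le hww)
  have e := eval_mask (eval_or e₀ e₁) hmask
  rw [Expr.window, e]
  refine Nat.eq_of_testBit_eq fun j => ?_
  simp only [Nat.testBit_mod_two_pow, Nat.testBit_or, Nat.testBit_div_two_pow,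
    Nat.testBit_mul_two_pow]
  by_cases hj : j < len
  swap
  · simp [hj]
  have hvw := Nat.div_add_mod v w
  by_cases hc : j + v % w < w
  · have hn : ¬ (w - v % w ≤ j) := by omega
    have e : j + v % w + w * (v / w) = j + v := by omega
    simp [hj, hc, hn, e]
  · have hn : w - v % w ≤ j := by omega
    have e : j - (w - v % w) + w * (v / w + 1) = j + v := by rw [Nat.mul_succ]; omega
    have hjw : j < w := by omega
    have hjw₂ : j - (w - v % w) < w := by omega
    simp [hj, hc, hn, e, hjw, hjw₂]

/-- Concatenation of records of variable lengths. -/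
theorem exists_concat {ι : Type*} (K : Finset ι) (rec : ι → List ℕ) :
    ∃ (T : List ℕ) (off : ι → ℕ), T.length = ∑ k ∈ K, (rec k).length ∧
      (∀ t ∈ T, ∃ k ∈ K, t ∈ rec k) ∧
      ∀ k ∈ K, off k + (rec k).length ≤ T.length ∧
        ∀ t < (rec k).length, T.getD (off k + t) 0 = (rec k).getD t 0 := by
  classical
  induction K using Finset.induction_on with
  | empty => exact ⟨[], fun _ => 0, by simp⟩
  | insert a K ha ih =>
    obtain ⟨T, off, hlen, hmem, h⟩ := ih
    refine ⟨T ++ rec a, Function.update off a T.length, ?_, ?_, ?_⟩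
    · rw [sum_insert ha, List.length_append, hlen, Nat.add_comm]
    · intro t ht
      rcases List.mem_append.1 ht with ht | ht
      · obtain ⟨k, hk, hkt⟩ := hmem t ht
        exact ⟨k, mem_insert_of_mem hk, hkt⟩
      · exact ⟨a, mem_insert_self _ _, ht⟩
    · intro k hk
      rcases mem_insert.1 hk with rfl | hk
      · simp only [Function.update_self, List.length_append, le_refl, true_and]
        intro t ht
        rw [List.getD_append_right _ _ _ _ (by omega)]
        simp
      · have hne : k ≠ a := fun e => ha (e ▸ hk)
        obtain ⟨h₁, h₂⟩ := h k hk
        rw [Function.update_of_ne hne]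
        refine ⟨by rw [List.length_append]; omega, fun t ht => ?_⟩
        rw [List.getD_append _ _ _ _ (by omega), h₂ t ht]

end WordRAM

/-! ### Multiply-shift hashing and a two-level perfect hash table. -/

namespace WordRAM
open Finset

/-- Multiply-shift hashing of `w`-bit words to `d`-bit words. -/
def mulShift (w d a x : ℕ) : ℕ := a * x % 2 ^ w / 2 ^ (w - d)

theorem mulShift_lt (w d a x : ℕ) : mulShift w d a x < 2 ^ d := by
  refine Nat.div_lt_of_lt_mul ?_
  calc a * x % 2 ^ w < 2 ^ w := Nat.mod_lt _ (by positivity)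
    _ ≤ 2 ^ (w - d + d) := Nat.pow_le_pow_right (by norm_num) (by omega)
    _ = _ := pow_add _ _ _

/-- Equal hash values place `a * (y + z)` and `a * y` modulo `2 ^ w` in the same interval of length
`2 ^ (w - d)`, so their difference `a * z` is cyclically close to `0`. -/
theorem near_of_mulShift_eq {w d a y z : ℕ}
    (h : mulShift w d a (y + z) = mulShift w d a y) :
    a * z % 2 ^ w < 2 ^ (w - d) ∨ 2 ^ w - a * z % 2 ^ w < 2 ^ (w - d) := by
  unfold mulShift at h
  have hR : 0 < 2 ^ (w - d) := by positivity
  have hN : 0 < 2 ^ w := by positivity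
  rw [Nat.mul_add, Nat.add_mod] at h
  have hB : a * y % 2 ^ w < 2 ^ w := Nat.mod_lt _ hN
  have hC : a * z % 2 ^ w < 2 ^ w := Nat.mod_lt _ hN
  generalize a * y % 2 ^ w = B at *
  generalize a * z % 2 ^ w = C at *
  have h₁ := Nat.div_add_mod ((B + C) % 2 ^ w) (2 ^ (w - d))
  have h₂ := Nat.div_add_mod B (2 ^ (w - d))
  have h₃ := Nat.mod_lt ((B + C) % 2 ^ w) hR
  have h₄ := Nat.mod_lt B hR
  rw [h] at h₁
  by_cases hBC : B + C < 2 ^ w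
  · rw [Nat.mod_eq_of_lt hBC] at h₁ h₃
    left; omega
  · have e : (B + C) % 2 ^ w = B + C - 2 ^ w := by
      rw [Nat.mod_eq_sub_mod (by omega), Nat.mod_eq_of_lt (by omega)]
    rw [e] at h₁ h₃
    right; omega

/-- Write `z = 2 ^ t * q` with `q` odd. For odd `a` the residue `a * z` is `2 ^ t` times an odd
number modulo `2 ^ (w - t)`. If `w - d ≤ t`, it is too far from `0` for a collision. Otherwise `a ↦
a * q` is injective modulo `2 ^ w`, and on either side of `0` there are at most `2 ^ t` choices of
the high part and `2 ^ r` odd low parts, with `t + r + 1 = w - d`. -/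
theorem card_mulShift_collision_of_lt {w d y z : ℕ} (hz : 0 < z) (hzw : z < 2 ^ w) :
    #{a ∈ range (2 ^ w) | Odd a ∧ mulShift w d a (y + z) = mulShift w d a y} * 2 ^ d ≤ 2 ^ w := by
  obtain ⟨t, q, hq, rfl⟩ := Nat.exists_eq_two_pow_mul_odd hz.ne'
  have htw : t < w := by
    by_contra hc
    have h₁ : 2 ^ w ≤ 2 ^ t := Nat.pow_le_pow_right (by norm_num) (by omega)
    have h₂ := Nat.le_mul_of_pos_right (2 ^ t) hq.pos
    omega
  have hsplit : 2 ^ w = 2 ^ t * 2 ^ (w - t) := by rw [← pow_add]; congr 1; omega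
  have hmod : ∀ a, a * (2 ^ t * q) % 2 ^ w = 2 ^ t * (a * q % 2 ^ (w - t)) := by
    intro a
    rw [hsplit, ← Nat.mul_mod_mul_left]; congr 1; ring
  have hm : 2 ∣ 2 ^ (w - t) := dvd_pow_self 2 (by omega)
  have hodd : ∀ a, Odd a → (a * q % 2 ^ (w - t)) % 2 = 1 := by
    intro a ha
    rw [Nat.mod_mod_of_dvd _ hm]
    exact Nat.odd_iff.1 (ha.mul hq)
  have hcop : Nat.Coprime (2 ^ w) q := Nat.Coprime.pow_left _ (Nat.coprime_two_left.2 hq)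
  have hinj : ∀ a a', a < 2 ^ w → a' < 2 ^ w → a * q % 2 ^ w = a' * q % 2 ^ w → a = a' := by
    intro a a' ha ha' h
    have h₁ : a ≡ a' [MOD 2 ^ w] := Nat.ModEq.cancel_right_of_coprime hcop h
    exact Nat.ModEq.eq_of_lt_of_lt h₁ ha ha'
  have hlow : ∀ a, a * q % 2 ^ w % 2 ^ (w - t) = a * q % 2 ^ (w - t) := fun a =>
    Nat.mod_mod_of_dvd _ (pow_dvd_pow 2 (by omega))
  have hhigh : ∀ a, a * q % 2 ^ w / 2 ^ (w - t) < 2 ^ t := fun a => by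
    refine Nat.div_lt_of_lt_mul ?_
    rw [Nat.mul_comm (2 ^ (w - t)), ← hsplit]
    exact Nat.mod_lt _ (by positivity)
  by_cases hr : w - d ≤ t
  · have hempty : {a ∈ range (2 ^ w) | Odd a ∧
        mulShift w d a (y + 2 ^ t * q) = mulShift w d a y} = ∅ := by
      refine filter_eq_empty_iff.2 fun a _ ⟨ha, hc⟩ => ?_
      have h₁ := near_of_mulShift_eq hc
      have h₂ := hodd a ha
      have h₃ : a * q % 2 ^ (w - t) < 2 ^ (w - t) := Nat.mod_lt _ (by positivity)
      have h₄ : 2 ^ (w - d) ≤ 2 ^ t := Nat.pow_le_pow_right (by norm_num) hr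
      rw [hmod a] at h₁
      generalize a * q % 2 ^ (w - t) = e at *
      rcases h₁ with h₁ | h₁
      · have := Nat.le_mul_of_pos_right (2 ^ t) (show 0 < e by omega)
        omega
      · rw [hsplit, ← Nat.mul_sub] at h₁
        have := Nat.le_mul_of_pos_right (2 ^ t) (show 0 < 2 ^ (w - t) - e by omega)
        omega
    rw [hempty]; simp
  · obtain ⟨r, hr⟩ : ∃ r, w - d = t + r + 1 := ⟨w - d - t - 1, by omega⟩
    have hpr : 2 ^ (w - d) = 2 ^ t * 2 ^ (r + 1) := by rw [← pow_add, hr]; rfl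
    have hpr' : 2 ^ (r + 1) = 2 * 2 ^ r := by ring
    have hsub : {a ∈ range (2 ^ w) | Odd a ∧
        mulShift w d a (y + 2 ^ t * q) = mulShift w d a y} ⊆
        {a ∈ range (2 ^ w) | Odd a ∧ a * q % 2 ^ (w - t) < 2 ^ (r + 1)} ∪
        {a ∈ range (2 ^ w) | Odd a ∧ 2 ^ (w - t) - a * q % 2 ^ (w - t) < 2 ^ (r + 1)} := by
      intro a ha
      simp only [mem_filter, mem_union] at ha ⊢
      obtain ⟨ha, ho, hc⟩ := ha
      have h₁ := near_of_mulShift_eq hc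
      rw [hmod a, hsplit, ← Nat.mul_sub, hpr, Nat.mul_lt_mul_left (by positivity),
        Nat.mul_lt_mul_left (by positivity)] at h₁
      rcases h₁ with h₁ | h₁
      · exact Or.inl ⟨ha, ho, h₁⟩
      · exact Or.inr ⟨ha, ho, h₁⟩
    have hmeven : ∃ m, 2 ^ (w - t) = 2 * m := hm
    obtain ⟨m, hm2⟩ := hmeven
    have c₁ : #{a ∈ range (2 ^ w) | Odd a ∧ a * q % 2 ^ (w - t) < 2 ^ (r + 1)} ≤
        #(range (2 ^ t) ×ˢ range (2 ^ r)) := by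
      refine card_le_card_of_injOn
        (fun a => (a * q % 2 ^ w / 2 ^ (w - t), a * q % 2 ^ (w - t) / 2)) ?_ ?_
      · intro a ha
        simp only [coe_filter, Set.mem_ofPred_eq] at ha
        simp only [coe_product, Set.mem_prod, mem_coe, mem_range]
        exact ⟨hhigh a, by omega⟩
      · intro a ha a' ha' h
        simp only [coe_filter, Set.mem_ofPred_eq, mem_range] at ha ha'
        simp only [Prod.mk.injEq] at h
        have h₁ := hodd a ha.2.1
        have h₂ := hodd a' ha'.2.1
        refine hinj a a' ha.1 ha'.1 ?_
        rw [← Nat.div_add_mod (a * q % 2 ^ w) (2 ^ (w - t)),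
          ← Nat.div_add_mod (a' * q % 2 ^ w) (2 ^ (w - t)), h.1, hlow, hlow]
        congr 1
        omega
    have c₂ : #{a ∈ range (2 ^ w) | Odd a ∧
        2 ^ (w - t) - a * q % 2 ^ (w - t) < 2 ^ (r + 1)} ≤
        #(range (2 ^ t) ×ˢ range (2 ^ r)) := by
      refine card_le_card_of_injOn
        (fun a => (a * q % 2 ^ w / 2 ^ (w - t), (2 ^ (w - t) - a * q % 2 ^ (w - t)) / 2)) ?_ ?_
      · intro a ha
        simp only [coe_filter, Set.mem_ofPred_eq] at ha
        simp only [coe_product, Set.mem_prod, mem_coe, mem_range]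
        exact ⟨hhigh a, by omega⟩
      · intro a ha a' ha' h
        simp only [coe_filter, Set.mem_ofPred_eq, mem_range] at ha ha'
        simp only [Prod.mk.injEq] at h
        have h₁ := hodd a ha.2.1
        have h₂ := hodd a' ha'.2.1
        have h₃ : a * q % 2 ^ (w - t) < 2 ^ (w - t) := Nat.mod_lt _ (by positivity)
        have h₄ : a' * q % 2 ^ (w - t) < 2 ^ (w - t) := Nat.mod_lt _ (by positivity)
        refine hinj a a' ha.1 ha'.1 ?_
        rw [← Nat.div_add_mod (a * q % 2 ^ w) (2 ^ (w - t)),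
          ← Nat.div_add_mod (a' * q % 2 ^ w) (2 ^ (w - t)), h.1, hlow, hlow]
        congr 1
        omega
    simp only [card_product, card_range] at c₁ c₂
    have hle := (card_le_card hsub).trans (card_union_le _ _)
    calc _ ≤ (2 ^ t * 2 ^ (r + 1)) * 2 ^ d := by
          refine Nat.mul_le_mul_right _ ?_
          rw [hpr', Nat.mul_left_comm]
          omega
      _ = 2 ^ w := by rw [← hpr, ← pow_add]; congr 1; omega

theorem card_mulShift_collision {w d x y : ℕ} (hx : x < 2 ^ w) (hy : y < 2 ^ w) (hxy : x ≠ y) :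
    #{a ∈ range (2 ^ w) | Odd a ∧ mulShift w d a x = mulShift w d a y} * 2 ^ d ≤ 2 ^ w := by
  rcases Nat.lt_or_gt_of_ne hxy with h | h
  · obtain ⟨z, rfl⟩ := Nat.exists_eq_add_of_lt h
    have := card_mulShift_collision_of_lt (d := d) (y := x) (Nat.succ_pos z)
      (show z + 1 < 2 ^ w by omega)
    simpa only [eq_comm, Nat.add_assoc] using this
  · obtain ⟨z, rfl⟩ := Nat.exists_eq_add_of_lt h
    exact card_mulShift_collision_of_lt (d := d) (y := y) (Nat.succ_pos z)
      (show z + 1 < 2 ^ w by omega)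

theorem card_odd_range_two_pow {w : ℕ} (hw : 0 < w) :
    #{a ∈ range (2 ^ w) | Odd a} = 2 ^ (w - 1) := by
  have e : 2 ^ w = 2 * 2 ^ (w - 1) := by
    rw [← pow_succ']; congr 1; omega
  have : {a ∈ range (2 ^ w) | Odd a} = (range (2 ^ (w - 1))).image fun i => 2 * i + 1 := by
    ext a
    simp only [mem_filter, mem_range, mem_image]
    constructor
    · rintro ⟨h, k, rfl⟩
      exact ⟨k, by omega, rfl⟩
    · rintro ⟨k, hk, rfl⟩
      exact ⟨by omega, k, rfl⟩
  rw [this, card_image_of_injective _ fun i j h => by simpa using h, card_range]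

/-- Some multiplier has few collisions. -/
theorem exists_mulShift {w : ℕ} (hw : 0 < w) (d : ℕ) (K : Finset ℕ) (hK : ∀ x ∈ K, x < 2 ^ w) :
    ∃ a < 2 ^ w, #{p ∈ K.offDiag | mulShift w d a p.1 = mulShift w d a p.2} * 2 ^ d ≤
      2 * #K.offDiag := by
  have hne : {a ∈ range (2 ^ w) | Odd a}.Nonempty := by
    rw [← card_pos, card_odd_range_two_pow hw]; positivity
  -- Averaging over the `2 ^ (w - 1)` odd multipliers: every pair collides for at most `2 ^ w / 2 ^
  -- d` of them, hence with frequency at most `2 / 2 ^ d`.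
  have hsum : ∑ a ∈ range (2 ^ w) with Odd a,
      #{p ∈ K.offDiag | mulShift w d a p.1 = mulShift w d a p.2} * 2 ^ d ≤
      ∑ _a ∈ range (2 ^ w) with Odd _a, 2 * #K.offDiag := by
    rw [sum_const, card_odd_range_two_pow hw, smul_eq_mul, ← sum_mul]
    simp only [card_filter]
    rw [sum_comm, sum_mul]
    calc _ ≤ ∑ p ∈ K.offDiag, 2 ^ w := by
          refine sum_le_sum fun p hp => ?_
          rw [mem_offDiag] at hp
          rw [← card_filter, filter_filter]
          exact card_mulShift_collision (hK _ hp.1) (hK _ hp.2.1) hp.2.2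
      _ = _ := by
          rw [sum_const, smul_eq_mul, show 2 ^ w = 2 ^ (w - 1) * 2 by
            rw [← pow_succ]; congr 1; omega]
          ring
  obtain ⟨a, ha, h⟩ := exists_le_of_sum_le hne hsum
  rw [mem_filter, mem_range] at ha
  exact ⟨a, ha.1, h⟩

/-- Birthday bound: with more than `2 * #K ^ 2` slots the number of colliding pairs granted by
`exists_mulShift` is less than `1`. The summand `2` in the bound for `2 ^ d` covers the empty set.
-/
theorem exists_injOn_mulShift {w : ℕ} (hw : 0 < w) (K : Finset ℕ) (hK : ∀ x ∈ K, x < 2 ^ w) :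
    ∃ d a, a < 2 ^ w ∧ 2 ^ d ≤ 4 * #K ^ 2 + 2 ∧
      ∀ x ∈ K, ∀ y ∈ K, mulShift w d a x = mulShift w d a y → x = y := by
  obtain ⟨a, ha, h⟩ := exists_mulShift hw (Nat.log 2 (2 * #K ^ 2) + 1) K hK
  refine ⟨Nat.log 2 (2 * #K ^ 2) + 1, a, ha, ?_, ?_⟩
  · rcases Nat.eq_zero_or_pos (#K) with h0 | h0
    · simp [h0]
    · have := Nat.pow_log_le_self 2 (x := 2 * #K ^ 2) (by positivity)
      rw [pow_succ]; omega
  · intro x hx y hy hxy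
    by_contra hne
    have h₁ : 2 * #K ^ 2 < 2 ^ (Nat.log 2 (2 * #K ^ 2) + 1) :=
      Nat.lt_pow_succ_log_self (by norm_num) _
    have h₂ : 0 < #{p ∈ K.offDiag | mulShift w (Nat.log 2 (2 * #K ^ 2) + 1) a p.1 =
        mulShift w (Nat.log 2 (2 * #K ^ 2) + 1) a p.2} :=
      card_pos.2 ⟨(x, y), by simp [hx, hy, hne, hxy]⟩
    have h₃ : #K.offDiag ≤ #K ^ 2 := by rw [offDiag_card, sq]; omega
    nlinarith

/-- Both sides count ordered pairs with equal hash value, the diagonal contributing `#K`.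
Second-level tables have size quadratic in their bucket, so this bounds their total size. -/
theorem sum_card_fiber_sq (K : Finset ℕ) (h : ℕ → ℕ) (m : ℕ) (hm : ∀ x ∈ K, h x < m) :
    ∑ i ∈ range m, #{x ∈ K | h x = i} ^ 2 = #K + #{p ∈ K.offDiag | h p.1 = h p.2} := by
  have h₁ : #{p ∈ K ×ˢ K | h p.1 = h p.2} =
      ∑ i ∈ range m, #{p ∈ {p ∈ K ×ˢ K | h p.1 = h p.2} | h p.1 = i} :=
    card_eq_sum_card_fiberwise fun p hp => by
      simp only [coe_filter, mem_product, Set.mem_ofPred_eq] at hp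
      simpa using hm _ hp.1.1
  have h₂ : #{p ∈ K ×ˢ K | h p.1 = h p.2} = #K + #{p ∈ K.offDiag | h p.1 = h p.2} := by
    rw [← diag_union_offDiag, filter_union, card_union_of_disjoint, filter_true_of_mem, diag_card]
    · intro p hp
      rw [mem_diag] at hp
      rw [hp.2]
    · exact disjoint_filter_filter (disjoint_diag_offDiag K)
  rw [← h₂, h₁]
  refine sum_congr rfl fun i _ => ?_
  rw [sq, ← card_product]
  congr 1
  ext p
  simp only [mem_product, mem_filter]
  constructor
  · rintro ⟨⟨a, b⟩, c, d⟩
    exact ⟨⟨⟨a, c⟩, by rw [b, d]⟩, b⟩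
  · rintro ⟨⟨⟨a, c⟩, e⟩, b⟩
    exact ⟨⟨a, b⟩, c, by rw [← e, b]⟩

theorem getD_map_range {n i : ℕ} (f : ℕ → ℕ) (hi : i < n) :
    ((List.range n).map f).getD i 0 = f i := by
  simp [List.getD_eq_getElem?_getD, hi]

/-- Lookup of a key in a two-level hash table at `base`. -/
def Expr.lookup (a s base key : Expr) : Expr :=
  let b := base + 3 * ((a * key) >>> s)
  let slot := Expr.read (b + 2) + 2 * ((Expr.read b * key) >>> Expr.read (b + 1))
  .ite (.read slot) key 0 (.ite key (.read slot) 0 (.read (slot + 1)))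

theorem Expr.eval_lookup {w : ℕ} (hw : 2 ≤ w) {M σ : ℕ → ℕ} {aE sE bE kE : Expr}
    {a d base κ a' d' p x y z : ℕ}
    (ha : aE.eval w M σ = a) (hs : sE.eval w M σ = w - d) (hb : bE.eval w M σ = base)
    (hk : kE.eval w M σ = κ) (hlt : base + 3 * mulShift w d a κ + 2 < 2 ^ w)
    (h₀ : M (base + 3 * mulShift w d a κ) = a')
    (h₁ : M (base + 3 * mulShift w d a κ + 1) = w - d')
    (h₂ : M (base + 3 * mulShift w d a κ + 2) = p)
    (hlt' : p + 2 * mulShift w d' a' κ + 1 < 2 ^ w)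
    (h₃ : M (p + 2 * mulShift w d' a' κ) = x) (h₄ : M (p + 2 * mulShift w d' a' κ + 1) = y)
    (hz : z = if x = κ then y else 0) :
    (Expr.lookup aE sE bE kE).eval w M σ = z := by
  have hp : 4 ≤ 2 ^ w := by
    calc 4 = 2 ^ 2 := by norm_num
      _ ≤ 2 ^ w := Nat.pow_le_pow_right (by norm_num) hw
  have e₁ := eval_shr (eval_mul_mod ha hk) hs
  have e₂ := eval_add hb (eval_mul (eval_lit 3 (by omega)) e₁
    (by unfold mulShift at hlt; omega)) (by unfold mulShift at hlt; omega)
  have f₀ := eval_read e₂ h₀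
  have f₁ := eval_read (eval_add e₂ (eval_lit 1 (by omega)) (by unfold mulShift at hlt; omega)) h₁
  have f₂ := eval_read (eval_add e₂ (eval_lit 2 (by omega)) (by unfold mulShift at hlt; omega)) h₂
  have e₃ := eval_shr (eval_mul_mod f₀ hk) f₁
  have e₄ := eval_add f₂ (eval_mul (eval_lit 2 (by omega)) e₃
    (by unfold mulShift at hlt'; omega)) (by unfold mulShift at hlt'; omega)
  have e₅ := eval_read e₄ h₃
  have e₆ := eval_read (eval_add e₄ (eval_lit 1 (by omega)) (by unfold mulShift at hlt'; omega)) h₄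
  refine eval_ite e₅ hk (fun h => ?_) (fun h => eval_ite hk e₅ (fun h' => ?_) (fun h' => ?_))
  · rw [hz, if_neg (by omega)]; exact eval_lit 0 (by omega)
  · rw [hz, if_neg (by omega)]; exact eval_lit 0 (by omega)
  · rw [hz, if_pos (by omega)]; exact e₆

/-- A static dictionary of linear size. -/
theorem exists_dictionary {w : ℕ} (hw : 2 ≤ w) (K : Finset ℕ) (hK : ∀ κ ∈ K, κ < 2 ^ w)
    (v : ℕ → ℕ) (hv : ∀ κ ∈ K, v κ < 2 ^ w) (base : ℕ) (hbase : base + 40 * (#K + 1) < 2 ^ w) :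
    ∃ (T : List ℕ) (a s : ℕ), T.length ≤ 40 * (#K + 1) ∧ (∀ t ∈ T, t < 2 ^ w) ∧ a < 2 ^ w ∧
      s ≤ w ∧ ∀ M : ℕ → ℕ, (∀ i < T.length, M (base + i) = T.getD i 0) →
        ∀ (σ : ℕ → ℕ) (aE sE bE kE : Expr) (κ : ℕ), aE.eval w M σ = a → sE.eval w M σ = s →
          bE.eval w M σ = base → kE.eval w M σ = κ →
          (Expr.lookup aE sE bE kE).eval w M σ = if κ ∈ K then v κ else 0 := by
  classical
  set d := Nat.clog 2 (#K) with hd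
  obtain ⟨a, ha, hcoll⟩ := exists_mulShift (by omega : 0 < w) d K hK
  have hd₁ : #K ≤ 2 ^ d := Nat.le_pow_clog (by norm_num) _
  have hd₂ : 2 ^ d ≤ 2 * #K + 1 := by
    rcases Nat.lt_or_ge 1 (#K) with h | h
    · have := Nat.pow_pred_clog_lt_self (b := 2) (by norm_num) h
      have hpos : 0 < Nat.clog 2 (#K) := Nat.clog_pos (by norm_num) h
      have e : 2 ^ d = 2 * 2 ^ (Nat.clog 2 (#K)).pred := by
        rw [hd, ← pow_succ']; congr 1; exact (Nat.succ_pred hpos.ne').symm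
      omega
    · have : d = 0 := by rw [hd]; exact Nat.clog_of_right_le_one h 2
      rw [this]; omega
  have hoff : #K.offDiag ≤ #K * #K := by rw [offDiag_card]; omega
  have hcoll' : #{p ∈ K.offDiag | mulShift w d a p.1 = mulShift w d a p.2} ≤ 2 * #K := by
    have hp : 0 < 2 ^ d := by positivity
    by_contra hc
    push Not at hc
    nlinarith
  have hsq := sum_card_fiber_sq K (mulShift w d a) (2 ^ d) fun x _ => mulShift_lt _ _ _ _
  set B : ℕ → Finset ℕ := fun i => {x ∈ K | mulShift w d a x = i} with hB
  have hex : ∀ i, ∃ d' a', a' < 2 ^ w ∧ 2 ^ d' ≤ 4 * #(B i) ^ 2 + 2 ∧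
      ∀ x ∈ B i, ∀ y ∈ B i, mulShift w d' a' x = mulShift w d' a' y → x = y := fun i =>
    exists_injOn_mulShift (by omega) (B i) fun x hx => hK x (mem_filter.1 hx).1
  choose d' a' ha' hd' hinj using hex
  -- An empty slot holds the pair `(0, 0)`. Even the key `0`, which matches it when absent, then
  -- gets the value `0` that stands for a missing key.
  have hcell : ∀ i j, ∃ x y, (∃ κ ∈ B i, mulShift w (d' i) (a' i) κ = j ∧ x = κ ∧ y = v κ) ∨
      ((∀ κ ∈ B i, mulShift w (d' i) (a' i) κ ≠ j) ∧ x = 0 ∧ y = 0) := by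
    intro i j
    by_cases h : ∃ κ ∈ B i, mulShift w (d' i) (a' i) κ = j
    · obtain ⟨κ, h₁, h₂⟩ := h
      exact ⟨κ, v κ, Or.inl ⟨κ, h₁, h₂, rfl, rfl⟩⟩
    · push Not at h
      exact ⟨0, 0, Or.inr ⟨h, rfl, rfl⟩⟩
  choose X Y hXY using hcell
  have hX : ∀ i j, X i j < 2 ^ w := fun i j => by
    rcases hXY i j with ⟨κ, h, _, e, _⟩ | ⟨_, e, _⟩
    · rw [e]; exact hK _ (mem_filter.1 h).1
    · rw [e]; positivity
  have hY : ∀ i j, Y i j < 2 ^ w := fun i j => by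
    rcases hXY i j with ⟨κ, h, _, _, e⟩ | ⟨_, _, e⟩
    · rw [e]; exact hv _ (mem_filter.1 h).1
    · rw [e]; positivity
  obtain ⟨T₂, off, hlen, hmem, hcat⟩ := exists_concat (range (2 ^ d)) fun i =>
    (List.range (2 * 2 ^ d' i)).map fun t => if t % 2 = 0 then X i (t / 2) else Y i (t / 2)
  simp only [List.length_map, List.length_range] at hlen hcat
  -- Three words per bucket: multiplier, shift and address of its table. The tables follow as pairs
  -- of key and value.
  set T₁ := (List.range (3 * 2 ^ d)).map fun t => if t % 3 = 0 then a' (t / 3) else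
    if t % 3 = 1 then w - d' (t / 3) else base + 3 * 2 ^ d + off (t / 3) with hT₁
  have hT₁len : T₁.length = 3 * 2 ^ d := by simp [hT₁]
  have hlen₂ : T₂.length ≤ 24 * #K + 4 * 2 ^ d := by
    rw [hlen]
    calc ∑ i ∈ range (2 ^ d), 2 * 2 ^ d' i ≤ ∑ i ∈ range (2 ^ d), (8 * #(B i) ^ 2 + 4) :=
          sum_le_sum fun i _ => by have := hd' i; omega
      _ = 8 * ∑ i ∈ range (2 ^ d), #(B i) ^ 2 + 4 * 2 ^ d := by
          rw [sum_add_distrib, ← mul_sum, sum_const, card_range, smul_eq_mul]; ring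
      _ ≤ _ := by rw [hsq]; omega
  have hTlen : (T₁ ++ T₂).length = 3 * 2 ^ d + T₂.length := by
    rw [List.length_append, hT₁len]
  -- With `2 ^ d ≤ 2 * #K + 1` the two parts have at most `6 * #K + 3` and `32 * #K + 4` words.
  have hbound : 3 * 2 ^ d + T₂.length ≤ 40 * (#K + 1) := by omega
  have hww : w < 2 ^ w := Nat.lt_two_pow_self
  refine ⟨T₁ ++ T₂, a, w - d, by omega, ?_, ha, by omega, ?_⟩
  · intro t ht
    rcases List.mem_append.1 ht with ht | ht
    · rw [hT₁, List.mem_map] at ht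
      obtain ⟨i, hi, rfl⟩ := ht
      rw [List.mem_range] at hi
      have := (hcat (i / 3) (mem_range.2 (by omega))).1
      split_ifs
      · exact ha' _
      · omega
      · omega
    · obtain ⟨k, _, hk⟩ := hmem t ht
      rw [List.mem_map] at hk
      obtain ⟨i, _, rfl⟩ := hk
      split_ifs
      exacts [hX _ _, hY _ _]
  · intro M hM σ aE sE bE kE κ haE hsE hbE hkE
    have hi : mulShift w d a κ < 2 ^ d := mulShift_lt _ _ _ _
    have hj : mulShift w (d' (mulShift w d a κ)) (a' (mulShift w d a κ)) κ <
        2 ^ d' (mulShift w d a κ) := mulShift_lt _ _ _ _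
    have hread₁ : ∀ r < 3, M (base + 3 * mulShift w d a κ + r) =
        if r = 0 then a' (mulShift w d a κ) else
          if r = 1 then w - d' (mulShift w d a κ) else
            base + 3 * 2 ^ d + off (mulShift w d a κ) := by
      intro r hr
      rw [Nat.add_assoc, hM _ (by omega), List.getD_append _ _ _ _ (by omega), hT₁,
        getD_map_range _ (by omega), show (3 * mulShift w d a κ + r) % 3 = r by omega,
        show (3 * mulShift w d a κ + r) / 3 = mulShift w d a κ by omega]
    have h₀ := hread₁ 0 (by omega)
    have h₁ := hread₁ 1 (by omega)
    have h₂ := hread₁ 2 (by omega)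
    simp only [Nat.add_zero, if_true] at h₀
    simp only [one_ne_zero, if_true, if_false] at h₁
    rw [if_neg (by omega), if_neg (by omega)] at h₂
    generalize hI : mulShift w d a κ = i at *
    generalize hJ : mulShift w (d' i) (a' i) κ = j at *
    obtain ⟨hc₁, hc₂⟩ := hcat i (mem_range.2 hi)
    have hread₂ : ∀ r < 2, M (base + 3 * 2 ^ d + off i + 2 * j + r) =
        if r = 0 then X i j else Y i j := by
      intro r hr
      have e := hM (3 * 2 ^ d + off i + 2 * j + r) (by omega)
      rw [List.getD_append_right _ _ _ _ (by omega), hT₁len,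
        show 3 * 2 ^ d + off i + 2 * j + r - 3 * 2 ^ d = off i + (2 * j + r) by omega,
        hc₂ _ (by omega), getD_map_range _ (by omega), show (2 * j + r) % 2 = r by omega,
        show (2 * j + r) / 2 = j by omega] at e
      rw [← e]; congr 1; ring
    have h₃ := hread₂ 0 (by omega)
    have h₄ := hread₂ 1 (by omega)
    simp only [Nat.add_zero, if_true] at h₃
    rw [if_neg (by omega)] at h₄
    subst hI
    subst hJ
    refine Expr.eval_lookup hw haE hsE hbE hkE (by omega) h₀ h₁ h₂ (by omega) h₃ h₄ ?_
    have hmemB : κ ∈ K → κ ∈ B (mulShift w d a κ) := fun h => mem_filter.2 ⟨h, rfl⟩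
    rcases hXY (mulShift w d a κ)
      (mulShift w (d' (mulShift w d a κ)) (a' (mulShift w d a κ)) κ) with
      ⟨κ', hk', hh, e₁, e₂⟩ | ⟨hno, e₁, e₂⟩
    · rw [e₁, e₂]
      by_cases hκ : κ ∈ K
      · have : κ' = κ := hinj _ κ' hk' κ (hmemB hκ) hh
        simp [this, hκ]
      · have : κ' ≠ κ := fun e => hκ (e ▸ (mem_filter.1 hk').1)
        simp [this, hκ]
    · rw [e₁, e₂]
      have hκ : κ ∉ K := fun h => hno κ (hmemB h) rfl
      simp [hκ]

end WordRAM

/-! ### Predecessor and rank, and the specification of a query command. -/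

namespace WordRAM
open Finset

/-- The predecessor of `x` in `S`, or `0`. -/
def pred (S : Finset ℕ) (x : ℕ) : ℕ := (S.filter (· ≤ x)).sup id

/-- The number of elements of `S` that are at most `x`. -/
def rank (S : Finset ℕ) (x : ℕ) : ℕ := #(S.filter (· ≤ x))

theorem isPredecessorAnswer {S : Finset ℕ} (x : ℕ) :
    IsPredecessorAnswer S x (pred S x) (rank S x) := by
  unfold pred rank
  by_cases h : (S.filter (· ≤ x)).Nonempty
  · left
    obtain ⟨y, hy, e⟩ := exists_mem_eq_sup _ h id
    rw [e]
    rw [mem_filter] at hy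
    have hmax : ∀ s ∈ S, s ≤ x → s ≤ y := fun s hs hsx => by
      have := le_sup (f := id) (mem_filter.2 ⟨hs, hsx⟩ : s ∈ S.filter (· ≤ x))
      rw [e] at this
      exact this
    refine ⟨⟨hy, fun s hs => hmax s hs.1 hs.2⟩, ?_⟩
    congr 1
    refine filter_congr fun s hs => ⟨hmax s hs, fun h => h.trans hy.2⟩
  · right
    rw [not_nonempty_iff_eq_empty] at h
    rw [h]
    refine ⟨fun s hs => ?_, by simp, by simp⟩
    by_contra hc
    exact notMem_empty s (h ▸ mem_filter.2 ⟨hs, by omega⟩)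

theorem memory_map {w : ℕ} {l : List ℕ} (hl : ∀ t ∈ l, t < 2 ^ w) (i : ℕ) :
    memory (l.map (BitVec.ofNat w)) i = l.getD i 0 := by
  unfold memory
  by_cases hi : i < l.length
  · rw [List.getD_eq_getElem _ _ (by simpa using hi), List.getD_eq_getElem _ _ hi]
    simp only [List.getElem_map, BitVec.toNat_ofNat]
    exact Nat.mod_eq_of_lt (hl _ (List.getElem_mem hi))
  · rw [List.getD_eq_default _ _ (by simpa using hi), List.getD_eq_default _ _ (by omega)]
    simp

/-- On the memory `M`, the command `c` answers all queries up to `u` at cost at most `T`. -/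
def Solves (w u : ℕ) (S : Finset ℕ) (M : ℕ → ℕ) (c : Cmd) (T : ℕ) : Prop :=
  ∀ x, 1 ≤ x → x ≤ u → ∃ σ' t, Runs w M c (start x) σ' t ∧ t ≤ T ∧
    σ' 0 = pred S x ∧ σ' 1 = rank S x

/-! ### Bit vector for bounded word sizes -/

/-- The membership bit of the number in the variable `3`. -/
def memberBit : Expr :=
  (Expr.read (Expr.var 3 >>> (1 : Expr)) >>> (Expr.var 3 &&& 1)) &&& 1

/-- Variable `3` runs from `x` down to `1`, variable `1` counts the members met, and variable `2`
keeps the first of them, which is the largest. Its value `0` means that none has been met; keys are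
positive. -/
def scanBody : Cmd :=
  .seq (.assign 2 (.ite 0 (.var 2) (.var 2) (.ite 0 memberBit (.var 3) 0)))
    (.seq (.assign 1 (.var 1 + memberBit)) (.assign 3 (.var 3 - 1)))

def scan : Cmd :=
  .seq (.assign 3 (.var 0)) (.seq (.while 0 (.var 3) scanBody) (.assign 0 (.var 2)))

/-- Two membership bits per word fit for every `w ≥ 2`. As `0` is not a key, the word at address `0`
is even, which tells this structure from the others, whose first word is an odd tag. -/
def bitTable (w : ℕ) (S : Finset ℕ) : List ℕ :=
  (List.range (2 ^ (w - 1))).map fun i =>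
    2 * (if 2 * i + 1 ∈ S then 1 else 0) + if 2 * i ∈ S then 1 else 0

theorem eval_memberBit {w : ℕ} (hw : 2 ≤ w) {S : Finset ℕ} {M σ : ℕ → ℕ}
    (hM : ∀ i < 2 ^ (w - 1), M i = (bitTable w S).getD i 0) {z : ℕ} (hz : σ 3 = z)
    (hzw : z < 2 ^ w) :
    memberBit.eval w M σ = if z ∈ S then 1 else 0 := by
  have h1 : 1 < 2 ^ w := Nat.one_lt_two_pow (by omega)
  have hp : 2 ^ w = 2 * 2 ^ (w - 1) := by rw [← pow_succ']; congr 1; omega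
  have e₁ := Expr.eval_shr (w := w) (M := M) (Expr.eval_var (σ := σ) 3 hz) (Expr.eval_lit 1 h1)
  have e₂ := Expr.eval_mask (y := 1) (w := w) (M := M) (Expr.eval_var (σ := σ) 3 hz)
    (Expr.eval_lit 1 h1)
  have hr := hM (z / 2 ^ 1) (by omega)
  rw [bitTable, getD_map_range _ (by omega)] at hr
  have e₃ := Expr.eval_mask (y := 1) (Expr.eval_shr (Expr.eval_read e₁ hr) e₂)
    (Expr.eval_lit 1 h1)
  rw [memberBit, e₃, pow_one]
  rcases Nat.mod_two_eq_zero_or_one z with h | h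
  · rw [h, show 2 * (z / 2) = z by omega]
    split_ifs <;> rfl
  · rw [h, show 2 * (z / 2) + 1 = z by omega]
    split_ifs <;> rfl

theorem runs_scan_while {w : ℕ} (hw : 2 ≤ w) {S : Finset ℕ} {M : ℕ → ℕ}
    (hM : ∀ i < 2 ^ (w - 1), M i = (bitTable w S).getD i 0) {x : ℕ} (hx : x < 2 ^ w) (z : ℕ) :
    ∀ σ : ℕ → ℕ, z ≤ x → σ 3 = z → σ 2 = (S.filter fun a => z < a ∧ a ≤ x).sup id →
      σ 1 = #(S.filter fun a => z < a ∧ a ≤ x) →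
      ∃ σ' t, Runs w M (.while 0 (.var 3) scanBody) σ σ' t ∧ t ≤ 100 * (z + 1) ∧
        σ' 2 = (S.filter fun a => 0 < a ∧ a ≤ x).sup id ∧
        σ' 1 = #(S.filter fun a => 0 < a ∧ a ≤ x) := by
  have h1 : 1 < 2 ^ w := Nat.one_lt_two_pow (by omega)
  induction z with
  | zero =>
    intro σ _ h3 h2 h1'
    refine ⟨σ, _, Runs.whileFalse ?_, ?_, h2, h1'⟩
    · rw [Expr.eval_lit 0 (by omega), Expr.eval_var 3 h3]; omega
    · change 1 + 1 + 2 ≤ _; omega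
  | succ z ih =>
    intro σ hzx h3 h2 h1'
    have hb := eval_memberBit hw hM h3 (by omega)
    set F := S.filter fun a => z + 1 < a ∧ a ≤ x with hF
    have hpos : 0 < F.sup id ↔ F.Nonempty := by
      constructor
      · intro h
        by_contra hc
        rw [not_nonempty_iff_eq_empty] at hc
        simp [hc] at h
      · rintro ⟨a, ha⟩
        have h₁ := le_sup (f := id) ha
        have h₂ := (mem_filter.1 ha).2.1
        simp only [id] at h₁
        omega
    have hstep : (S.filter fun a => z < a ∧ a ≤ x) = if z + 1 ∈ S then insert (z + 1) F else F := by
      ext a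
      split_ifs with h
      · simp only [mem_filter, mem_insert, hF]
        constructor
        · rintro ⟨h₁, h₂, h₃⟩
          by_cases e : a = z + 1
          · exact Or.inl e
          · exact Or.inr ⟨h₁, by omega, h₃⟩
        · rintro (rfl | ⟨h₁, h₂, h₃⟩)
          · exact ⟨h, by omega, hzx⟩
          · exact ⟨h₁, by omega, h₃⟩
      · simp only [mem_filter, hF]
        refine and_congr_right fun ha => ?_
        have : a ≠ z + 1 := fun e => h (e ▸ ha)
        omega
    have hnot : z + 1 ∉ F := by simp [hF]
    set σ₁ := Function.update σ 2 ((S.filter fun a => z < a ∧ a ≤ x).sup id) with hσ₁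
    have r₁ : Runs w M (.assign 2 (.ite 0 (.var 2) (.var 2) (.ite 0 memberBit (.var 3) 0)))
        σ σ₁ (1 + 1 + 1 + (1 + memberBit.cost + 1 + 1 + 2) + 2 + 1) := by
      refine Runs.assign_of_eq (Expr.eval_ite (Expr.eval_lit 0 (by omega)) (Expr.eval_var 2 h2)
        ?_ ?_)
      · intro h
        refine Expr.eval_var 2 ?_
        rw [h2, hstep]
        split_ifs
        · rw [sup_insert]
          obtain ⟨a, ha⟩ := hpos.1 h
          have h₁ := le_sup (f := id) ha
          have h₂ := (mem_filter.1 ha).2.1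
          simp only [id] at h₁
          exact (max_eq_right (by simp only [id]; omega)).symm
        · rfl
      · intro h
        have hFe : F = ∅ := by
          rw [← not_nonempty_iff_eq_empty, ← hpos]; exact h
        refine Expr.eval_ite (Expr.eval_lit 0 (by omega)) hb (fun h' => ?_) (fun h' => ?_)
        · refine Expr.eval_var 3 ?_
          have : z + 1 ∈ S := by
            by_contra hc
            simp [hc] at h'
          rw [hstep, if_pos this, hFe, h3]; simp
        · have : z + 1 ∉ S := by
            intro hc
            simp [hc] at h'
          rw [Expr.eval_lit 0 (by omega), hstep, if_neg this, hFe]; simp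
    set σ₂ := Function.update σ₁ 1 #(S.filter fun a => z < a ∧ a ≤ x) with hσ₂
    have hcw : #F ≤ x := by
      have : F ⊆ Ioc 0 x := fun a ha => by
        rw [hF, mem_filter] at ha
        rw [mem_Ioc]; omega
      simpa using card_le_card this
    have hcard : #F + (if z + 1 ∈ S then 1 else 0) = #(S.filter fun a => z < a ∧ a ≤ x) := by
      rw [hstep]
      split_ifs
      · rw [card_insert_of_notMem hnot]
      · rfl
    have r₂ : Runs w M (.assign 1 (.var 1 + memberBit)) σ₁ σ₂
        (1 + memberBit.cost + 1 + 1) := by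
      refine Runs.assign_of_eq ?_
      rw [← hcard]
      refine Expr.eval_add (Expr.eval_var 1 ?_)
        (eval_memberBit hw hM (by simpa [hσ₁] using h3) (by omega)) ?_
      · simpa [hσ₁] using h1'
      · have : #(S.filter fun a => z < a ∧ a ≤ x) ≤ x := by
          have : (S.filter fun a => z < a ∧ a ≤ x) ⊆ Ioc 0 x := fun a ha => by
            rw [mem_filter] at ha
            rw [mem_Ioc]; omega
          simpa using card_le_card this
        rw [hstep] at this
        split_ifs at this ⊢
        · rw [card_insert_of_notMem hnot] at this; omega
        · omega
    have r₃ : Runs w M (.assign 3 (.var 3 - 1)) σ₂ (Function.update σ₂ 3 z)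
        (1 + 1 + 1 + 1) :=
      Runs.assign_of_eq (Expr.eval_sub (x := z + 1) (y := 1)
        (Expr.eval_var 3 (by simpa [hσ₁, hσ₂] using h3)) (Expr.eval_lit 1 h1) (by omega) (by omega))
    obtain ⟨σ', t, hr, ht, e₁, e₂⟩ := ih (Function.update σ₂ 3 z) (by omega) (by simp)
      (by simp [hσ₂, hσ₁]) (by simp [hσ₂])
    refine ⟨σ', _, Runs.whileTrue ?_ (Runs.seq r₁ (Runs.seq r₂ r₃)) hr, ?_, e₁, e₂⟩
    · rw [Expr.eval_lit 0 (by omega), Expr.eval_var 3 h3]; omega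
    · have : memberBit.cost = 10 := rfl
      change 1 + 1 + 2 + (1 + 1 + 1 + (1 + memberBit.cost + 1 + 1 + 2) + 2 + 1 +
        (1 + memberBit.cost + 1 + 1 + (1 + 1 + 1 + 1))) + t ≤ _
      omega

theorem solves_scan {w u : ℕ} (hw : 2 ≤ w) (hu : u < 2 ^ w) {S : Finset ℕ}
    (hS : S ⊆ Icc 1 u) {M : ℕ → ℕ} (hM : ∀ i < 2 ^ (w - 1), M i = (bitTable w S).getD i 0) :
    Solves w u S M scan (100 * 2 ^ w + 100) := by
  intro x hx hxu
  have r₁ := Runs.assign (w := w) (M := M) 3 (.var 0) (start x)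
  rw [Expr.eval_var (x := x) 0 (by simp [start])] at r₁
  have hempty : (S.filter fun a => x < a ∧ a ≤ x) = ∅ := by
    refine filter_eq_empty_iff.2 fun a _ => by omega
  obtain ⟨σ', t, hr, ht, e₁, e₂⟩ := runs_scan_while hw hM (show x < 2 ^ w by omega) x
    (Function.update (start x) 3 x) le_rfl (by simp) (by rw [hempty]; simp [start])
    (by rw [hempty]; simp [start])
  have hfil : (S.filter fun a => 0 < a ∧ a ≤ x) = S.filter (· ≤ x) := by
    refine filter_congr fun a ha => ?_
    have := mem_Icc.1 (hS ha)
    omega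
  have r₃ := Runs.assign (w := w) (M := M) 0 (.var 2) σ'
  rw [Expr.eval_var (x := σ' 2) 2 rfl] at r₃
  refine ⟨_, _, Runs.seq r₁ (Runs.seq hr r₃), ?_, ?_, ?_⟩
  · change 1 + 1 + (t + (1 + 1)) ≤ _
    omega
  · simp only [Function.update_self]
    rw [e₁, hfil, pred]
  · rw [Function.update_of_ne (by norm_num), e₂, hfil, rank]

/-- Command for the empty set. -/
def answerNone : Cmd := .seq (.assign 0 0) (.assign 1 0)

theorem solves_answerNone {w u : ℕ} (M : ℕ → ℕ) : Solves w u ∅ M answerNone 10 := by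
  intro x _ _
  refine ⟨_, _, Runs.seq (Runs.assign _ _ _) (Runs.assign _ _ _), ?_, ?_, ?_⟩
  · change 1 + 1 + (1 + 1) ≤ 10
    norm_num
  · rw [Function.update_of_ne (by norm_num), Function.update_self,
      Expr.eval_lit 0 (by positivity)]
    simp [pred]
  · rw [Function.update_self, Expr.eval_lit 0 (by positivity)]
    simp [rank]

end WordRAM

namespace WordRAM
open Finset

/-! ### Sorted enumeration -/

/-- The elements of `A` in increasing order. -/
def enum (A : Finset ℕ) (t : ℕ) : ℕ := if h : t < #A then A.orderEmbOfFin rfl ⟨t, h⟩ else 0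

theorem enum_mem {A : Finset ℕ} {t : ℕ} (h : t < #A) : enum A t ∈ A := by
  rw [enum, dif_pos h]; exact orderEmbOfFin_mem _ _ _

theorem enum_lt_enum {A : Finset ℕ} {s t : ℕ} (hst : s < t) (h : t < #A) :
    enum A s < enum A t := by
  rw [enum, enum, dif_pos h, dif_pos (hst.trans h)]
  simpa using hst

theorem exists_enum_eq {A : Finset ℕ} {a : ℕ} (ha : a ∈ A) : ∃ t < #A, enum A t = a := by
  have : a ∈ Set.range (A.orderEmbOfFin rfl) := by rw [range_orderEmbOfFin]; exact ha
  obtain ⟨⟨t, ht⟩, e⟩ := this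
  exact ⟨t, ht, by rw [enum, dif_pos ht, e]⟩

theorem image_enum (A : Finset ℕ) : (range #A).image (enum A) = A := by
  ext a
  simp only [mem_image, mem_range]
  exact ⟨fun ⟨t, ht, e⟩ => e ▸ enum_mem ht, fun h => exists_enum_eq h⟩

theorem enum_injOn (A : Finset ℕ) : Set.InjOn (enum A) (range #A) := by
  intro s hs t ht h
  simp only [coe_range, Set.mem_Iio] at hs ht
  rcases lt_trichotomy s t with h' | h' | h'
  · exact absurd h (enum_lt_enum h' ht).ne
  · exact h'
  · exact absurd h (enum_lt_enum h' hs).ne'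

theorem card_filter_enum (A : Finset ℕ) (P : ℕ → Prop) [DecidablePred P] :
    #{t ∈ range #A | P (enum A t)} = #(A.filter P) := by
  conv_rhs => rw [← image_enum A, filter_image]
  rw [card_image_of_injOn]
  exact (enum_injOn A).mono fun t ht => (mem_filter.1 ht).1

/-- Turns the count of indices that satisfy a downward closed condition into the threshold of that
condition; used for all counts in sorted sequences. -/
theorem eq_range_card {A : Finset ℕ} (h : ∀ a ∈ A, ∀ b < a, b ∈ A) : A = range #A := by
  refine eq_of_subset_of_card_le (fun a ha => ?_) (by simp)
  have : range (a + 1) ⊆ A := fun b hb => by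
    rcases Nat.lt_succ_iff_lt_or_eq.1 (mem_range.1 hb) with h' | rfl
    exacts [h a ha b h', ha]
  have := card_le_card this
  rw [card_range] at this
  exact mem_range.2 (by omega)

theorem enum_le_iff {A : Finset ℕ} {t d : ℕ} (ht : t < #A) :
    enum A t ≤ d ↔ t < #(A.filter (· ≤ d)) := by
  have h : {t ∈ range #A | enum A t ≤ d} = range #(A.filter (· ≤ d)) := by
    rw [← card_filter_enum A (· ≤ d)]
    refine eq_range_card fun a ha b hb => ?_
    rw [mem_filter, mem_range] at ha ⊢
    exact ⟨by omega, (enum_lt_enum hb ha.1).le.trans ha.2⟩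
  have := congrArg (t ∈ ·) h
  simpa [ht] using this

theorem sup_filter_le_eq_enum {A : Finset ℕ} {d : ℕ} (h : 0 < #(A.filter (· ≤ d))) :
    (A.filter (· ≤ d)).sup id = enum A (#(A.filter (· ≤ d)) - 1) := by
  have hlt : #(A.filter (· ≤ d)) - 1 < #A := by
    have := card_filter_le A (· ≤ d); omega
  refine le_antisymm (Finset.sup_le fun a ha => ?_) ?_
  · obtain ⟨ha, had⟩ := mem_filter.1 ha
    obtain ⟨t, ht, rfl⟩ := exists_enum_eq ha
    have := (enum_le_iff ht).1 had
    rcases Nat.lt_or_ge t (#(A.filter (· ≤ d)) - 1) with h' | h'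
    · exact (enum_lt_enum h' hlt).le
    · rw [show #(A.filter (· ≤ d)) - 1 = t by omega]; exact le_rfl
  · exact le_sup (f := id) (mem_filter.2 ⟨enum_mem hlt, (enum_le_iff hlt).2 (by omega)⟩)

/-! ### Jump points of a monotone function and their trie -/

/-- The points up to `u` where `G` increases, and `0`. -/
def jumps (G : ℕ → ℕ) (u : ℕ) : Finset ℕ := {z ∈ range (u + 1) | z = 0 ∨ G (z - 1) < G z}

/-- `G` is strictly increasing on its jump points, hence injective there with values in `[0, G u]`.
-/
theorem card_jumps_le {G : ℕ → ℕ} (hG : Monotone G) (u : ℕ) : #(jumps G u) ≤ G u + 1 := by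
  rw [← card_range (G u + 1)]
  refine card_le_card_of_injOn G (fun z hz => ?_) ?_
  · simp only [jumps, coe_filter, mem_range, Set.mem_ofPred_eq] at hz
    simp only [coe_range, Set.mem_Iio]
    have := hG (show z ≤ u by omega)
    omega
  · have key : ∀ z z', z ∈ jumps G u → z' ∈ jumps G u → z < z' → G z < G z' := by
      intro z z' _ hz' hlt
      simp only [jumps, mem_filter] at hz'
      rcases hz'.2 with h | h
      · omega
      · exact (hG (show z ≤ z' - 1 by omega)).trans_lt h
    intro z hz z' hz' h
    rcases lt_trichotomy z z' with h' | h' | h'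
    · exact absurd h (key z z' hz hz' h').ne
    · exact h'
    · exact absurd h (key z' z hz' hz h').ne'

theorem eq_of_no_jump {G : ℕ → ℕ} (hG : Monotone G) {u E x : ℕ} (hE : E ≤ x) (hx : x ≤ u)
    (h : ∀ s ∈ jumps G u, E < s → ¬ s ≤ x) : G x = G E := by
  induction x, hE using Nat.le_induction with
  | base => rfl
  | succ x hEx ih =>
    rw [← ih (by omega) fun s hs h₁ h₂ => h s hs h₁ (by omega)]
    by_contra hne
    have hlt : G x < G (x + 1) := lt_of_le_of_ne (hG (by omega)) (Ne.symm hne)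
    refine h (x + 1) ?_ (by omega) le_rfl
    simp only [jumps, mem_filter, mem_range]
    exact ⟨by omega, Or.inr (by simpa using hlt)⟩

/-- The next chunks of the jump points below the node with prefix `p` and `q` remaining bits
after the chunk. -/
def chunks (A : Finset ℕ) (c q p : ℕ) : Finset ℕ :=
  (A.filter fun s => s / 2 ^ (c + q) = p).image fun s => s / 2 ^ q % 2 ^ c

/-- Value of `G` behind the first `i` children of a node. -/
def nodeValue (G : ℕ → ℕ) (A : Finset ℕ) (c q p i : ℕ) : ℕ :=
  if i = 0 then G (p * 2 ^ (c + q))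
  else G ((p * 2 ^ c + enum (chunks A c q p) (i - 1) + 1) * 2 ^ q - 1)

theorem chunks_subset (A : Finset ℕ) (c q p : ℕ) : chunks A c q p ⊆ range (2 ^ c) := by
  intro a ha
  obtain ⟨s, _, rfl⟩ := mem_image.1 ha
  exact mem_range.2 (Nat.mod_lt _ (by positivity))

theorem div_pow_eq (x c q : ℕ) : x / 2 ^ q = x / 2 ^ (c + q) * 2 ^ c + x / 2 ^ q % 2 ^ c := by
  rw [Nat.add_comm c q, pow_add, ← Nat.div_div_eq_div_mul]
  exact (Nat.div_add_mod' _ _).symm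

/-- The stored value is that of `G` at a point `E ≤ x` such that no jump lies in `(E, x]`: the start
of the node's interval if no child precedes or contains `x`, else the end of the interval of the
last child whose chunk `lo` is at most the chunk `d` of `x`. For `lo < d` this interval ends before
`x`. The case `lo = d` is excluded by the hypothesis that the trie has no longer prefix of `x`,
except on the last level, where the interval is the point `x`. A jump in `(E, x]` would lie below
the node in a child with chunk at most `lo`, hence not after `E`. -/
theorem nodeValue_eq {G : ℕ → ℕ} (hG : Monotone G) {u x c q : ℕ} (hx : x ≤ u)
    (hq : q = 0 ∨ ∀ s ∈ jumps G u, s / 2 ^ q ≠ x / 2 ^ q) :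
    nodeValue G (jumps G u) c q (x / 2 ^ (c + q))
      #((chunks (jumps G u) c q (x / 2 ^ (c + q))).filter (· ≤ x / 2 ^ q % 2 ^ c)) = G x := by
  set A := jumps G u with hA
  set p := x / 2 ^ (c + q) with hp
  set d := x / 2 ^ q % 2 ^ c with hd
  set Ch := chunks A c q p with hCh
  set i := #(Ch.filter (· ≤ d)) with hi
  have hxq : x / 2 ^ q = p * 2 ^ c + d := div_pow_eq x c q
  have hQ : 0 < 2 ^ q := by positivity
  have hcq : 2 ^ (c + q) = 2 ^ c * 2 ^ q := pow_add _ _ _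
  have hmem : ∀ s ∈ A, s / 2 ^ (c + q) = p → s ≤ x →
      s / 2 ^ q % 2 ^ c ∈ Ch ∧ s / 2 ^ q % 2 ^ c ≤ d := by
    intro s hs hsp hsx
    refine ⟨mem_image.2 ⟨s, mem_filter.2 ⟨hs, hsp⟩, rfl⟩, ?_⟩
    have h₁ : s / 2 ^ q ≤ x / 2 ^ q := Nat.div_le_div_right hsx
    rw [hxq, div_pow_eq s c q, hsp] at h₁
    omega
  unfold nodeValue
  split_ifs with h0
  · refine (eq_of_no_jump hG (Nat.div_mul_le_self _ _) hx fun s hs h₁ h₂ => ?_).symm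
    have hsp : s / 2 ^ (c + q) = p := by
      refine le_antisymm (Nat.div_le_div_right h₂) ?_
      rw [Nat.le_div_iff_mul_le (by positivity)]
      exact h₁.le
    obtain ⟨h₃, h₄⟩ := hmem s hs hsp h₂
    rw [hi, card_eq_zero] at h0
    exact notMem_empty _ (h0 ▸ mem_filter.2 ⟨h₃, h₄⟩)
  · have hlt : i - 1 < #Ch := by
      have := card_filter_le Ch (· ≤ d); omega
    set lo := enum Ch (i - 1) with hlo
    have hlod : lo ≤ d := (enum_le_iff hlt).2 (by omega)
    have hEx : (p * 2 ^ c + lo + 1) * 2 ^ q - 1 ≤ x := by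
      have hxx : (p * 2 ^ c + d) * 2 ^ q ≤ x := by rw [← hxq]; exact Nat.div_mul_le_self _ _
      rcases Nat.lt_or_ge lo d with h | h
      · have : (p * 2 ^ c + lo + 1) * 2 ^ q ≤ (p * 2 ^ c + d) * 2 ^ q :=
          Nat.mul_le_mul_right _ (by omega)
        omega
      · have hld : lo = d := by omega
        rcases hq with hq | hq
        · subst hq
          simp only [pow_zero, Nat.mul_one] at hxx ⊢
          omega
        · exfalso
          obtain ⟨s, hs, e⟩ := mem_image.1 (enum_mem hlt)
          obtain ⟨hs, hsp⟩ := mem_filter.1 hs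
          refine hq s hs ?_
          have e' : s / 2 ^ q % 2 ^ c = lo := e
          rw [div_pow_eq s c q, hsp, e', hxq, hld]
    refine (eq_of_no_jump hG hEx hx fun s hs h₁ h₂ => ?_).symm
    have hs₁ : p * 2 ^ c + lo + 1 ≤ s / 2 ^ q := by
      rw [Nat.le_div_iff_mul_le hQ]; omega
    have hsp : s / 2 ^ (c + q) = p := by
      refine le_antisymm (Nat.div_le_div_right h₂) ?_
      rw [Nat.add_comm c q, pow_add, ← Nat.div_div_eq_div_mul,
        Nat.le_div_iff_mul_le (by positivity)]
      omega
    obtain ⟨h₃, h₄⟩ := hmem s hs hsp h₂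
    obtain ⟨t, ht, e⟩ := exists_enum_eq h₃
    have hti : t < i := (enum_le_iff ht).1 (e ▸ h₄)
    have hle : s / 2 ^ q % 2 ^ c ≤ lo := by
      rw [← e]
      rcases Nat.lt_or_ge t (i - 1) with h' | h'
      · exact (enum_lt_enum h' hlt).le
      · rw [hlo, show i - 1 = t by omega]
    rw [div_pow_eq s c q, hsp] at hs₁
    omega

theorem sum_card_chunks_le (A : Finset ℕ) (c q : ℕ) :
    ∑ p ∈ A.image fun s => s / 2 ^ (c + q), #(chunks A c q p) ≤ #A := by
  calc _ ≤ ∑ p ∈ A.image fun s => s / 2 ^ (c + q), #(A.filter fun s => s / 2 ^ (c + q) = p) :=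
        sum_le_sum fun p _ => card_image_le
    _ = #A := (card_eq_sum_card_image _ _).symm

/-- Search key of the prefix of `x` without the last `e` bits. -/
def trieKey (w e x : ℕ) : ℕ := (2 ^ w + x) / 2 ^ e

theorem trieKey_eq {w e x : ℕ} (he : e ≤ w) : trieKey w e x = 2 ^ (w - e) + x / 2 ^ e := by
  rw [trieKey, show 2 ^ w = 2 ^ (w - e) * 2 ^ e by rw [← pow_add]; congr 1; omega,
    Nat.add_comm, Nat.add_mul_div_right _ _ (by positivity), Nat.add_comm]

theorem trieKey_of_lt {w e x : ℕ} (he : w < e) (hx : x < 2 ^ w) : trieKey w e x = 0 := by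
  refine Nat.div_eq_of_lt ?_
  calc 2 ^ w + x < 2 ^ (w + 1) := by rw [pow_succ]; omega
    _ ≤ 2 ^ e := Nat.pow_le_pow_right (by norm_num) he

theorem log_trieKey {w e x : ℕ} (he : e ≤ w) (hx : x < 2 ^ w) :
    Nat.log 2 (trieKey w e x) = w - e := by
  have hlt : x / 2 ^ e < 2 ^ (w - e) := by
    refine Nat.div_lt_of_lt_mul ?_
    rw [← pow_add]
    exact hx.trans_le (Nat.pow_le_pow_right (by norm_num) (by omega))
  rw [trieKey_eq he]
  refine Nat.log_eq_of_pow_le_of_lt_pow (Nat.le_add_right _ _) ?_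
  rw [pow_succ]; omega

theorem trieKey_lt {w e x : ℕ} (he : 0 < e) (hx : x < 2 ^ w) : trieKey w e x < 2 ^ w := by
  refine Nat.div_lt_of_lt_mul ?_
  have : 2 ^ 1 ≤ 2 ^ e := Nat.pow_le_pow_right (by norm_num) he
  nlinarith

/-- The leading one of `2 ^ w + x` marks the length of the prefix, so keys of different levels
differ. Since `c * (J - 1) ≤ w`, only the root level can drop more than `w` bits; its key is then
`0` for every `x`, while all other keys are positive. -/
theorem trieKey_inj {w c J j j' x y : ℕ} (hc : 0 < c) (hJ : c * (J - 1) ≤ w)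
    (hj : j < J) (hj' : j' < J) (hx : x < 2 ^ w) (hy : y < 2 ^ w)
    (h : trieKey w (c * (J - j)) x = trieKey w (c * (J - j')) y) :
    j = j' ∧ x / 2 ^ (c * (J - j)) = y / 2 ^ (c * (J - j')) := by
  have hz : ∀ i < J, w < c * (J - i) → i = 0 := by
    intro i _ hlt
    by_contra hne
    have : c * (J - i) ≤ c * (J - 1) := Nat.mul_le_mul_left _ (by omega)
    omega
  have hpos : ∀ i x, c * (J - i) ≤ w → 0 < trieKey w (c * (J - i)) x := by
    intro i x hi
    rw [trieKey_eq hi]; positivity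
  by_cases h₁ : c * (J - j) ≤ w <;> by_cases h₂ : c * (J - j') ≤ w
  · have e := congrArg (Nat.log 2) h
    rw [log_trieKey h₁ hx, log_trieKey h₂ hy] at e
    have e' : J - j = J - j' := Nat.eq_of_mul_eq_mul_left hc (by omega)
    have e'' : j = j' := by omega
    subst e''
    rw [trieKey_eq h₁, trieKey_eq h₁] at h
    exact ⟨rfl, by omega⟩
  · have := hpos j x h₁
    rw [h, trieKey_of_lt (by omega) hy] at this
    omega
  · have := hpos j' y h₂
    rw [← h, trieKey_of_lt (by omega) hx] at this
    omega
  · have e₁ := hz j hj (by omega)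
    have e₂ := hz j' hj' (by omega)
    subst e₁ e₂
    refine ⟨rfl, ?_⟩
    have hp : 2 ^ w ≤ 2 ^ (c * (J - 0)) := Nat.pow_le_pow_right (by norm_num) (by omega)
    rw [Nat.div_eq_of_lt (by omega), Nat.div_eq_of_lt (by omega)]

end WordRAM

namespace WordRAM
open Finset

/-- The parameter stored at the address `i`. -/
def param (i : ℕ) : Expr := .read (.const i)

theorem eval_param {w : ℕ} {M σ : ℕ → ℕ} {i v : ℕ} (hi : i < 2 ^ w) (h : M i = v) :
    (param i).eval w M σ = v :=
  Expr.eval_read (Nat.mod_eq_of_lt hi) h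

/-! ### Searching the trie -/

/-- `2 ^ w + x` does not fit in a word, so both summands are halved and the shift is one less. -/
def keyExpr (m : Expr) : Expr :=
  ((Expr.var 0 >>> (1 : Expr)) + param 5) >>> (param 3 * (param 1 - m) - 1)

def findExpr (m : Expr) : Expr := Expr.lookup (param 6) (param 7) (param 8) (keyExpr m)

def chunkExpr : Expr := (Expr.var 0 >>> (param 3 * (param 1 - .var 2 - 1))) &&& param 14

def childExpr : Expr :=
  .read (.var 5 + 1 + Expr.count (param 9) (param 10) (param 3) (param 12) (param 13)
    (.read (.var 5)) chunkExpr)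

/-- Variables `2`, `3`, `4` are bounds and midpoint of the search over the levels, `5` is the
address of the node, and `6` the value of `G`. A zero flag at address `2` means that no trie is
stored and the value is `0`. -/
def trieSearch : Cmd :=
  .seq (.assign 2 0) (.seq (.assign 3 (param 1)) (.seq (.bsearch 2 3 4 (findExpr (.var 4)))
    (.seq (.assign 5 (findExpr (.var 2))) (.assign 6 (.ite 0 (param 2) childExpr 0)))))

/-- Number of steps of the constant-time parts of `trieSearch`. -/
def trieCost : ℕ := (findExpr (.var 4)).cost + childExpr.cost + 100

/-- Keys of the trie nodes above the set `A`. -/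
def nodeKeys (w c J : ℕ) (A : Finset ℕ) : Finset ℕ :=
  (range J ×ˢ A).image fun js => trieKey w (c * (J - js.1)) js.2

/-- Fields of the word that holds the children of a node. -/
def childField (Ch : Finset ℕ) (c t : ℕ) : ℕ := if t < #Ch then enum Ch t else 2 ^ c

/-- The memory contains the trie of the jump points of `G`. -/
structure HasTrie (w u : ℕ) (G : ℕ → ℕ) (c J : ℕ) (M : ℕ → ℕ) : Prop where
  levels : M 1 = J
  flag : M 2 = 1
  width : M 3 = c
  top : M 5 = 2 ^ (w - 1)
  ones : M 9 = pack (c + 1) (2 ^ c) fun _ => 1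
  tops : M 10 = pack (c + 1) (2 ^ c) fun _ => 2 ^ c
  last : M 12 = (c + 1) * (2 ^ c - 1)
  mask : M 13 = 2 ^ (c + 1) - 1
  chunk : M 14 = 2 ^ c - 1
  nodes : ∃ v : ℕ → ℕ,
    (∀ σ kE κ, kE.eval w M σ = κ → (Expr.lookup (param 6) (param 7) (param 8) kE).eval w M σ =
      if κ ∈ nodeKeys w c J (jumps G u) then v κ else 0) ∧
    ∀ j < J, ∀ s ∈ jumps G u, ∀ ptr, ptr = v (trieKey w (c * (J - j)) s) →
      ∀ q, q = c * (J - j - 1) → ∀ p, p = s / 2 ^ (c + q) →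
        0 < ptr ∧ ptr + 1 + 2 ^ c < 2 ^ w ∧
        M ptr = pack (c + 1) (2 ^ c) (childField (chunks (jumps G u) c q p) c) ∧
        ∀ i ≤ #(chunks (jumps G u) c q p), M (ptr + 1 + i) = nodeValue G (jumps G u) c q p i

theorem card_childField_le {Ch : Finset ℕ} {c d : ℕ} (hCh : Ch ⊆ range (2 ^ c)) (hd : d < 2 ^ c) :
    #{t ∈ range (2 ^ c) | childField Ch c t ≤ d} = #(Ch.filter (· ≤ d)) := by
  have hle : #Ch ≤ 2 ^ c := by simpa using card_le_card hCh
  rw [← card_filter_enum Ch (· ≤ d)]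
  congr 1
  ext t
  rw [mem_filter, mem_filter, mem_range, mem_range, childField]
  split_ifs with h
  · simp [h, h.trans_le hle]
  · simp [h]; omega

/-- The search predicate says that the prefix of `x` at level `m` is a trie node. By `hroot` it
holds at level `0`, so the search ends at a node whose successor towards `x` is missing or which
lies on the last level. These are the hypotheses of `nodeValue_eq`. -/
theorem runs_trieSearch {w u : ℕ} {G : ℕ → ℕ} {c J : ℕ} {M : ℕ → ℕ} (h : HasTrie w u G c J M)
    (hw : 64 ≤ w) (hu : u < 2 ^ w) (hG : Monotone G) (hc : 0 < c) (hJ : 0 < J)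
    (hJw : c * (J - 1) ≤ w) (hcw : (c + 1) * 2 ^ c ≤ w)
    (hroot : ∀ x ≤ u, ∃ s ∈ jumps G u, s / 2 ^ (c * J) = x / 2 ^ (c * J)) {x : ℕ} (hx : x ≤ u) :
    ∃ σ' t, Runs w M trieSearch (start x) σ' t ∧ t ≤ 2 * trieCost * (Nat.clog 2 J + 1) ∧
      σ' 0 = x ∧ σ' 6 = G x := by
  obtain ⟨v, hlook, hnode⟩ := h.nodes
  have hww : 4 * w < 2 ^ w := by
    have h₁ : ∀ n, 64 ≤ n → 4 * n < 2 ^ n := by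
      intro n hn
      induction n, hn using Nat.le_induction with
      | base => norm_num
      | succ n _ ih => rw [pow_succ]; omega
    exact h₁ w hw
  have hcle : c + 1 ≤ w := (Nat.le_mul_of_pos_right _ (by positivity)).trans hcw
  have hJle : c * J ≤ 2 * w := by
    obtain ⟨J', rfl⟩ : ∃ J', J = J' + 1 := ⟨J - 1, by omega⟩
    rw [Nat.add_sub_cancel] at hJw
    rw [Nat.mul_succ]; omega
  have hJ2 : J ≤ c * J := Nat.le_mul_of_pos_left _ hc
  have hprm : ∀ {i a : ℕ} {σ : ℕ → ℕ}, i < 64 → M i = a → (param i).eval w M σ = a :=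
    fun hi e => eval_param (by omega) e
  have hlit : ∀ {i : ℕ} {σ : ℕ → ℕ}, i < 64 → (OfNat.ofNat i : Expr).eval w M σ = i :=
    fun hi => Expr.eval_lit _ (by omega)
  have hmulJ : ∀ m, c * (J - m) ≤ 2 * w := fun m =>
    (Nat.mul_le_mul_left c (Nat.sub_le J m)).trans hJle
  have hpw : 2 ^ w = 2 * 2 ^ (w - 1) := by rw [← pow_succ']; congr 1; omega
  have hkey : ∀ (σ : ℕ → ℕ) (mE : Expr) (m : ℕ), σ 0 = x → mE.eval w M σ = m → m < J →
      (keyExpr mE).eval w M σ = trieKey w (c * (J - m)) x := by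
    intro σ mE m h0 hm hmJ
    have hpos : 0 < c * (J - m) := Nat.mul_pos hc (by omega)
    have e₁ := Expr.eval_sub (Expr.eval_mul (hprm (σ := σ) (by norm_num) h.width)
      (Expr.eval_sub (hprm (by norm_num) h.levels) hm hmJ.le (by omega))
      (by have := hmulJ m; omega)) (hlit (i := 1) (by norm_num)) (by omega)
      (by have := hmulJ m; omega)
    have e₂ := Expr.eval_shr (Expr.eval_add (Expr.eval_shr (Expr.eval_var 0 h0)
      (hlit (i := 1) (by norm_num))) (hprm (by norm_num) h.top) (by rw [pow_one]; omega)) e₁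
    rw [keyExpr, e₂, trieKey, pow_one, show x / 2 + 2 ^ (w - 1) = (2 ^ w + x) / 2 by omega,
      Nat.div_div_eq_div_mul, ← pow_succ']
    congr 2; omega
  have hfind : ∀ (σ : ℕ → ℕ) (mE : Expr) (m : ℕ), σ 0 = x → mE.eval w M σ = m → m < J →
      (findExpr mE).eval w M σ = if trieKey w (c * (J - m)) x ∈ nodeKeys w c J (jumps G u) then
        v (trieKey w (c * (J - m)) x) else 0 := fun σ mE m h0 hm hmJ =>
    hlook σ _ _ (hkey σ mE m h0 hm hmJ)
  have hjlt : ∀ s ∈ jumps G u, s < 2 ^ w := fun s hs => by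
    have := mem_range.1 (mem_filter.1 hs).1; omega
  set P : ℕ → Prop := fun m => ∃ s ∈ jumps G u, s / 2 ^ (c * (J - m)) = x / 2 ^ (c * (J - m))
    with hP
  have hkeyEq : ∀ {m s}, m < J → s ∈ jumps G u →
      s / 2 ^ (c * (J - m)) = x / 2 ^ (c * (J - m)) →
      trieKey w (c * (J - m)) s = trieKey w (c * (J - m)) x := by
    intro m s hm hs e
    by_cases hle : c * (J - m) ≤ w
    · rw [trieKey_eq hle, trieKey_eq hle, e]
    · rw [trieKey_of_lt (by omega) (hjlt s hs), trieKey_of_lt (by omega) (by omega)]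
  have hmemP : ∀ m < J, (trieKey w (c * (J - m)) x ∈ nodeKeys w c J (jumps G u) ↔ P m) := by
    intro m hm
    rw [nodeKeys, mem_image]
    constructor
    · rintro ⟨⟨j, s⟩, hjs, e⟩
      rw [mem_product, mem_range] at hjs
      obtain ⟨rfl, e'⟩ := trieKey_inj hc hJw hjs.1 hm (hjlt s hjs.2) (by omega) e
      exact ⟨s, hjs.2, e'⟩
    · rintro ⟨s, hs, e⟩
      exact ⟨(m, s), mem_product.2 ⟨mem_range.2 hm, hs⟩, hkeyEq hm hs e⟩
  have r₁ : Runs w M (.assign 2 0) (start x) (Function.update (start x) 2 0) (1 + 1) :=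
    Runs.assign_of_eq (hlit (i := 0) (by norm_num))
  have r₂ : Runs w M (.assign 3 (param 1)) (Function.update (start x) 2 0)
      (Function.update (Function.update (start x) 2 0) 3 J) (1 + 1 + 1) :=
    Runs.assign_of_eq (hprm (by norm_num) h.levels)
  set σ₂ := Function.update (Function.update (start x) 2 0) 3 J with hσ₂
  obtain ⟨j, b', m', t₃, r₃, -, hjJ, hPj, hPj', ht₃⟩ := runs_bsearch (w := w) (M := M) (σ := σ₂)
    (lo := 2) (hi := 3) (mid := 4) (p := findExpr (.var 4)) (by omega) (by norm_num) (by norm_num)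
    (by norm_num) P (a := 0) (b := J) (by simp [hσ₂]) (by simp [hσ₂]) hJ (by omega) (by
      intro m a' b' _ hmJ
      rw [hfind _ (.var 4) m (by simp [hσ₂, start]) (Expr.eval_var 4 (by simp)) hmJ,
        ← hmemP m hmJ]
      split_ifs with hmem
      · simp only [hmem, iff_true]
        obtain ⟨s, hs, e⟩ := (hmemP m hmJ).1 hmem
        rw [← hkeyEq hmJ hs e]
        exact (hnode m hmJ s hs _ rfl _ rfl _ rfl).1
      · simp [hmem])
  have hPj : P j := by
    rcases hPj with rfl | hPj
    · simpa [hP] using hroot x hx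
    · exact hPj
  obtain ⟨s, hs, hsx⟩ := id hPj
  set σ₃ := Function.update (Function.update (Function.update σ₂ 2 j) 3 b') 4 m' with hσ₃
  have hptr : (findExpr (.var 2)).eval w M σ₃ = v (trieKey w (c * (J - j)) s) := by
    rw [hfind _ (.var 2) j (by simp [hσ₃, hσ₂, start])
      (Expr.eval_var 2 (by simp [hσ₃])) hjJ, if_pos ((hmemP j hjJ).2 hPj), hkeyEq hjJ hs hsx]
  set ptr := v (trieKey w (c * (J - j)) s) with hptr'
  have r₄ : Runs w M (.assign 5 (findExpr (.var 2))) σ₃ (Function.update σ₃ 5 ptr)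
      ((findExpr (.var 2)).cost + 1) := Runs.assign_of_eq hptr
  set σ₄ := Function.update σ₃ 5 ptr with hσ₄
  set q := c * (J - j - 1) with hq
  have hcq : c + q = c * (J - j) := by
    obtain ⟨i, hi⟩ : ∃ i, J - j = i + 1 := ⟨J - j - 1, by omega⟩
    rw [hq, hi, Nat.add_sub_cancel, Nat.mul_succ, Nat.add_comm]
  obtain ⟨hp₁, hp₂, hp₃, hp₄⟩ := hnode j hjJ s hs ptr rfl q rfl _ rfl
  rw [hcq, hsx] at hp₃ hp₄
  rw [← hcq] at hp₃ hp₄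
  set Ch := chunks (jumps G u) c q (x / 2 ^ (c + q)) with hCh
  have hd : x / 2 ^ q % 2 ^ c < 2 ^ c := Nat.mod_lt _ (by positivity)
  have hchunk : chunkExpr.eval w M σ₄ = x / 2 ^ q % 2 ^ c := by
    have hqle : q ≤ 2 * w := (Nat.le_add_left q c).trans (hcq ▸ hmulJ j)
    refine Expr.eval_mask (Expr.eval_shr (Expr.eval_var 0 (by simp [hσ₄, hσ₃, hσ₂, start]))
      (Expr.eval_mul (hprm (by norm_num) h.width) (Expr.eval_sub (Expr.eval_sub
        (hprm (by norm_num) h.levels) (Expr.eval_var 2 (by simp [hσ₄, hσ₃])) hjJ.le (by omega))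
        (hlit (i := 1) (by norm_num)) (by omega) (by omega)) (by omega)))
      (hprm (by norm_num) h.chunk)
  have hfield : ∀ t < 2 ^ c, childField Ch c t ≤ 2 ^ c := by
    intro t _
    unfold childField
    split_ifs with ht
    · exact (mem_range.1 (chunks_subset _ _ _ _ (enum_mem ht))).le
    · exact le_rfl
  have hcount := Expr.eval_count (w := w) (M := M) (σ := σ₄) (by positivity) hcw
    (Nat.pow_lt_pow_right (by norm_num) (by omega)) (hprm (by norm_num) h.ones)
    (hprm (by norm_num) h.tops) (hprm (by norm_num) h.width) (hprm (by norm_num) h.last)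
    (hprm (by norm_num) h.mask) (Expr.eval_read (Expr.eval_var 5 (by simp [hσ₄])) hp₃) hchunk
    hfield hd
  rw [card_childField_le (chunks_subset _ _ _ _) hd, ← hCh] at hcount
  have hcnt : #(Ch.filter (· ≤ x / 2 ^ q % 2 ^ c)) ≤ #Ch := card_filter_le _ _
  have hCh2 : #Ch ≤ 2 ^ c := by simpa using card_le_card (chunks_subset (jumps G u) c q _)
  have hval : (Expr.ite 0 (param 2) childExpr 0).eval w M σ₄ = G x := by
    refine Expr.eval_ite (hlit (i := 0) (by norm_num)) (hprm (by norm_num) h.flag) (fun _ => ?_)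
      (fun h => absurd one_pos h)
    refine Expr.eval_read (Expr.eval_add (Expr.eval_add (Expr.eval_var (x := ptr) 5 (by simp [hσ₄]))
      (hlit (i := 1) (by norm_num)) (by omega)) hcount (by omega)) ?_
    rw [hp₄ _ hcnt]
    refine nodeValue_eq hG hx ?_
    rcases hPj' with e | hn
    · left
      rw [hq, show J - j - 1 = 0 by omega, Nat.mul_zero]
    · right
      intro s' hs' e
      refine hn ⟨s', hs', ?_⟩
      rw [show J - (j + 1) = J - j - 1 by omega]
      exact e
  refine ⟨Function.update σ₄ 6 (G x), _, Runs.seq r₁ (Runs.seq r₂ (Runs.seq r₃ (Runs.seq r₄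
    (Runs.assign_of_eq hval)))), ?_, ?_, ?_⟩
  · change 1 + 1 + (1 + 1 + 1 + (t₃ + ((findExpr (.var 2)).cost + 1 +
      (1 + (1 + 1) + childExpr.cost + 1 + 2 + 1)))) ≤ _
    have : (findExpr (.var 2)).cost = (findExpr (.var 4)).cost := rfl
    rw [this]
    unfold trieCost
    nlinarith
  · simp [hσ₄, hσ₃, hσ₂, start]
  · simp

/-- With one level the loop stops at once. The single lookup reads arbitrary words, but the zero
flag discards its result. -/
theorem runs_trieSearch_none {w : ℕ} {M : ℕ → ℕ} (hw : 64 ≤ w) (h₁ : M 1 = 1) (h₂ : M 2 = 0)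
    (x : ℕ) :
    ∃ σ' t, Runs w M trieSearch (start x) σ' t ∧ t ≤ 2 * trieCost ∧ σ' 0 = x ∧ σ' 6 = 0 := by
  have hww : w < 2 ^ w := Nat.lt_two_pow_self
  have hlit : ∀ {i : ℕ} {σ : ℕ → ℕ}, i < 64 → (OfNat.ofNat i : Expr).eval w M σ = i :=
    fun hi => Expr.eval_lit _ (by omega)
  have r₁ : Runs w M (.assign 2 0) (start x) (Function.update (start x) 2 0) (1 + 1) :=
    Runs.assign_of_eq (hlit (i := 0) (by norm_num))
  have r₂ : Runs w M (.assign 3 (param 1)) (Function.update (start x) 2 0)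
      (Function.update (Function.update (start x) 2 0) 3 1) (1 + 1 + 1) :=
    Runs.assign_of_eq (eval_param (by omega) h₁)
  set σ₂ := Function.update (Function.update (start x) 2 0) 3 1 with hσ₂
  obtain ⟨j, b', m', t₃, r₃, -, -, -, -, ht₃⟩ := runs_bsearch (w := w) (M := M) (σ := σ₂)
    (lo := 2) (hi := 3) (mid := 4) (p := findExpr (.var 4)) (by omega) (by norm_num) (by norm_num)
    (by norm_num) (fun _ => True) (a := 0) (b := 1) (by simp [hσ₂]) (by simp [hσ₂]) one_pos
    (by omega) (by intro m a' b' h h'; omega)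
  set σ₃ := Function.update (Function.update (Function.update σ₂ 2 j) 3 b') 4 m' with hσ₃
  have r₄ := Runs.assign (w := w) (M := M) 5 (findExpr (.var 2)) σ₃
  have hval : ∀ σ, (Expr.ite 0 (param 2) childExpr 0).eval w M σ = 0 := fun σ =>
    Expr.eval_ite (hlit (i := 0) (by norm_num)) (eval_param (by omega) h₂)
      (fun h => absurd h (lt_irrefl 0)) fun _ => hlit (i := 0) (by norm_num)
  refine ⟨_, _, Runs.seq r₁ (Runs.seq r₂ (Runs.seq r₃ (Runs.seq r₄
    (Runs.assign_of_eq (hval _))))), ?_, ?_, ?_⟩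
  · change 1 + 1 + (1 + 1 + 1 + (t₃ + ((findExpr (.var 2)).cost + 1 +
      (1 + (1 + 1) + childExpr.cost + 1 + 2 + 1)))) ≤ _
    have : (findExpr (.var 2)).cost = (findExpr (.var 4)).cost := rfl
    rw [this]
    unfold trieCost
    rw [Nat.clog_of_right_le_one le_rfl] at ht₃
    omega
  · simp [hσ₃, hσ₂, start]
  · simp

end WordRAM

namespace WordRAM
open Finset

/-! ### Searching a group of keys -/

def lowExpr : Expr := .var 0 &&& param 16

def wordExpr (t : Expr) : Expr := .read (.var 7 + 4 + t)

def wordTest : Expr := .ite lowExpr (wordExpr (.var 4) &&& param 22) 0 1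

/-- With a single field per word, that field may use all bits and leave no spare bit for the
parallel comparison, so the word is compared directly. -/
def wordRank : Expr :=
  .ite (param 17) 2 (.ite lowExpr (wordExpr (.var 2)) 0 1)
    (Expr.count (param 18) (param 19) (param 20) (param 21) (param 22) (wordExpr (.var 2)) lowExpr)

def fieldExpr : Expr :=
  (wordExpr ((.var 9 - 1) / param 17) >>>
    (param 23 * ((.var 9 - 1) - (.var 9 - 1) / param 17 * param 17))) &&& param 22

/-- Variable `8` is a count that may include padding, variable `9` its minimum with the number of
keys of the group. If no key of the group is at most `x`, the answer is the stored predecessor of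
the group. -/
def groupFinish : Cmd :=
  .seq (.assign 8 (.var 2 * param 17 + wordRank))
    (.seq (.assign 9 (.ite (.read (.var 7 + 2)) (.var 8) (.read (.var 7 + 2)) (.var 8)))
      (.seq (.assign 1 (.read (.var 7) + .var 9))
        (.assign 0 (.ite 0 (.var 9) ((.var 0 - lowExpr) + fieldExpr) (.read (.var 7 + 1))))))

def groupSearch : Cmd :=
  .seq (.assign 7 (.read (param 15 + .var 6))) (.seq (.assign 2 0)
    (.seq (.assign 3 (.read (.var 7 + 3))) (.seq (.bsearch 2 3 4 wordTest) groupFinish)))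

/-- Number of steps of the constant-time parts of `groupSearch`. -/
def groupCost : ℕ := wordTest.cost + wordRank.cost + fieldExpr.cost + lowExpr.cost + 100

/-- The memory contains the parameters of the groups: directory at `dir`, keys modulo `2 ^ b` in
words with `g` fields of width `f`. -/
structure HasGroupParams (w b f g dir : ℕ) (M : ℕ → ℕ) : Prop where
  dir : M 15 = dir
  low : M 16 = 2 ^ b - 1
  fields : M 17 = g
  ones : 2 ≤ g → M 18 = pack f g fun _ => 1
  tops : 2 ≤ g → M 19 = pack f g fun _ => 2 ^ (f - 1)
  test : 2 ≤ g → M 20 = f - 1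
  last : 2 ≤ g → M 21 = f * (g - 1)
  mask : M 22 = 2 ^ f - 1
  width : M 23 = f

/-- By monotonicity all fields before word `t` are at most `v` and all fields from word `t + 1` on
exceed `v`, so `t * g` plus the count within word `t` is the exact count in the padded sequence.
Padding equal to `v` may be counted, but it stands behind the `m` true entries, so the minimum with
`m` removes it. -/
theorem padded_rank {arr : ℕ → ℕ} (harr : Monotone arr) {v m cnt nw g t : ℕ} (hcnt : cnt ≤ m)
    (hm : m ≤ nw * g) (h : ∀ s < m, arr s ≤ v ↔ s < cnt)
    (h₁ : t = 0 ∨ arr (t * g) ≤ v) (h₂ : t + 1 = nw ∨ ¬ arr ((t + 1) * g) ≤ v) :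
    min m (t * g + #{i ∈ range g | arr (t * g + i) ≤ v}) = cnt := by
  set A := {i ∈ range g | arr (t * g + i) ≤ v} with hA
  have hAr : A = range #A := eq_range_card fun a ha b hb => by
    rw [hA, mem_filter, mem_range] at ha ⊢
    exact ⟨by omega, (harr (by omega)).trans ha.2⟩
  have hAg : #A ≤ g := by simpa using card_filter_le (range g) fun i => arr (t * g + i) ≤ v
  have hiff : ∀ i < g, (arr (t * g + i) ≤ v ↔ i < #A) := by
    intro i hi
    have : i ∈ A ↔ i < #A := by
      conv_lhs => rw [hAr]
      exact mem_range
    rw [← this, hA, mem_filter, mem_range]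
    simp [hi]
  have key : ∀ s < nw * g, (arr s ≤ v ↔ s < t * g + #A) := by
    intro s hs
    rcases Nat.lt_or_ge s (t * g) with h' | h'
    · have : arr s ≤ v := by
        rcases h₁ with h₁ | h₁
        · simp [h₁] at h'
        · exact (harr h'.le).trans h₁
      simp only [this, true_iff]; omega
    · rcases Nat.lt_or_ge s (t * g + g) with h'' | h''
      · have := hiff (s - t * g) (by omega)
        rw [show t * g + (s - t * g) = s by omega] at this
        rw [this]; omega
      · have hn : ¬ arr s ≤ v := by
          rcases h₂ with h₂ | h₂
          · rw [← h₂, Nat.succ_mul] at hs; omega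
          · intro hc
            exact h₂ ((harr (by rw [Nat.succ_mul]; omega)).trans hc)
        simp only [hn, false_iff]; omega
  rcases Nat.lt_or_ge (t * g + #A) m with h' | h'
  · rw [min_eq_right h'.le]
    have e₁ := h _ h'
    rw [key _ (by omega)] at e₁
    by_contra hne
    have hlt : cnt < t * g + #A := by omega
    have e₂ := h cnt (by omega)
    rw [key _ (by omega)] at e₂
    omega
  · rw [min_eq_left h']
    rcases Nat.eq_zero_or_pos m with h0 | h0
    · omega
    · have e₁ := h (m - 1) (by omega)
      rw [key _ (by omega)] at e₁
      omega

theorem add_le_mul_succ {p q K l t s : ℕ} (ht : t ≤ p * (l + 1)) (hs : s ≤ t + q)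
    (hpq : p + q ≤ K) : s ≤ K * (l + 1) := by
  have := Nat.mul_le_mul_right (l + 1) hpq
  have := Nat.le_mul_of_pos_right q l.succ_pos
  rw [Nat.succ_eq_add_one] at this
  linarith [Nat.add_mul p q (l + 1)]

set_option maxHeartbeats 800000 in
theorem runs_groupSearch {w b f g dir : ℕ} {M : ℕ → ℕ} (h : HasGroupParams w b f g dir M)
    (hw : 64 ≤ w) (hg : 0 < g) (hfg : f * g ≤ w) (hgf : 2 ≤ g → 0 < f ∧ g < 2 ^ f)
    {x i P R prev m nw cnt : ℕ} {arr : ℕ → ℕ} {σ : ℕ → ℕ} (h0 : σ 0 = x) (h6 : σ 6 = i)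
    (hx : x < 2 ^ w) (hdir : dir + i < 2 ^ w) (hP : M (dir + i) = P)
    (hP₀ : M P = R) (hP₁ : M (P + 1) = prev) (hP₂ : M (P + 2) = m) (hP₃ : M (P + 3) = nw)
    (hword : ∀ t < nw, M (P + 4 + t) = pack f g fun i => arr (t * g + i))
    (hPw : P + 4 + nw < 2 ^ w) (hnw : 0 < nw) (hnw' : 2 * (nw * g + g) < 2 ^ w)
    (hR : R + m < 2 ^ w) (harr : Monotone arr) (harr' : ∀ t, arr t < 2 ^ f)
    (hg₂ : 2 ≤ g → x % 2 ^ b < 2 ^ (f - 1) ∧ ∀ t, arr t ≤ 2 ^ (f - 1))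
    (hcnt : cnt ≤ m) (hm : m ≤ nw * g) (hrank : ∀ s < m, arr s ≤ x % 2 ^ b ↔ s < cnt) :
    ∃ σ' t, Runs w M groupSearch σ σ' t ∧ t ≤ 2 * groupCost * (Nat.clog 2 nw + 1) ∧
      σ' 0 = (if cnt = 0 then prev else x - x % 2 ^ b + arr (cnt - 1)) ∧ σ' 1 = R + cnt := by
  have hww : w < 2 ^ w := Nat.lt_two_pow_self
  have hprm : ∀ {i a : ℕ} {σ : ℕ → ℕ}, i < 64 → M i = a → (param i).eval w M σ = a :=
    fun hi e => eval_param (by omega) e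
  have hlit : ∀ {i : ℕ} {σ : ℕ → ℕ}, i < 64 → (OfNat.ofNat i : Expr).eval w M σ = i :=
    fun hi => Expr.eval_lit _ (by omega)
  have hnwg : nw ≤ nw * g := Nat.le_mul_of_pos_right _ hg
  have hlow : ∀ {σ : ℕ → ℕ}, σ 0 = x → lowExpr.eval w M σ = x % 2 ^ b := fun h0 =>
    Expr.eval_mask (Expr.eval_var 0 h0) (hprm (by norm_num) h.low)
  have hread : ∀ {σ : ℕ → ℕ} {tE : Expr} {t : ℕ}, σ 7 = P → tE.eval w M σ = t → t < nw →
      (wordExpr tE).eval w M σ = pack f g fun i => arr (t * g + i) := fun h7 ht htn =>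
    Expr.eval_read (Expr.eval_add (Expr.eval_add (Expr.eval_var 7 h7)
      (hlit (i := 4) (by norm_num)) (by omega)) ht (by omega)) (hword _ htn)
  have r₁ : Runs w M (.assign 7 (.read (param 15 + .var 6))) σ (Function.update σ 7 P)
      (1 + 1 + 1 + 1 + 1 + 1) :=
    Runs.assign_of_eq (Expr.eval_read (Expr.eval_add (hprm (by norm_num) h.dir)
      (Expr.eval_var 6 h6) hdir) hP)
  have r₂ : Runs w M (.assign 2 0) (Function.update σ 7 P)
      (Function.update (Function.update σ 7 P) 2 0) (1 + 1) :=
    Runs.assign_of_eq (hlit (i := 0) (by norm_num))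
  set σ₂ := Function.update (Function.update σ 7 P) 2 0 with hσ₂
  have r₃ : Runs w M (.assign 3 (.read (.var 7 + 3))) σ₂ (Function.update σ₂ 3 nw)
      (1 + 1 + 1 + 1 + 1) :=
    Runs.assign_of_eq (Expr.eval_read (Expr.eval_add (Expr.eval_var (x := P) 7 (by simp [hσ₂]))
      (hlit (i := 3) (by norm_num)) (by omega)) hP₃)
  set σ₃ := Function.update σ₂ 3 nw with hσ₃
  obtain ⟨t, b', m', t₄, r₄, -, htn, ht₁, ht₂, hcost⟩ := runs_bsearch (w := w) (M := M) (σ := σ₃)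
    (lo := 2) (hi := 3) (mid := 4) (p := wordTest) (by omega) (by norm_num) (by norm_num)
    (by norm_num) (fun t => arr (t * g) ≤ x % 2 ^ b) (a := 0) (b := nw) (by simp [hσ₃, hσ₂])
    (by simp [hσ₃]) hnw (by omega) (by
      intro t a' b' _ htn
      have e₁ := Expr.eval_mask (hread (σ := Function.update (Function.update
        (Function.update σ₃ 2 a') 3 b') 4 t) (tE := .var 4) (by simp [hσ₃, hσ₂])
        (Expr.eval_var 4 (by simp)) htn) (hprm (by norm_num) h.mask)
      have e₂ := pack_field (f := f) (s := g) (i := 0) (a := fun i => arr (t * g + i))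
        (fun _ _ => harr' _) hg
      rw [Nat.mul_zero, pow_zero, Nat.div_one] at e₂
      rw [e₂, Nat.add_zero] at e₁
      by_cases hle : arr (t * g) ≤ x % 2 ^ b
      · rw [wordTest, Expr.eval_ite (z := 1) (hlow (by simp [hσ₃, hσ₂, h0])) e₁
          (fun h => absurd h (by omega)) (fun _ => hlit (i := 1) (by norm_num))]
        simp [hle]
      · rw [wordTest, Expr.eval_ite (z := 0) (hlow (by simp [hσ₃, hσ₂, h0])) e₁
          (fun _ => hlit (i := 0) (by norm_num)) (fun h => absurd h (by omega))]
        simp [hle])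
  set σ₄ := Function.update (Function.update (Function.update σ₃ 2 t) 3 b') 4 m' with hσ₄
  have h40 : σ₄ 0 = x := by simp [hσ₄, hσ₃, hσ₂, h0]
  have h47 : σ₄ 7 = P := by simp [hσ₄, hσ₃, hσ₂]
  have h42 : σ₄ 2 = t := by simp [hσ₄]
  have hwt := hread h47 (Expr.eval_var 2 h42) htn
  have hr : wordRank.eval w M σ₄ = #{i ∈ range g | arr (t * g + i) ≤ x % 2 ^ b} := by
    refine Expr.eval_ite (hprm (by norm_num) h.fields) (hlit (i := 2) (by norm_num))
      (fun hg1 => ?_) (fun hg2 => ?_)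
    · have hg1 : g = 1 := by omega
      subst hg1
      rw [pack_one] at hwt
      simp only [Nat.add_zero] at hwt
      refine Expr.eval_ite (hlow h40) hwt (fun hlt => ?_) (fun hlt => ?_)
      · rw [hlit (i := 0) (by norm_num)]
        have : ¬ arr t ≤ x % 2 ^ b := by simpa using hlt
        simp [filter_singleton, this]
      · rw [hlit (i := 1) (by norm_num)]
        have : arr t ≤ x % 2 ^ b := by simpa using hlt
        simp [filter_singleton, this]
    · have hg2 : 2 ≤ g := by omega
      obtain ⟨hf, hgf'⟩ := hgf hg2
      obtain ⟨hxl, harr₂⟩ := hg₂ hg2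
      obtain ⟨e, rfl⟩ : ∃ e, f = e + 1 := ⟨f - 1, by omega⟩
      exact Expr.eval_count hg hfg hgf' (hprm (by norm_num) (h.ones hg2))
        (hprm (by norm_num) (h.tops hg2)) (hprm (by norm_num) (h.test hg2))
        (hprm (by norm_num) (h.last hg2)) (hprm (by norm_num) h.mask) hwt (hlow h40)
        (fun i _ => harr₂ _) hxl
  set B := #{i ∈ range g | arr (t * g + i) ≤ x % 2 ^ b} with hB
  have hBg : B ≤ g := by
    simpa using card_filter_le (range g) fun i => arr (t * g + i) ≤ x % 2 ^ b
  have htg : t * g ≤ nw * g := Nat.mul_le_mul_right _ htn.le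
  have r₅ : Runs w M (.assign 8 (.var 2 * param 17 + wordRank)) σ₄
      (Function.update σ₄ 8 (t * g + B)) (1 + (1 + 1) + 1 + wordRank.cost + 1 + 1) :=
    Runs.assign_of_eq (Expr.eval_add (Expr.eval_mul (Expr.eval_var 2 h42)
      (hprm (by norm_num) h.fields) (by omega)) hr (by omega))
  set σ₅ := Function.update σ₄ 8 (t * g + B) with hσ₅
  have hmE : (Expr.read (.var 7 + 2)).eval w M σ₅ = m :=
    Expr.eval_read (Expr.eval_add (Expr.eval_var (x := P) 7 (by simp [hσ₅, h47]))
      (hlit (i := 2) (by norm_num)) (by omega)) hP₂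
  have hmin := padded_rank harr hcnt hm hrank ht₁ ht₂
  have r₆ : Runs w M (.assign 9 (.ite (.read (.var 7 + 2)) (.var 8) (.read (.var 7 + 2)) (.var 8)))
      σ₅ (Function.update σ₅ 9 cnt) (1 + 1 + 1 + 1 + 1 + (1 + 1 + 1 + 1) + 1 + 2 + 1) := by
    refine Runs.assign_of_eq (Expr.eval_ite hmE (Expr.eval_var (x := t * g + B) 8 (by simp [hσ₅]))
      (fun hlt => ?_) (fun hlt => ?_))
    · rw [hmE, ← hmin, min_eq_left hlt.le]
    · rw [Expr.eval_var (x := t * g + B) 8 (by simp [hσ₅]), ← hmin, min_eq_right (by omega)]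
  set σ₆ := Function.update σ₅ 9 cnt with hσ₆
  have h67 : σ₆ 7 = P := by simp [hσ₆, hσ₅, h47]
  have r₇ : Runs w M (.assign 1 (.read (.var 7) + .var 9)) σ₆ (Function.update σ₆ 1 (R + cnt))
      (1 + 1 + 1 + 1 + 1) :=
    Runs.assign_of_eq (Expr.eval_add (Expr.eval_read (Expr.eval_var 7 h67) hP₀)
      (Expr.eval_var 9 (by simp [hσ₆])) (by omega))
  set σ₇ := Function.update σ₆ 1 (R + cnt) with hσ₇
  have h70 : σ₇ 0 = x := by simp [hσ₇, hσ₆, hσ₅, h40]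
  have h77 : σ₇ 7 = P := by simp [hσ₇, h67]
  have h79 : (Expr.var 9).eval w M σ₇ = cnt := Expr.eval_var 9 (by simp [hσ₇, hσ₆])
  have hfinal : (Expr.ite 0 (.var 9) ((.var 0 - lowExpr) + fieldExpr)
      (.read (.var 7 + 1))).eval w M σ₇ =
      if cnt = 0 then prev else x - x % 2 ^ b + arr (cnt - 1) := by
    refine Expr.eval_ite (hlit (i := 0) (by norm_num)) h79 (fun hpos => ?_) (fun hpos => ?_)
    · rw [if_neg (by omega)]
      have e₁ := Expr.eval_sub h79 (hlit (i := 1) (by norm_num)) (by omega) (by omega)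
      have e₂ := Expr.eval_div e₁ (hprm (by norm_num) h.fields)
      have hdm : (cnt - 1) / g * g ≤ cnt - 1 := Nat.div_mul_le_self _ _
      have e₃ := Expr.eval_sub e₁ (Expr.eval_mul e₂ (hprm (by norm_num) h.fields) (by omega)) hdm
        (by omega)
      have hmod : cnt - 1 - (cnt - 1) / g * g = (cnt - 1) % g := by
        have := Nat.div_add_mod' (cnt - 1) g; omega
      rw [hmod] at e₃
      have hlt : (cnt - 1) % g < g := Nat.mod_lt _ hg
      have hfm : f * ((cnt - 1) % g) ≤ w := (Nat.mul_le_mul_left f hlt.le).trans hfg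
      have hdn : (cnt - 1) / g < nw := Nat.div_lt_of_lt_mul (by rw [Nat.mul_comm]; omega)
      have e₄ : fieldExpr.eval w M σ₇ = arr (cnt - 1) := by
        rw [fieldExpr, Expr.eval_mask (Expr.eval_shr (hread h77 e₂ hdn)
          (Expr.eval_mul (hprm (by norm_num) h.width) e₃ (by omega)))
          (hprm (by norm_num) h.mask), pack_field (fun _ _ => harr' _) hlt, Nat.div_add_mod']
      have hle : arr (cnt - 1) ≤ x % 2 ^ b := (hrank _ (by omega)).2 (by omega)
      have hxm : x % 2 ^ b ≤ x := Nat.mod_le _ _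
      exact Expr.eval_add (Expr.eval_sub (Expr.eval_var 0 h70) (hlow h70) hxm hx) e₄ (by omega)
    · rw [if_pos (by omega)]
      exact Expr.eval_read (Expr.eval_add (Expr.eval_var 7 h77) (hlit (i := 1) (by norm_num))
        (by omega)) hP₁
  have r₈ := Runs.assign_of_eq (d := 0) hfinal
  have hK : (Expr.ite 0 (.var 9) ((.var 0 - lowExpr) + fieldExpr) (.read (.var 7 + 1))).cost + 1 ≤
      lowExpr.cost + fieldExpr.cost + 30 := by
    change 1 + 1 + 2 + (1 + lowExpr.cost + 1 + fieldExpr.cost + 1) + (1 + 1 + 1 + 1) + 1 ≤ _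
    omega
  generalize (Expr.ite 0 (.var 9) ((.var 0 - lowExpr) + fieldExpr) (.read (.var 7 + 1))).cost + 1 =
    K at r₈ hK
  refine ⟨_, _, Runs.seq r₁ (Runs.seq r₂ (Runs.seq r₃ (Runs.seq r₄ (Runs.seq r₅ (Runs.seq r₆
    (Runs.seq r₇ r₈)))))), ?_, ?_, ?_⟩
  · refine add_le_mul_succ hcost (q := wordRank.cost + K + 60) ?_ ?_
    · omega
    · unfold groupCost
      omega
  · simp
  · simp [hσ₇]

end WordRAM

namespace WordRAM
open Finset

/-! ### Construction of the trie -/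

/-- Record of a trie node. -/
def nodeRecord (G : ℕ → ℕ) (A : Finset ℕ) (c q p : ℕ) : List ℕ :=
  pack (c + 1) (2 ^ c) (childField (chunks A c q p) c) ::
    (List.range (#(chunks A c q p) + 1)).map (nodeValue G A c q p)

theorem childField_lt {Ch : Finset ℕ} {c : ℕ} (hCh : Ch ⊆ range (2 ^ c)) (t : ℕ) :
    childField Ch c t < 2 ^ (c + 1) := by
  have : (0 : ℕ) < 2 ^ c := by positivity
  rw [childField, pow_succ]
  split_ifs with h
  · have := mem_range.1 (hCh (enum_mem h))
    omega
  · omega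

theorem getD_append_right' {l₁ l₂ : List ℕ} (i : ℕ) :
    (l₁ ++ l₂).getD (l₁.length + i) 0 = l₂.getD i 0 := by
  rw [List.getD_append_right _ _ _ _ (by omega), Nat.add_sub_cancel_left]

/-- At each level there are at most `#(jumps G u)` nodes and as many children, and a node needs two
words besides those of its children. This gives the factor `3`; the dictionary contributes `40`. The
slack `w + 1` in `hlen` keeps the addresses behind a node within a word. -/
theorem exists_trie {w u : ℕ} (hw : 64 ≤ w) {G : ℕ → ℕ} {c J base : ℕ} (hu : u < 2 ^ w)
    (hGw : ∀ z, G z < 2 ^ w) (hc : 0 < c) (hJw : c * (J - 1) ≤ w)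
    (hcw : (c + 1) * 2 ^ c ≤ w) (hbase : 0 < base)
    (hlen : base + 43 * (J * #(jumps G u) + 1) + w + 1 < 2 ^ w) :
    ∃ (T : List ℕ) (a s tb : ℕ), T.length ≤ 43 * (J * #(jumps G u) + 1) ∧ (∀ t ∈ T, t < 2 ^ w) ∧
      a < 2 ^ w ∧ s < 2 ^ w ∧ tb < 2 ^ w ∧ ∀ M : ℕ → ℕ,
        (∀ i < T.length, M (base + i) = T.getD i 0) → M 1 = J → M 2 = 1 → M 3 = c →
        M 5 = 2 ^ (w - 1) → M 6 = a → M 7 = s → M 8 = tb →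
        M 9 = (pack (c + 1) (2 ^ c) fun _ => 1) → M 10 = (pack (c + 1) (2 ^ c) fun _ => 2 ^ c) →
        M 12 = (c + 1) * (2 ^ c - 1) → M 13 = 2 ^ (c + 1) - 1 → M 14 = 2 ^ c - 1 →
        HasTrie w u G c J M := by
  classical
  set A := jumps G u with hA
  have hAu : ∀ s ∈ A, s < 2 ^ w := fun s hs => by
    simp only [hA, jumps, mem_filter, mem_range] at hs
    omega
  set N : Finset (Σ _ : ℕ, ℕ) :=
    (range J).sigma fun j => A.image fun s => s / 2 ^ (c + c * (J - j - 1)) with hN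
  obtain ⟨T₁, off, hT₁, hmem, hoff⟩ := exists_concat N fun n =>
    nodeRecord G A c (c * (J - n.1 - 1)) n.2
  have hcard : T₁.length ≤ 3 * (J * #A) := by
    rw [hT₁, hN, sum_sigma]
    have : ∀ j ∈ range J, ∑ p ∈ A.image (fun s => s / 2 ^ (c + c * (J - j - 1))),
        (nodeRecord G A c (c * (J - j - 1)) p).length ≤ 3 * #A := by
      intro j _
      simp only [nodeRecord, List.length_cons, List.length_map, List.length_range]
      have h₁ := sum_card_chunks_le A c (c * (J - j - 1))
      have h₂ : #(A.image fun s => s / 2 ^ (c + c * (J - j - 1))) ≤ #A := card_image_le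
      simp only [sum_add_distrib, sum_const, smul_eq_mul, Nat.mul_one]
      omega
    refine (sum_le_card_nsmul _ _ _ this).trans ?_
    rw [card_range, smul_eq_mul]
    linarith
  have hK : #(nodeKeys w c J A) ≤ J * #A := by
    refine card_image_le.trans ?_
    rw [card_product, card_range]
  have hexp : ∀ j < J, c * (J - j) = c + c * (J - j - 1) := by
    intro j hj
    obtain ⟨e, he⟩ : ∃ e, J - j = e + 1 := ⟨J - j - 1, by omega⟩
    rw [he, Nat.add_sub_cancel, Nat.mul_succ, Nat.add_comm]
  have hNmem : ∀ j < J, ∀ s ∈ A, (⟨j, s / 2 ^ (c * (J - j))⟩ : Σ _ : ℕ, ℕ) ∈ N := by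
    intro j hj s hs
    rw [hN, mem_sigma, hexp j hj]
    exact ⟨mem_range.2 hj, mem_image_of_mem _ hs⟩
  -- The address depends only on the key, because by `trieKey_inj` the key determines level and
  -- prefix.
  obtain ⟨v, hv⟩ : ∃ v : ℕ → ℕ, ∀ j < J, ∀ s ∈ A,
      v (trieKey w (c * (J - j)) s) = base + off ⟨j, s / 2 ^ (c * (J - j))⟩ := by
    refine ⟨fun κ => if h : ∃ js : ℕ × ℕ, (js.1 < J ∧ js.2 ∈ A) ∧
      trieKey w (c * (J - js.1)) js.2 = κ then
      base + off ⟨h.choose.1, h.choose.2 / 2 ^ (c * (J - h.choose.1))⟩ else 0, ?_⟩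
    intro j hj s hs
    have h : ∃ js : ℕ × ℕ, (js.1 < J ∧ js.2 ∈ A) ∧
      trieKey w (c * (J - js.1)) js.2 = trieKey w (c * (J - j)) s := ⟨(j, s), ⟨hj, hs⟩, rfl⟩
    refine (dif_pos h).trans ?_
    obtain ⟨⟨h₁, h₂⟩, h₃⟩ := h.choose_spec
    obtain ⟨e₁, e₂⟩ := trieKey_inj hc hJw h₁ hj (hAu _ h₂) (hAu _ hs) h₃
    rw [e₂, e₁]
  have hvw : ∀ κ ∈ nodeKeys w c J A, v κ < 2 ^ w := by
    intro κ hκ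
    obtain ⟨⟨j, s⟩, hjs, rfl⟩ := mem_image.1 hκ
    obtain ⟨hj, hs⟩ := mem_product.1 hjs
    rw [hv j (mem_range.1 hj) s hs]
    have := (hoff _ (hNmem j (mem_range.1 hj) s hs)).1
    omega
  have hKw : ∀ κ ∈ nodeKeys w c J A, κ < 2 ^ w := by
    intro κ hκ
    obtain ⟨⟨j, s⟩, hjs, rfl⟩ := mem_image.1 hκ
    obtain ⟨hj, hs⟩ := mem_product.1 hjs
    refine trieKey_lt ?_ (hAu _ hs)
    rw [hexp j (mem_range.1 hj)]
    omega
  obtain ⟨T₂, a, s, hT₂, hT₂w, ha, hs, hlook⟩ := exists_dictionary (by omega : 2 ≤ w)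
    (nodeKeys w c J A) hKw v hvw (base + T₁.length) (by omega)
  have hww : w < 2 ^ w := Nat.lt_two_pow_self
  have h2c : 2 ^ c ≤ w := le_trans (Nat.le_mul_of_pos_left _ c.succ_pos) hcw
  refine ⟨T₁ ++ T₂, a, s, base + T₁.length, ?_, ?_, ha, by omega, by omega, ?_⟩
  · rw [List.length_append]
    omega
  · intro t ht
    rcases List.mem_append.1 ht with ht | ht
    · obtain ⟨n, -, hn⟩ := hmem t ht
      rcases List.mem_cons.1 hn with rfl | hn
      · exact (pack_lt fun i _ => childField_lt (chunks_subset _ _ _ _) i).trans_le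
          (Nat.pow_le_pow_right (by norm_num) hcw)
      · obtain ⟨i, -, rfl⟩ := List.mem_map.1 hn
        rw [nodeValue]
        split_ifs <;> exact hGw _
    · exact hT₂w t ht
  · intro M hM h1 h2 h3 h5 h6 h7 h8 h9 h10 h12 h13 h14
    refine ⟨h1, h2, h3, h5, h9, h10, h12, h13, h14, v, ?_, ?_⟩
    · intro σ kE κ hκ
      refine hlook M (fun i hi => ?_) σ _ _ _ _ κ (eval_param (by omega) h6)
        (eval_param (by omega) h7) (eval_param (by omega) h8) hκ
      rw [Nat.add_assoc, hM _ (by rw [List.length_append]; omega), getD_append_right']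
    · rintro j hj s hs ptr rfl q rfl p rfl
      rw [hv j hj s hs, ← hexp j hj, ← hA]
      obtain ⟨ho, hrec⟩ := hoff _ (hNmem j hj s hs)
      have hlenr : (nodeRecord G A c (c * (J - j - 1)) (s / 2 ^ (c * (J - j)))).length =
          #(chunks A c (c * (J - j - 1)) (s / 2 ^ (c * (J - j)))) + 2 := by
        simp [nodeRecord]
      dsimp only at ho hrec
      rw [hlenr] at ho hrec
      have hget : ∀ i < #(chunks A c (c * (J - j - 1)) (s / 2 ^ (c * (J - j)))) + 2,
          M (base + off ⟨j, s / 2 ^ (c * (J - j))⟩ + i) =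
            (nodeRecord G A c (c * (J - j - 1)) (s / 2 ^ (c * (J - j)))).getD i 0 := by
        intro i hi
        rw [Nat.add_assoc, hM _ (by rw [List.length_append]; omega),
          List.getD_append _ _ _ _ (by omega), hrec i hi]
      refine ⟨by omega, by omega, ?_, fun i hi => ?_⟩
      · have := hget 0 (by omega)
        simpa [nodeRecord] using this
      · rw [Nat.add_assoc _ 1 i, Nat.add_comm 1 i, hget (i + 1) (by omega), nodeRecord,
          List.getD_cons_succ, getD_map_range _ (by omega)]

end WordRAM

namespace WordRAM
open Finset

/-! ### Construction of the groups -/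

/-- A monotone `G` splits `S` into consecutive groups: keys with a smaller index than `x` precede
it, those with a larger index follow it, and only the group of `x` itself has to be searched. -/
theorem rank_eq_group {S : Finset ℕ} {G : ℕ → ℕ} (hG : Monotone G) (x : ℕ) :
    rank S x = #(S.filter (G · < G x)) + #((S.filter (G · = G x)).filter (· ≤ x)) := by
  rw [rank, filter_filter, ← card_union_of_disjoint]
  · congr 1
    ext a
    simp only [mem_filter, mem_union]
    constructor
    · rintro ⟨h₁, h₂⟩
      rcases (hG h₂).lt_or_eq with h | h
      exacts [.inl ⟨h₁, h⟩, .inr ⟨h₁, h, h₂⟩]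
    · rintro (⟨h₁, h₂⟩ | ⟨h₁, -, h₂⟩)
      exacts [⟨h₁, (hG.reflect_lt h₂).le⟩, ⟨h₁, h₂⟩]
  · rw [disjoint_filter]
    rintro a - h₁ ⟨h₂, -⟩
    omega

theorem pred_eq_group {S : Finset ℕ} {G : ℕ → ℕ} (hG : Monotone G) (x : ℕ) :
    pred S x = if #((S.filter (G · = G x)).filter (· ≤ x)) = 0 then (S.filter (G · < G x)).sup id
      else enum (S.filter (G · = G x)) (#((S.filter (G · = G x)).filter (· ≤ x)) - 1) := by
  rw [pred]
  split_ifs with h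
  · congr 1
    refine filter_congr fun a ha => ⟨fun h' => ?_, fun h' => (hG.reflect_lt h').le⟩
    refine (hG h').lt_of_ne fun e => ?_
    rw [card_eq_zero] at h
    exact notMem_empty a (h ▸ mem_filter.2 ⟨mem_filter.2 ⟨ha, e⟩, h'⟩)
  · rw [← sup_filter_le_eq_enum (Nat.pos_of_ne_zero h)]
    refine le_antisymm (Finset.sup_le fun a ha => ?_)
      (sup_mono (filter_subset_filter _ (filter_subset _ _)))
    obtain ⟨ha, hax⟩ := mem_filter.1 ha
    rcases (hG hax).lt_or_eq with h' | h'
    · obtain ⟨z, hz⟩ := card_pos.1 (Nat.pos_of_ne_zero h)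
      obtain ⟨hz₁, -⟩ := mem_filter.1 hz
      refine le_trans ?_ (le_sup (f := id) hz)
      rw [← (mem_filter.1 hz₁).2] at h'
      exact (hG.reflect_lt h').le
    · exact le_sup (f := id) (mem_filter.2 ⟨mem_filter.2 ⟨ha, h'⟩, hax⟩)

/-- Low bits of the keys `A` in increasing order, followed by `pad`. -/
def groupField (A : Finset ℕ) (b pad t : ℕ) : ℕ := if t < #A then enum A t % 2 ^ b else pad

/-- The words in front are the rank and the predecessor before the group, the number of keys and the
number of words. The extra word in `/ g + 1` makes the binary search start on a nonempty range even
for an empty group. -/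
def groupRecord (S : Finset ℕ) (G : ℕ → ℕ) (b f g pad i : ℕ) : List ℕ :=
  [#(S.filter (G · < i)), (S.filter (G · < i)).sup id, #(S.filter (G · = i)),
    #(S.filter (G · = i)) / g + 1] ++
  (List.range (#(S.filter (G · = i)) / g + 1)).map fun t =>
    pack f g fun j => groupField (S.filter (G · = i)) b pad (t * g + j)

theorem mod_le_mod_iff {a x d : ℕ} (h : a / d = x / d) : a % d ≤ x % d ↔ a ≤ x := by
  have h₁ := Nat.div_add_mod a d
  have h₂ := Nat.div_add_mod x d
  rw [h] at h₁
  omega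

theorem groupField_le {A : Finset ℕ} {b pad : ℕ} (hpad : ∀ v < 2 ^ b, v ≤ pad) (t : ℕ) :
    groupField A b pad t ≤ pad := by
  rw [groupField]
  split_ifs
  · exact hpad _ (Nat.mod_lt _ (by positivity))
  · rfl

theorem groupField_mono {A : Finset ℕ} {b pad : ℕ} (hpad : ∀ v < 2 ^ b, v ≤ pad)
    (hA : ∀ a ∈ A, ∀ a' ∈ A, a / 2 ^ b = a' / 2 ^ b) : Monotone (groupField A b pad) := by
  intro s t hst
  by_cases ht : t < #A
  · have hs := hst.trans_lt ht
    rw [groupField, groupField, if_pos ht, if_pos hs,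
      mod_le_mod_iff (hA _ (enum_mem hs) _ (enum_mem ht))]
    rcases hst.lt_or_eq with h | rfl
    exacts [(enum_lt_enum h ht).le, le_rfl]
  · rw [groupField.eq_def A b pad t, if_neg ht]
    exact groupField_le hpad s

/-- A directory of `N` addresses is followed by records of `5` words each plus the quotients by `g`;
the sum of the rounded-down quotients is at most `#S / g`. By `hb`, points with equal index agree
above bit `b`, so the low bits order the keys of a group and the query supplies the high bits of the
answer. -/
theorem exists_groups {w u : ℕ} (hw : 64 ≤ w) {S : Finset ℕ} {G : ℕ → ℕ} {b f g pad N base : ℕ}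
    (hu : u < 2 ^ w) (hS : S ⊆ Icc 1 u) (hG : Monotone G)
    (hb : ∀ y ≤ u, ∀ z ≤ u, G y = G z → y / 2 ^ b = z / 2 ^ b)
    (hg : 0 < g) (hfg : f * g ≤ w) (hgw : g ≤ w) (hgf : 2 ≤ g → 0 < f ∧ g < 2 ^ f)
    (hg₂ : 2 ≤ g → b = f - 1 ∧ pad = 2 ^ b) (hpad : ∀ v < 2 ^ b, v ≤ pad) (hpf : pad < 2 ^ f)
    (hlen : base + 6 * N + 2 * #S + 4 * w + 10 < 2 ^ w) :
    ∃ T : List ℕ, T.length ≤ 6 * N + #S / g ∧ (∀ t ∈ T, t < 2 ^ w) ∧ ∀ M : ℕ → ℕ,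
      (∀ i < T.length, M (base + i) = T.getD i 0) → HasGroupParams w b f g base M →
      ∀ x ≤ u, G x < N → ∀ σ : ℕ → ℕ, σ 0 = x → σ 6 = G x →
        ∃ σ' t, Runs w M groupSearch σ σ' t ∧
          t ≤ 2 * groupCost * (Nat.clog 2 (#(S.filter (G · = G x)) / g + 1) + 1) ∧
          σ' 0 = pred S x ∧ σ' 1 = rank S x := by
  have hSu : ∀ a ∈ S, a ≤ u := fun a ha => (mem_Icc.1 (hS ha)).2
  obtain ⟨T, off, hT, hmem, hoff⟩ := exists_concat (range N) (groupRecord S G b f g pad)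
  have hrec : ∀ i, (groupRecord S G b f g pad i).length = #(S.filter (G · = i)) / g + 5 := by
    intro i
    simp [groupRecord]
  have hsum : ∑ i ∈ range N, #(S.filter (G · = i)) ≤ #S := by
    rw [← card_biUnion]
    · exact card_le_card (biUnion_subset.2 fun i _ => filter_subset _ _)
    · intro i _ j _ hij
      rw [Function.onFun, disjoint_filter]
      rintro a - rfl
      exact hij
  have hTlen : T.length ≤ 5 * N + #S / g := by
    rw [hT]
    simp only [hrec, sum_add_distrib, sum_const, card_range, smul_eq_mul]
    have : ∑ i ∈ range N, #(S.filter (G · = i)) / g ≤ #S / g := by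
      rw [Nat.le_div_iff_mul_le hg, sum_mul]
      exact (sum_le_sum fun i _ => Nat.div_mul_le_self _ _).trans hsum
    omega
  have hSg : #S / g ≤ #S := Nat.div_le_self _ _
  have hcard : ∀ p : ℕ → Prop, [DecidablePred p] → #(S.filter p) ≤ #S := fun p _ =>
    card_filter_le _ _
  refine ⟨(List.range N).map (fun i => base + N + off i) ++ T, ?_, ?_, ?_⟩
  · simp only [List.length_append, List.length_map, List.length_range]
    omega
  · intro t ht
    rcases List.mem_append.1 ht with ht | ht
    · obtain ⟨i, hi, rfl⟩ := List.mem_map.1 ht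
      have := (hoff i (by simpa using hi)).1
      omega
    · obtain ⟨i, -, hi⟩ := hmem t ht
      rcases List.mem_append.1 hi with hi | hi
      · have h₁ := hcard (G · < i)
        have h₂ := hcard (G · = i)
        have h₃ : #(S.filter (G · = i)) / g ≤ #(S.filter (G · = i)) := Nat.div_le_self _ _
        have h₄ : (S.filter (G · < i)).sup id ≤ u :=
          Finset.sup_le fun a ha => hSu a (mem_filter.1 ha).1
        simp only [List.mem_cons, List.not_mem_nil, or_false] at hi
        omega
      · obtain ⟨j, -, rfl⟩ := List.mem_map.1 hi
        exact (pack_lt fun _ _ => (groupField_le hpad _).trans_lt hpf).trans_le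
          (Nat.pow_le_pow_right (by norm_num) hfg)
  · intro M hM hM' x hx hxN σ h0 h6
    have hM₁ : ∀ i < N, M (base + i) = base + N + off i := by
      intro i hi
      rw [hM i (by simp; omega), List.getD_append _ _ _ _ (by simpa using hi),
        getD_map_range _ hi]
    have hM₂ : ∀ i < T.length, M (base + N + i) = T.getD i 0 := by
      intro i hi
      rw [Nat.add_assoc, hM (N + i) (by simp; omega)]
      have := getD_append_right' (l₁ := (List.range N).map (fun i => base + N + off i)) (l₂ := T) i
      simpa using this
    set A := S.filter (G · = G x) with hA
    have hAS : #A ≤ #S := hcard _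
    obtain ⟨ho, hget⟩ := hoff (G x) (mem_range.2 hxN)
    rw [hrec, ← hA] at ho hget
    have hM₃ : ∀ t < #A / g + 5, M (base + N + off (G x) + t) =
        (groupRecord S G b f g pad (G x)).getD t 0 := by
      intro t ht
      rw [Nat.add_assoc, hM₂ _ (by omega), hget t ht]
    have hAx : ∀ a ∈ A, a / 2 ^ b = x / 2 ^ b := fun a ha =>
      hb a (hSu a (mem_filter.1 ha).1) x hx (mem_filter.1 ha).2
    have hdm : #A / g * g ≤ #A := Nat.div_mul_le_self _ _
    have hdm' : #A < (#A / g + 1) * g := by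
      have := Nat.lt_div_mul_add hg (a := #A)
      rw [Nat.succ_mul]; omega
    have hcnt : #(A.filter (· ≤ x)) ≤ #A := card_filter_le _ _
    have hAu : #A / g ≤ #A := Nat.div_le_self _ _
    have hAg : 0 ≤ #A / g := Nat.zero_le _
    obtain ⟨σ', t, r, ht, e₀, e₁⟩ := runs_groupSearch hM' hw hg hfg hgf (x := x) (i := G x)
      (P := base + N + off (G x)) (R := #(S.filter (G · < G x)))
      (prev := (S.filter (G · < G x)).sup id) (m := #A) (nw := #A / g + 1)
      (cnt := #(A.filter (· ≤ x))) (arr := groupField A b pad) h0 h6 (by omega) (by omega)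
      (hM₁ _ hxN) (by simpa [groupRecord] using hM₃ 0 (by omega))
      (by simpa [groupRecord] using hM₃ 1 (by omega))
      (by simpa [groupRecord] using hM₃ 2 (by omega))
      (by simpa [groupRecord] using hM₃ 3 (by omega))
      (by
        intro t ht
        rw [Nat.add_assoc _ 4 t, hM₃ _ (by omega), groupRecord, ← hA]
        exact (getD_append_right' t).trans (getD_map_range _ ht))
      (by omega) (by omega) (by rw [Nat.succ_mul (#A / g)]; omega)
      (by have := hcard (G · < G x); omega)
      (groupField_mono hpad fun a ha a' ha' => (hAx a ha).trans (hAx a' ha').symm)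
      (fun t => (groupField_le hpad t).trans_lt hpf)
      (fun h => by
        obtain ⟨e, rfl⟩ := hg₂ h
        rw [← e]
        exact ⟨Nat.mod_lt _ (by positivity), groupField_le hpad⟩)
      hcnt hdm'.le
      (by
        intro s hs
        rw [groupField, if_pos hs, mod_le_mod_iff (hAx _ (enum_mem hs)), enum_le_iff hs])
    refine ⟨σ', t, r, ht, ?_, ?_⟩
    · rw [e₀, pred_eq_group hG]
      split_ifs with h
      · rfl
      · have hlt : #(A.filter (· ≤ x)) - 1 < #A := by omega
        rw [groupField, if_pos hlt]
        have h₁ := Nat.div_add_mod (enum A (#(A.filter (· ≤ x)) - 1)) (2 ^ b)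
        have h₂ := Nat.div_add_mod x (2 ^ b)
        rw [hAx _ (enum_mem hlt)] at h₁
        rw [Nat.sub_eq_of_eq_add h₂.symm, h₁]
    · rw [e₁, rank_eq_group hG]

end WordRAM

namespace WordRAM
open Finset

/-! ### Sparse sets -/

theorem rank_mono (S : Finset ℕ) : Monotone (rank S) := fun _ _ h =>
  card_le_card fun _ ha => mem_filter.2 ⟨(mem_filter.1 ha).1, (mem_filter.1 ha).2.trans h⟩

theorem rank_le_card (S : Finset ℕ) (x : ℕ) : rank S x ≤ #S := card_filter_le _ _

theorem rank_lt_rank {S : Finset ℕ} {a b : ℕ} (hb : b ∈ S) (h : a < b) : rank S a < rank S b := by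
  refine card_lt_card ⟨fun z hz => ?_, fun hc => ?_⟩
  · exact mem_filter.2 ⟨(mem_filter.1 hz).1, (mem_filter.1 hz).2.trans h.le⟩
  · have := (mem_filter.1 (hc (mem_filter.2 ⟨hb, le_rfl⟩))).2
    omega

/-- Index of the group of `z`: blocks of length `2 ^ e` are split into runs of `k` keys. -/
def groupIndex (S : Finset ℕ) (u e k z : ℕ) : ℕ := min z u / 2 ^ e + rank S z / k

theorem groupIndex_mono (S : Finset ℕ) (u e k : ℕ) : Monotone (groupIndex S u e k) := by
  intro y z h
  have h₁ : min y u / 2 ^ e ≤ min z u / 2 ^ e := Nat.div_le_div_right (min_le_min_right u h)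
  have h₂ : rank S y / k ≤ rank S z / k := Nat.div_le_div_right (rank_mono S h)
  unfold groupIndex
  omega

/-- Both summands are monotone, so equality of the sums forces equality of each of them. -/
theorem groupIndex_eq {S : Finset ℕ} {u e k y z : ℕ} (hy : y ≤ u) (hz : z ≤ u)
    (h : groupIndex S u e k y = groupIndex S u e k z) :
    y / 2 ^ e = z / 2 ^ e ∧ rank S y / k = rank S z / k := by
  unfold groupIndex at h
  rw [min_eq_left hy, min_eq_left hz] at h
  rcases le_total y z with hyz | hyz
  · have h₁ : y / 2 ^ e ≤ z / 2 ^ e := Nat.div_le_div_right hyz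
    have h₂ : rank S y / k ≤ rank S z / k := Nat.div_le_div_right (rank_mono S hyz)
    omega
  · have h₁ : z / 2 ^ e ≤ y / 2 ^ e := Nat.div_le_div_right hyz
    have h₂ : rank S z / k ≤ rank S y / k := Nat.div_le_div_right (rank_mono S hyz)
    omega

/-- Owing to the truncation `min z u` this holds for every `z`, which makes all values of the index
fit in a word. -/
theorem groupIndex_le {S : Finset ℕ} {u e k : ℕ} (z : ℕ) :
    groupIndex S u e k z ≤ u / 2 ^ e + #S / k :=
  Nat.add_le_add (Nat.div_le_div_right (min_le_right z u)) (Nat.div_le_div_right (rank_le_card S z))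

/-- `rank S` is injective on `S`, and the ranks of a group lie in one interval of length `k`. -/
theorem card_group_le {S : Finset ℕ} {u e k x : ℕ} (hk : 0 < k) (hS : S ⊆ Icc 1 u) (hx : x ≤ u) :
    #(S.filter fun a => groupIndex S u e k a = groupIndex S u e k x) ≤ k := by
  have : #(Ico (rank S x / k * k) (rank S x / k * k + k)) = k := by simp
  refine le_of_le_of_eq ?_ this
  refine card_le_card_of_injOn (rank S) (fun a ha => ?_) fun a ha b hb hab => ?_
  · obtain ⟨ha, h⟩ := mem_filter.1 ha
    have := (groupIndex_eq (mem_Icc.1 (hS ha)).2 hx h).2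
    rw [← this, coe_Ico, Set.mem_Ico]
    exact ⟨Nat.div_mul_le_self _ _, Nat.lt_div_mul_add hk⟩
  · rcases lt_trichotomy a b with h | h | h
    · exact absurd hab (rank_lt_rank (mem_filter.1 hb).1 h).ne
    · exact h
    · exact absurd hab (rank_lt_rank (mem_filter.1 ha).1 h).ne'

/-- The start of a block is `0` or a point where the first summand of the index increases. Hence
every query has a root in the trie. -/
theorem exists_jump_in_block {S : Finset ℕ} {u e k x : ℕ} (hx : x ≤ u) :
    ∃ s ∈ jumps (groupIndex S u e k) u, s / 2 ^ e = x / 2 ^ e := by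
  have hpos : 0 < 2 ^ e := by positivity
  have hle : x / 2 ^ e * 2 ^ e ≤ x := Nat.div_mul_le_self _ _
  refine ⟨x / 2 ^ e * 2 ^ e, ?_, Nat.mul_div_cancel _ hpos⟩
  simp only [jumps, mem_filter, mem_range]
  refine ⟨by omega, ?_⟩
  rcases Nat.eq_zero_or_pos (x / 2 ^ e * 2 ^ e) with h | h
  · exact .inl h
  · right
    refine (groupIndex_mono S u e k (Nat.sub_le _ 1)).lt_of_ne fun h' => ?_
    have := (groupIndex_eq (by omega) (by omega) h').1
    rw [Nat.mul_div_cancel _ hpos] at this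
    have h₁ : x / 2 ^ e * 2 ^ e - 1 < x / 2 ^ e * 2 ^ e := by omega
    have h₂ := (Nat.div_lt_iff_lt_mul hpos).2 h₁
    omega

/-- From `y < 51 * (q + 1)` and `51 < 2 ^ 6`. It turns the bounds on trie levels and on words per
group into the search time. -/
theorem clog_le_of_mul_le {q y lam l : ℕ} (hlam : 0 < lam) (hq : q = l / lam)
    (h : y * lam ≤ 51 * l) : Nat.clog 2 (y + 1) ≤ Nat.log 2 q + 7 := by
  refine Nat.clog_le_of_le_pow ?_
  have h₁ : q + 1 ≤ 2 ^ (Nat.log 2 q + 1) := Nat.lt_pow_succ_log_self (by norm_num) q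
  have h₂ : l < (q + 1) * lam := by
    rw [hq, Nat.succ_mul]
    exact Nat.lt_div_mul_add hlam
  have h₃ : y < 51 * (q + 1) := by
    by_contra hc
    have := Nat.mul_le_mul_right lam (Nat.le_of_not_lt hc)
    nlinarith
  rw [show Nat.log 2 q + 7 = Nat.log 2 q + 1 + 6 by omega, pow_add]
  omega

/-- Parameters of the structure for sparse sets. -/
structure SparseParams (w u n l c J k b f g pad : ℕ) : Prop where
  chunk_pos : 0 < c
  levels_pos : 0 < J
  levels_le : c * (J - 1) ≤ w
  children_le : (c + 1) * 2 ^ c ≤ w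
  levels_mul : J * Nat.log 2 w ≤ 51 * l
  run_pos : 0 < k
  run_mul : k * Nat.log 2 w ≤ w
  le_run_mul : w ≤ 2 * (k * Nat.log 2 w)
  blocks_mul : u / 2 ^ (c * J) * w ≤ 2 * n
  low : b = min (c * J) w
  fields_pos : 0 < g
  fields_le : f * g ≤ w
  width_pos : 0 < f
  fields_lt : 2 ≤ g → g < 2 ^ f
  fields_low : 2 ≤ g → b = f - 1 ∧ pad = 2 ^ b
  le_pad : ∀ v < 2 ^ b, v ≤ pad
  pad_lt : pad < 2 ^ f
  le_fields_mul : w ≤ 36 * l * g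

/-- Take `c = lam / 2`, so that `2 ^ c` fields of `c + 1` bits fit in a word, and let `c * J` be
just above `min (l + lam) w`. Either one block covers the universe, or blocks have length at least
`2 ^ (l + lam)` and there are at most `n / 2 ^ lam`, hence at most `2 * n / w` of them. As `lam < 8
* l`, one has `c * J ≤ l + 2 * lam ≤ 17 * l`; with `lam ≤ 3 * c` this yields the factor `51`, and
with `c * J + 1 ≤ 18 * l` the factor `36`. -/
theorem exists_sparseParams {w u n l : ℕ} (hw : 2 ^ 64 ≤ w) (hu : u < 2 ^ w) (hn : 0 < n)
    (hl : Nat.log 2 w < 8 * l) (hul : u ≤ n * 2 ^ l) :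
    ∃ c J k b f g pad, SparseParams w u n l c J k b f g pad := by
  set lam := Nat.log 2 w with hlam
  have hlam64 : 64 ≤ lam := Nat.le_log_of_pow_le (by norm_num) hw
  have hw0 : w ≠ 0 := by positivity
  have hp₁ : 2 ^ lam ≤ w := Nat.pow_log_le_self 2 hw0
  have hp₂ : w < 2 ^ (lam + 1) := Nat.lt_pow_succ_log_self (by norm_num) w
  have hlamw : 8 * lam ≤ w := by
    have h₁ : ∀ m, 64 ≤ m → 8 * m ≤ 2 ^ m := by
      intro m hm
      induction m, hm using Nat.le_induction with
      | base => norm_num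
      | succ m _ ih => rw [pow_succ]; omega
    exact (h₁ lam hlam64).trans hp₁
  set c := lam / 2 with hc
  set mu := min (l + lam) w with hmu
  set J := mu / c + 1 with hJ
  have hc0 : 0 < c := by omega
  have hJ0 : 0 < J := Nat.succ_pos _
  have hJ₁ : c * (J - 1) ≤ mu := by
    rw [hJ, Nat.add_sub_cancel]
    exact Nat.mul_div_le _ _
  have hJ₂ : mu < c * J := Nat.lt_mul_div_succ _ hc0
  have hJ₃ : c * J ≤ mu + c := by
    have : c * J = c * (J - 1) + c := by
      rw [hJ, Nat.add_sub_cancel, Nat.mul_succ]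
    omega
  have hJl : c * J ≤ l + 2 * lam := by omega
  have hmulam : lam < mu := by omega
  have hfp : w < 2 ^ (c * J + 1) := hp₂.trans_le (Nat.pow_le_pow_right (by norm_num) (by omega))
  have hblocks : u / 2 ^ (c * J) * w ≤ 2 * n := by
    rcases Nat.lt_or_ge (c * J) w with h | h
    · have h₁ : l + lam ≤ c * J := by omega
      have h₂ : u / 2 ^ (c * J) ≤ u / 2 ^ (l + lam) :=
        Nat.div_le_div_left (Nat.pow_le_pow_right (by norm_num) h₁) (by positivity)
      have h₃ : u / 2 ^ (l + lam) * 2 ^ lam ≤ n := by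
        have h₄ : u / 2 ^ (l + lam) * 2 ^ (l + lam) ≤ n * 2 ^ l :=
          (Nat.div_mul_le_self _ _).trans hul
        rw [show 2 ^ (l + lam) = 2 ^ lam * 2 ^ l by rw [pow_add, Nat.mul_comm],
          ← Nat.mul_assoc] at h₄
        rw [show 2 ^ (l + lam) = 2 ^ lam * 2 ^ l by rw [pow_add, Nat.mul_comm]]
        exact Nat.le_of_mul_le_mul_right h₄ (by positivity)
      calc _ ≤ u / 2 ^ (l + lam) * (2 * 2 ^ lam) :=
            Nat.mul_le_mul h₂ (by rw [← pow_succ']; exact hp₂.le)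
        _ ≤ 2 * n := by linarith
    · rw [Nat.div_eq_of_lt (hu.trans_le (Nat.pow_le_pow_right (by norm_num) h))]
      omega
  have hkpos : 0 < w / lam := Nat.div_pos (by omega) (by omega)
  have hkw : w ≤ 2 * (w / lam * lam) := by
    have h₁ := Nat.lt_div_mul_add (a := w) (by omega : 0 < lam)
    have h₂ := Nat.mul_le_mul_right lam hkpos
    omega
  have hchild : (c + 1) * 2 ^ c ≤ w := by
    calc (c + 1) * 2 ^ c ≤ 2 ^ c * 2 ^ c := Nat.mul_le_mul_right _ Nat.lt_two_pow_self
      _ = 2 ^ (c + c) := (pow_add _ _ _).symm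
      _ ≤ 2 ^ lam := Nat.pow_le_pow_right (by norm_num) (by omega)
      _ ≤ w := hp₁
  have hJlam : J * lam ≤ 51 * l := by
    calc J * lam ≤ J * (3 * c) := Nat.mul_le_mul_left _ (by omega)
      _ = 3 * (c * J) := by ring
      _ ≤ 51 * l := by omega
  -- If two fields of `c * J + 1` bits do not fit in a word, every key gets a word of its own, and
  -- `w < 36 * l` pays for it.
  rcases Nat.lt_or_ge w (2 * (c * J + 1)) with h | h
  · refine ⟨c, J, w / lam, min (c * J) w, w, 1, 2 ^ w - 1, hc0, hJ0, by omega, hchild, hJlam,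
      hkpos, Nat.div_mul_le_self _ _, hkw, hblocks, rfl, by omega, by omega, by omega, by omega,
      by omega, fun v hv => ?_, ?_, by omega⟩
    · have : 2 ^ min (c * J) w ≤ 2 ^ w := Nat.pow_le_pow_right (by norm_num) (by omega)
      omega
    · have : 0 < 2 ^ w := by positivity
      omega
  · have hg : 0 < w / (c * J + 1) := Nat.div_pos (by omega) (by omega)
    refine ⟨c, J, w / lam, min (c * J) w, c * J + 1, w / (c * J + 1), 2 ^ (c * J), hc0, hJ0,
      by omega, hchild, hJlam, hkpos, Nat.div_mul_le_self _ _, hkw, hblocks, rfl, hg,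
      Nat.mul_div_le _ _, by omega, fun _ => (Nat.div_le_self _ _).trans_lt hfp, fun _ => ?_,
      fun v hv => ?_, ?_, ?_⟩
    · rw [min_eq_left (by omega)]
      exact ⟨by omega, rfl⟩
    · rw [min_eq_left (by omega)] at hv
      exact hv.le
    · exact Nat.pow_lt_pow_right (by norm_num) (by omega)
    · have h₁ := Nat.lt_div_mul_add (a := w) (by omega : 0 < c * J + 1)
      have h₂ := Nat.mul_le_mul_right (c * J + 1) hg
      have h₃ : c * J + 1 ≤ 18 * l := by omega
      calc w ≤ 2 * (w / (c * J + 1) * (c * J + 1)) := by omega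
        _ ≤ 2 * (w / (c * J + 1) * (18 * l)) := by gcongr
        _ = _ := by ring


end WordRAM

/-! ### Assembly of the structure for sparse sets. -/

namespace WordRAM
open Finset

/-- Entry `i` is the value of `param i`. The tag `5` comes first, and the directory of the groups
starts behind these `24` words. -/
def sparseHeader (w c b f g J flag a s tb : ℕ) : List ℕ :=
  [5, J, flag, c, 0, 2 ^ (w - 1), a, s, tb, pack (c + 1) (2 ^ c) fun _ => 1,
    pack (c + 1) (2 ^ c) fun _ => 2 ^ c, 0, (c + 1) * (2 ^ c - 1), 2 ^ (c + 1) - 1, 2 ^ c - 1, 24,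
    2 ^ b - 1, g, pack f g fun _ => 1, pack f g fun _ => 2 ^ (f - 1), f - 1, f * (g - 1),
    2 ^ f - 1, f]

/-- Bounds the number of groups by `O(n lam / w)`; multiplied by the `O(l / lam)` levels of the trie
it gives `O(n l / w)` words. -/
theorem sparse_card_mul {w u n l c J k b f g pad : ℕ}
    (h : SparseParams w u n l c J k b f g pad) :
    (u / 2 ^ (c * J) + n / k) * w ≤ 2 * n + 2 * (n * Nat.log 2 w) := by
  have h₁ : n / k * w ≤ 2 * (n * Nat.log 2 w) := by
    calc n / k * w ≤ n / k * (2 * (k * Nat.log 2 w)) := Nat.mul_le_mul_left _ h.le_run_mul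
      _ = 2 * (n / k * k * Nat.log 2 w) := by ring
      _ ≤ 2 * (n * Nat.log 2 w) := by gcongr; exact Nat.div_mul_le_self _ _
  rw [Nat.add_mul]
  exact Nat.add_le_add h.blocks_mul h₁

theorem exists_sparseTrie {w u l c J k b f g pad base : ℕ} {S : Finset ℕ} (hw : 2 ^ 64 ≤ w)
    (hu : u < 2 ^ w) (hl : Nat.log 2 w < 8 * l) (hl' : #S * l ≤ 2 * 2 ^ w)
    (h : SparseParams w u #S l c J k b f g pad) (hbase : 0 < base) (hbase' : 2 * base ≤ 2 ^ w) :
    ∃ (T : List ℕ) (J' flag a s tb : ℕ), T.length * w ≤ 15000 * (#S * l + w) ∧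
      (∀ t ∈ T, t < 2 ^ w) ∧ J' < 2 ^ w ∧ flag < 2 ^ w ∧ a < 2 ^ w ∧ s < 2 ^ w ∧ tb < 2 ^ w ∧
      ∀ M : ℕ → ℕ, (∀ i < T.length, M (base + i) = T.getD i 0) →
        (∀ i < 24, M i = (sparseHeader w c b f g J' flag a s tb).getD i 0) →
        ∀ x ≤ u, ∃ σ' t, Runs w M trieSearch (start x) σ' t ∧
          t ≤ 2 * trieCost * (Nat.log 2 (l / Nat.log 2 w) + 8) ∧ σ' 0 = x ∧
          σ' 6 = groupIndex S u (c * J) k x := by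
  set lam := Nat.log 2 w with hlam
  have hlam64 : 64 ≤ lam := Nat.le_log_of_pow_le (by norm_num) hw
  have hcard := sparse_card_mul h
  rw [← hlam] at hcard
  have hw6 : 1000000 ≤ w := le_trans (by norm_num) hw
  clear hw
  have h2w : 1000 * w ≤ 2 ^ w := by
    have h₁ : ∀ m, 64 ≤ m → 1000 * m ≤ 2 ^ m := by
      intro m hm
      induction m, hm using Nat.le_induction with
      | base => norm_num
      | succ m _ ih => rw [pow_succ 2 m]; omega
    exact h₁ w (by omega)
  set G := groupIndex S u (c * J) k with hG
  have hGm : Monotone G := groupIndex_mono S u (c * J) k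
  have hw64 : 64 ≤ w := by omega
  have hGle : ∀ z, G z ≤ u / 2 ^ (c * J) + #S / k := fun z => groupIndex_le z
  have hkl := h.run_mul
  rw [← hlam] at hkl
  have hk2 : 2 * k < w := by
    have h₁ := Nat.mul_le_mul_left k hlam64
    have h₂ := h.run_pos
    omega
  -- With fewer than `k` keys there is one block and one run, so all indices are `0` and no trie is
  -- stored. Otherwise `w ≤ 2 * #S * lam`, which pays for the additional jump point `0`.
  rcases Nat.lt_or_ge #S k with hnk | hnk
  · refine ⟨[], 1, 0, 0, 0, 0, by simp, by simp, by omega, by omega, by omega, by omega, by omega,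
      fun M _ hM x hx => ?_⟩
    obtain ⟨σ', t, r, ht, h0, h6⟩ := runs_trieSearch_none hw64 (hM 1 (by norm_num))
      (hM 2 (by norm_num)) x
    refine ⟨σ', t, r, ht.trans ?_, h0, ?_⟩
    · exact Nat.le_mul_of_pos_right _ (by omega)
    · have h₁ := h.blocks_mul
      have h₂ : u / 2 ^ (c * J) = 0 := by
        by_contra hne
        have := Nat.le_mul_of_pos_left w (Nat.pos_of_ne_zero hne)
        omega
      have h₃ := hGle x
      rw [h₂, Nat.div_eq_of_lt hnk] at h₃
      omega
  · have hA : #(jumps G u) ≤ u / 2 ^ (c * J) + #S / k + 1 :=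
      (card_jumps_le hGm u).trans (Nat.add_le_add_right (hGle u) 1)
    have hAw : #(jumps G u) * w ≤ 6 * (#S * lam) := by
      have h₁ : w ≤ 2 * (#S * lam) :=
        h.le_run_mul.trans (Nat.mul_le_mul_left _ (Nat.mul_le_mul_right _ hnk))
      have h₂ := Nat.mul_le_mul_right w hA
      have h₃ : #S * 1 ≤ #S * lam := Nat.mul_le_mul_left _ (by omega)
      rw [Nat.succ_mul] at h₂
      omega
    have hJAw : J * #(jumps G u) * w ≤ 306 * (#S * l) := by
      calc J * #(jumps G u) * w = J * (#(jumps G u) * w) := Nat.mul_assoc _ _ _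
        _ ≤ J * (6 * (#S * lam)) := Nat.mul_le_mul_left _ hAw
        _ = 6 * #S * (J * lam) := by ring
        _ ≤ 6 * #S * (51 * l) := Nat.mul_le_mul_left _ h.levels_mul
        _ = _ := by ring
    have hJA : 1000000 * (J * #(jumps G u)) ≤ 612 * 2 ^ w := by
      have := Nat.mul_le_mul_right (J * #(jumps G u)) hw6
      rw [Nat.mul_comm w] at this
      omega
    have hGw : ∀ z, G z < 2 ^ w := by
      intro z
      have h₁ := hGle z
      have h₂ : 1000000 * (u / 2 ^ (c * J) + #S / k) ≤ (u / 2 ^ (c * J) + #S / k) * w := by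
        rw [Nat.mul_comm _ w]
        exact Nat.mul_le_mul_right _ hw6
      have h₃ : #S * lam ≤ #S * (8 * l) := Nat.mul_le_mul_left _ hl.le
      have h₄ : #S * 1 ≤ #S * l := Nat.mul_le_mul_left _ (by omega)
      rw [Nat.mul_left_comm] at h₃
      generalize u / 2 ^ (c * J) + #S / k = z at *
      omega
    obtain ⟨T, a, s, tb, hT, hTw, ha, hs, htb, hM⟩ := exists_trie hw64 (G := G) (c := c) (J := J)
      (base := base) hu hGw h.chunk_pos h.levels_le h.children_le hbase (by omega)
    have hJw : J < 2 ^ w := by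
      have h₁ := h.levels_le
      have h₂ := Nat.le_mul_of_pos_left (J - 1) h.chunk_pos
      omega
    refine ⟨T, J, 1, a, s, tb, ?_, hTw, hJw, by omega, ha, hs, htb, fun M h₁ h₂ x hx => ?_⟩
    · have := Nat.mul_le_mul_right w hT
      rw [Nat.mul_assoc, Nat.add_mul] at this
      omega
    · have hTr := hM M h₁ (h₂ 1 (by norm_num)) (h₂ 2 (by norm_num)) (h₂ 3 (by norm_num))
        (h₂ 5 (by norm_num)) (h₂ 6 (by norm_num)) (h₂ 7 (by norm_num)) (h₂ 8 (by norm_num))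
        (h₂ 9 (by norm_num)) (h₂ 10 (by norm_num)) (h₂ 12 (by norm_num)) (h₂ 13 (by norm_num))
        (h₂ 14 (by norm_num))
      obtain ⟨σ', t, r, ht, h0, h6⟩ := runs_trieSearch hTr hw64 hu hGm h.chunk_pos h.levels_pos
        h.levels_le h.children_le (fun x hx => exists_jump_in_block hx) hx
      refine ⟨σ', t, r, ht.trans ?_, h0, h6⟩
      have h₃ : Nat.clog 2 J ≤ Nat.clog 2 (J + 1) := Nat.clog_mono_right 2 (Nat.le_succ J)
      have h₄ := clog_le_of_mul_le (by omega : 0 < lam) rfl h.levels_mul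
      exact Nat.mul_le_mul_left _ (by omega)

theorem sparseHeader_lt {w u n l c J k b f g pad J' flag a s tb : ℕ} (hw : 64 ≤ w)
    (h : SparseParams w u n l c J k b f g pad) (hJ : J' < 2 ^ w) (hflag : flag < 2 ^ w)
    (ha : a < 2 ^ w) (hs : s < 2 ^ w) (htb : tb < 2 ^ w) :
    ∀ t ∈ sparseHeader w c b f g J' flag a s tb, t < 2 ^ w := by
  have hww : w < 2 ^ w := Nat.lt_two_pow_self
  have hle : ∀ e ≤ w, 2 ^ e ≤ 2 ^ w := fun e he => Nat.pow_le_pow_right (by norm_num) he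
  have hc : 0 < 2 ^ c := by positivity
  have hc₁ : c + 1 ≤ w := (Nat.le_mul_of_pos_right _ hc).trans h.children_le
  have h₁ : (pack (c + 1) (2 ^ c) fun _ => 1) < 2 ^ w :=
    (pack_lt fun _ _ => Nat.one_lt_two_pow (by omega)).trans_le (hle _ h.children_le)
  have h₂ : (pack (c + 1) (2 ^ c) fun _ => 2 ^ c) < 2 ^ w :=
    (pack_lt fun _ _ => Nat.pow_lt_pow_right (by norm_num) (by omega)).trans_le
      (hle _ h.children_le)
  have hf := h.width_pos
  have h₃ : (pack f g fun _ => 1) < 2 ^ w :=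
    (pack_lt fun _ _ => Nat.one_lt_two_pow (by omega)).trans_le (hle _ h.fields_le)
  have h₄ : (pack f g fun _ => 2 ^ (f - 1)) < 2 ^ w :=
    (pack_lt fun _ _ => Nat.pow_lt_pow_right (by norm_num) (by omega)).trans_le
      (hle _ h.fields_le)
  have h₅ : (c + 1) * (2 ^ c - 1) ≤ w :=
    (Nat.mul_le_mul_left _ (Nat.sub_le _ _)).trans h.children_le
  have h₆ : f * (g - 1) ≤ w := (Nat.mul_le_mul_left _ (Nat.sub_le _ _)).trans h.fields_le
  have hfw : f ≤ w := (Nat.le_mul_of_pos_right _ h.fields_pos).trans h.fields_le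
  have hgw : g ≤ w := (Nat.le_mul_of_pos_left _ h.width_pos).trans h.fields_le
  have h₇ := hle f hfw
  have h₈ := hle (c + 1) hc₁
  have h₉ : 2 ^ b ≤ 2 ^ w := hle b (by rw [h.low]; omega)
  have h₁₀ : 2 ^ (w - 1) < 2 ^ w := Nat.pow_lt_pow_right (by norm_num) (by omega)
  have h₁₁ : 2 ^ c ≤ 2 ^ w := hle c (by omega)
  simp only [sparseHeader, List.forall_mem_cons, List.not_mem_nil, false_imp_iff, implies_true,
    and_true]
  refine ⟨?_, ?_, ?_, ?_, ?_, ?_, ?_, ?_, ?_, ?_, ?_, ?_, ?_, ?_, ?_, ?_, ?_, ?_, ?_, ?_, ?_, ?_,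
    ?_, ?_⟩ <;> omega

/-- Search in the structure for sparse sets. -/
def sparseSearch : Cmd := .seq trieSearch groupSearch

/-- The query finds the group index in the trie and then searches the group. The number of words of
a group is bounded by `k / g + 1`, so both binary searches have `O(1 + lg (l / lam))` rounds. -/
theorem exists_sparse {w u l : ℕ} {S : Finset ℕ} (hw : 2 ^ 64 ≤ w) (hu : u < 2 ^ w)
    (hS : S ⊆ Icc 1 u) (hn : 0 < #S) (hl : Nat.log 2 w < 8 * l) (hul : u ≤ #S * 2 ^ l)
    (hlu : #S * 2 ^ l ≤ 2 * u) :
    ∃ T : List ℕ, T.length * w ≤ 20000 * (#S * l + w) ∧ (∀ t ∈ T, t < 2 ^ w) ∧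
      T.getD 0 0 = 5 ∧ ∀ M : ℕ → ℕ, (∀ i < T.length, M i = T.getD i 0) →
        Solves w u S M sparseSearch
          (16 * (trieCost + groupCost) * (Nat.log 2 (l / Nat.log 2 w) + 1)) := by
  obtain ⟨c, J, k, b, f, g, pad, h⟩ := exists_sparseParams hw hu hn hl hul
  have hlam64 : 64 ≤ Nat.log 2 w := Nat.le_log_of_pow_le (by norm_num) hw
  have hcard := sparse_card_mul h
  have hl' : #S * l ≤ 2 * 2 ^ w := by
    have := Nat.mul_le_mul_left #S (Nat.lt_two_pow_self (n := l)).le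
    omega
  -- Here `64 ≤ lam < 8 * l` gives `l ≥ 9`, so `#S ≤ u / 256`; this leaves room for all addresses
  -- below `2 ^ w`.
  have hn' : 512 * #S ≤ 2 * u := by
    have h₁ : 2 ^ 9 ≤ 2 ^ l := Nat.pow_le_pow_right (by norm_num) (by omega)
    have := Nat.mul_le_mul_left #S h₁
    omega
  have hw6 : 1000000 ≤ w := le_trans (by norm_num) hw
  have h2w : 1000 * w ≤ 2 ^ w := by
    have h₁ : ∀ m, 64 ≤ m → 1000 * m ≤ 2 ^ m := by
      intro m hm
      induction m, hm using Nat.le_induction with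
      | base => norm_num
      | succ m _ ih => rw [pow_succ 2 m]; omega
    exact h₁ w (by omega)
  set N := u / 2 ^ (c * J) + #S / k with hN
  have hNw : N * w ≤ 18 * (#S * l) := by
    have h₃ : #S * Nat.log 2 w ≤ #S * (8 * l) := Nat.mul_le_mul_left _ hl.le
    have h₄ : #S * 1 ≤ #S * l := Nat.mul_le_mul_left _ (by omega)
    rw [Nat.mul_left_comm] at h₃
    omega
  have hN6 : 1000000 * N ≤ 36 * 2 ^ w := by
    have := Nat.mul_le_mul_right N hw6
    rw [Nat.mul_comm w] at this
    omega
  set G := groupIndex S u (c * J) k with hG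
  have hgw : g ≤ w := (Nat.le_mul_of_pos_left _ h.width_pos).trans h.fields_le
  have hfw : f ≤ w := (Nat.le_mul_of_pos_right _ h.fields_pos).trans h.fields_le
  obtain ⟨Tg, hTg, hTgw, hrunG⟩ := exists_groups (by omega : 64 ≤ w) (S := S) (G := G) (b := b)
    (f := f) (g := g) (pad := pad) (N := N + 1) (base := 24) hu hS (groupIndex_mono S u _ k)
    (by
      intro y hy z hz e
      have h₁ := (groupIndex_eq hy hz e).1
      rcases le_total (c * J) w with h₂ | h₂
      · rw [h.low, min_eq_left h₂, h₁]
      · rw [h.low, min_eq_right h₂, Nat.div_eq_of_lt (by omega), Nat.div_eq_of_lt (by omega)])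
    h.fields_pos h.fields_le hgw (fun hg => ⟨h.width_pos, h.fields_lt hg⟩) h.fields_low h.le_pad
    h.pad_lt (by omega)
  have hng : #S / g ≤ #S := Nat.div_le_self _ _
  obtain ⟨Tt, J', flag, a, s, tb, hTt, hTtw, hJ', hflag, ha, hs, htb, hrunT⟩ :=
    exists_sparseTrie (base := 24 + Tg.length) hw hu hl hl' h (by omega) (by omega)
  set H := sparseHeader w c b f g J' flag a s tb with hH
  have hHlen : H.length = 24 := rfl
  have hTlen : (H ++ Tg ++ Tt).length = 24 + Tg.length + Tt.length := by
    rw [List.length_append, List.length_append, hHlen]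
  refine ⟨H ++ Tg ++ Tt, ?_, ?_, rfl, fun M hM x _ hx => ?_⟩
  · rw [hTlen, Nat.add_mul, Nat.add_mul]
    have h₁ := Nat.mul_le_mul_right w hTg
    have h₂ : #S / g * w ≤ 36 * (#S * l) := by
      calc #S / g * w ≤ #S / g * (36 * l * g) := Nat.mul_le_mul_left _ h.le_fields_mul
        _ = 36 * (#S / g * g * l) := by ring
        _ ≤ 36 * (#S * l) := by gcongr; exact Nat.div_mul_le_self _ _
    rw [Nat.add_mul, Nat.mul_assoc, Nat.add_mul] at h₁
    omega
  · intro t ht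
    rcases List.mem_append.1 ht with ht | ht
    · rcases List.mem_append.1 ht with ht | ht
      · exact sparseHeader_lt (by omega) h hJ' hflag ha hs htb t ht
      · exact hTgw t ht
    · exact hTtw t ht
  · have hM₁ : ∀ i < 24, M i = H.getD i 0 := by
      intro i hi
      rw [hM i (by omega), List.append_assoc, List.getD_append _ _ _ _ (by omega)]
    have hM₂ : ∀ i < Tg.length, M (24 + i) = Tg.getD i 0 := by
      intro i hi
      rw [hM _ (by omega), List.getD_append _ _ _ _ (by rw [List.length_append]; omega)]
      exact getD_append_right' (l₁ := H) i
    have hM₃ : ∀ i < Tt.length, M (24 + Tg.length + i) = Tt.getD i 0 := by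
      intro i hi
      rw [hM _ (by omega), ← getD_append_right' (l₁ := H ++ Tg) (l₂ := Tt) i, List.length_append,
        hHlen]
    obtain ⟨σ₁, t₁, r₁, ht₁, h0, h6⟩ := hrunT M hM₃ hM₁ x hx
    have hgp : HasGroupParams w b f g 24 M :=
      ⟨hM₁ 15 (by norm_num), hM₁ 16 (by norm_num), hM₁ 17 (by norm_num),
        fun _ => hM₁ 18 (by norm_num), fun _ => hM₁ 19 (by norm_num),
        fun _ => hM₁ 20 (by norm_num), fun _ => hM₁ 21 (by norm_num), hM₁ 22 (by norm_num),
        hM₁ 23 (by norm_num)⟩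
    obtain ⟨σ₂, t₂, r₂, ht₂, e₀, e₁⟩ := hrunG M hM₂ hgp x hx
      (Nat.lt_succ_of_le (groupIndex_le x)) σ₁ h0 h6
    refine ⟨σ₂, t₁ + t₂, r₁.seq r₂, ?_, e₀, e₁⟩
    have hy : #(S.filter (G · = G x)) / g * Nat.log 2 w ≤ 51 * l := by
      have h₁ : #(S.filter (G · = G x)) / g ≤ k / g :=
        Nat.div_le_div_right (card_group_le h.run_pos hS hx)
      have h₂ : k / g * Nat.log 2 w * g ≤ 36 * l * g := by
        calc k / g * Nat.log 2 w * g = k / g * g * Nat.log 2 w := by ring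
          _ ≤ k * Nat.log 2 w := Nat.mul_le_mul_right _ (Nat.div_mul_le_self _ _)
          _ ≤ 36 * l * g := h.run_mul.trans h.le_fields_mul
      have h₃ := Nat.le_of_mul_le_mul_right h₂ h.fields_pos
      have h₄ := Nat.mul_le_mul_right (Nat.log 2 w) h₁
      omega
    revert ht₁ ht₂
    generalize trieCost = K₁
    generalize groupCost = K₂
    intro ht₁ ht₂
    have hclog := clog_le_of_mul_le (by omega : 0 < Nat.log 2 w) rfl hy
    have h₁ := Nat.mul_le_mul_left (2 * K₂) (Nat.add_le_add_right hclog 1)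
    have h₂ : ∀ K q : ℕ, 2 * K * (q + 8) ≤ 16 * K * (q + 1) := fun K q =>
      (Nat.mul_le_mul_left (2 * K) (by omega : q + 8 ≤ 8 * (q + 1))).trans_eq (by ring)
    have h₃ := h₂ K₁ (Nat.log 2 (l / Nat.log 2 w))
    have h₄ := h₂ K₂ (Nat.log 2 (l / Nat.log 2 w))
    rw [Nat.mul_add 16, Nat.add_mul]
    exact Nat.add_le_add (ht₁.trans h₃) (ht₂.trans (h₁.trans h₄))

end WordRAM

namespace WordRAM
open Finset

/-! ### Selection in bit strings -/

theorem card_filter_range_eq {s k : ℕ} {Q : ℕ → Prop} [DecidablePred Q] (hk : k ≤ s)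
    (h : ∀ i < s, Q i ↔ i < k) : #{i ∈ range s | Q i} = k := by
  have : {i ∈ range s | Q i} = range k := by
    ext i
    rw [mem_filter, mem_range, mem_range]
    exact ⟨fun hi => (h i hi.1).1 hi.2, fun hi => ⟨by omega, (h i (by omega)).2 hi⟩⟩
  rw [this, card_range]

theorem card_ones {v s m : ℕ} {p : ℕ → ℕ} (hp : ∀ i j, i < j → j < m → p i < p j)
    (hv : ∀ i < s, (v.testBit i = true ↔ ∃ j < m, p j = i)) {i : ℕ} (hi : i < s) :
    #{j ∈ range (i + 1) | v.testBit j = true} = #{j ∈ range m | p j ≤ i} := by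
  have : {j ∈ range (i + 1) | v.testBit j = true} = ({j ∈ range m | p j ≤ i}).image p := by
    ext k
    simp only [mem_filter, mem_range, mem_image]
    constructor
    · rintro ⟨hk, h⟩
      obtain ⟨j, hj, rfl⟩ := (hv k (by omega)).1 h
      exact ⟨j, ⟨hj, by omega⟩, rfl⟩
    · rintro ⟨j, ⟨hj, h⟩, rfl⟩
      exact ⟨by omega, (hv _ (by omega)).2 ⟨j, hj, rfl⟩⟩
  rw [this, card_image_of_injOn]
  intro a ha b hb hab
  simp only [coe_filter, mem_range, Set.mem_ofPred_eq] at ha hb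
  rcases lt_trichotomy a b with h | h | h
  · exact absurd hab (hp a b h hb.1).ne
  · exact h
  · exact absurd hab (ne_of_gt (hp b a h ha.1))

/-- Position of the one with index `j`. -/
theorem select_one {v s m : ℕ} {p : ℕ → ℕ} (hp : ∀ i j, i < j → j < m → p i < p j)
    (hv : ∀ i < s, (v.testBit i = true ↔ ∃ j < m, p j = i)) {j : ℕ} (hj : j < m) (hjs : p j ≤ s) :
    #{i ∈ range s | #{k ∈ range (i + 1) | v.testBit k = true} ≤ j} = p j := by
  refine card_filter_range_eq hjs fun i hi => ?_
  rw [card_ones hp hv hi]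
  constructor
  · intro h
    by_contra hc
    have : range (j + 1) ⊆ {j ∈ range m | p j ≤ i} := by
      intro k hk
      rw [mem_range] at hk
      rw [mem_filter, mem_range]
      refine ⟨by omega, ?_⟩
      rcases Nat.lt_or_ge k j with h' | h'
      · have := hp k j h' hj
        omega
      · rw [show k = j by omega]
        omega
    have := card_le_card this
    rw [card_range] at this
    omega
  · intro h
    have : {j ∈ range m | p j ≤ i} ⊆ range j := by
      intro k hk
      rw [mem_filter, mem_range] at hk
      rw [mem_range]
      by_contra hc
      rcases Nat.lt_or_ge j k with h' | h'
      · have := hp j k h' hk.1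
        omega
      · rw [show k = j by omega] at hk
        omega
    simpa using card_le_card this

/-- Position of the zero with index `d` in the unary code of `hi`. -/
theorem select_zero {v s m : ℕ} {hi : ℕ → ℕ} (hh : ∀ i j, i ≤ j → j < m → hi i ≤ hi j)
    (hv : ∀ i < s, (v.testBit i = true ↔ ∃ j < m, hi j + j = i)) {d : ℕ}
    (hd : d + #{j ∈ range m | hi j ≤ d} ≤ s) :
    #{i ∈ range s | #{k ∈ range (i + 1) | v.testBit k = false} ≤ d} =
      d + #{j ∈ range m | hi j ≤ d} := by
  set E := #{j ∈ range m | hi j ≤ d} with hE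
  have hEr : {j ∈ range m | hi j ≤ d} = range E := eq_range_card fun a ha b hb => by
    rw [mem_filter, mem_range] at ha ⊢
    exact ⟨by omega, (hh b a hb.le ha.1).trans ha.2⟩
  have hiff : ∀ j < m, (hi j ≤ d ↔ j < E) := fun j hj => by
    rw [← mem_range, ← hEr, mem_filter, mem_range]
    simp [hj]
  have hEm : E ≤ m := by simpa using card_filter_le (range m) fun j => hi j ≤ d
  refine card_filter_range_eq hd fun i his => ?_
  -- Ones and zeros among the bits `0, …, i` add up to `i + 1`, and by `card_ones` the ones are the
  -- keys with `hi j + j ≤ i`.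
  have hsum : #{k ∈ range (i + 1) | v.testBit k = true} +
      #{k ∈ range (i + 1) | v.testBit k = false} = i + 1 := by
    have := card_filter_add_card_filter_not (s := range (i + 1)) fun k => v.testBit k = true
    simpa using this
  rw [card_ones (p := fun j => hi j + j) (fun a b hab hb => by
    have := hh a b hab.le hb
    omega) hv his] at hsum
  constructor
  · intro h
    by_contra hc
    have : {j ∈ range m | hi j + j ≤ i} ⊆ range (i - d) := by
      intro j hj
      rw [mem_filter, mem_range] at hj
      rw [mem_range]
      have := hiff j hj.1
      omega
    have := card_le_card this
    rw [card_range] at this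
    omega
  · intro h
    have : range (i + 1 - d) ⊆ {j ∈ range m | hi j + j ≤ i} := by
      intro j hj
      rw [mem_range] at hj
      rw [mem_filter, mem_range]
      have := hiff j (by omega)
      omega
    have := card_le_card this
    rw [card_range] at this
    omega

theorem testBit_sum_two_pow {m : ℕ} {p : ℕ → ℕ} (hp : ∀ i j, i < j → j < m → p i < p j) (i : ℕ) :
    (∑ j ∈ range m, 2 ^ p j).testBit i = true ↔ ∃ j < m, p j = i := by
  have hinj : Set.InjOn p (range m) := by
    intro a ha b hb hab
    simp only [coe_range, Set.mem_Iio] at ha hb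
    rcases lt_trichotomy a b with h | h | h
    · exact absurd hab (hp a b h hb).ne
    · exact h
    · exact absurd hab (hp b a h ha).ne'
  rw [← sum_image (f := fun i => 2 ^ i) hinj, ← Nat.mem_bitIndices, ← List.mem_toFinset,
    toFinset_bitIndices_sum_two_pow]
  simp

end WordRAM

namespace WordRAM
open Finset

/-! ### Decoding a block of a dense set -/

/-- Cost of a command without branches. -/
def Cmd.lineCost : Cmd → ℕ
  | .assign _ e => e.cost + 1
  | .seq a b => a.lineCost + b.lineCost
  | _ => 0

theorem Runs.line_assign {w : ℕ} {M σ : ℕ → ℕ} {d v : ℕ} {e : Expr} (h : e.eval w M σ = v) :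
    Runs w M (.assign d e) σ (Function.update σ d v) (Cmd.lineCost (.assign d e)) :=
  Runs.assign_of_eq h

theorem Runs.line_seq {w : ℕ} {M σ₁ σ₂ σ₃ : ℕ → ℕ} {a b : Cmd}
    (h₁ : Runs w M a σ₁ σ₂ a.lineCost) (h₂ : Runs w M b σ₂ σ₃ b.lineCost) :
    Runs w M (.seq a b) σ₁ σ₃ (Cmd.lineCost (.seq a b)) :=
  Runs.seq h₁ h₂

def fieldCount (z q : Expr) : Expr :=
  Expr.count (param 10) (param 11) (param 13) (param 14) (param 15) z q

def spread (v : Expr) : Expr :=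
  Expr.zeroCounts (param 10) (param 11) (param 12) (param 13) (param 9) v

def lowCount (z q : Expr) : Expr :=
  Expr.count (param 18) (param 19) (param 1) (param 20) (param 21) z q

/-- The memory contains the parameters of a dense set. -/
structure HasDenseParams (w l lam beta s : ℕ) (M : ℕ → ℕ) : Prop where
  low : M 1 = l
  super : M 2 = l + lam
  block : M 3 = beta
  blocks : M 4 = 2 ^ (lam - beta) - 1
  bucket : M 5 = 2 ^ beta - 1
  lowMask : M 6 = 2 ^ l - 1
  offset : M 7 = 2 * lam
  offsetMask : M 8 = 2 ^ (2 * lam) - 1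
  full : M 9 = 2 ^ ((s + 1) * s) - 1
  ones : M 10 = pack (s + 1) s fun _ => 1
  tops : M 11 = pack (s + 1) s fun _ => 2 ^ s
  pows : M 12 = pack (s + 1) s fun i => 2 ^ i
  bits : M 13 = s
  last : M 14 = (s + 1) * (s - 1)
  mask : M 15 = 2 ^ (s + 1) - 1
  bitsMask : M 16 = 2 ^ s - 1
  lowsMask : M 17 = 2 ^ ((l + 1) * 2 ^ (beta + l)) - 1
  lowOnes : M 18 = pack (l + 1) (2 ^ l) fun _ => 1
  lowTops : M 19 = pack (l + 1) (2 ^ l) fun _ => 2 ^ l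
  lowLast : M 20 = (l + 1) * (2 ^ l - 1)
  fieldMask : M 21 = 2 ^ (l + 1) - 1
  field : M 22 = l + 1
  lowNum : M 23 = 2 ^ l
  word : M 24 = w

/-- Fields filled with `0` are always counted, so their number can be subtracted afterwards. -/
theorem card_padded {N n x : ℕ} (f : ℕ → ℕ) (hn : n ≤ N) :
    #{i ∈ range N | (if i < n then f i else 0) ≤ x} = #{i ∈ range n | f i ≤ x} + (N - n) := by
  obtain ⟨k, rfl⟩ := Nat.exists_eq_add_of_le hn
  rw [card_filter, card_filter, sum_range_add, Nat.add_sub_cancel_left]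
  congr 1
  · refine sum_congr rfl fun i hi => ?_
    rw [if_pos (mem_range.1 hi)]
  · simp

/-- The indices below `A` lie in earlier buckets and those from `A` to `B - 1` in bucket `d`; only
for the latter the low part decides. -/
theorem card_lex {m d x : ℕ} {hi lo : ℕ → ℕ} (hh : ∀ i j, i ≤ j → j < m → hi i ≤ hi j) {A B : ℕ}
    (hA : A = #{j ∈ range m | hi j < d}) (hB : B = #{j ∈ range m | hi j ≤ d}) :
    #{j ∈ range m | hi j < d ∨ hi j = d ∧ lo j ≤ x} =
      A + #{i ∈ range (B - A) | lo (A + i) ≤ x} := by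
  have hAr : {j ∈ range m | hi j < d} = range A := hA ▸ eq_range_card fun a ha b hb => by
    rw [mem_filter, mem_range] at ha ⊢
    exact ⟨by omega, (hh b a hb.le ha.1).trans_lt ha.2⟩
  have hBr : {j ∈ range m | hi j ≤ d} = range B := hB ▸ eq_range_card fun a ha b hb => by
    rw [mem_filter, mem_range] at ha ⊢
    exact ⟨by omega, (hh b a hb.le ha.1).trans ha.2⟩
  have hiA : ∀ j < m, (hi j < d ↔ j < A) := fun j hj => by
    rw [← mem_range (m := j), ← hAr, mem_filter, mem_range]
    simp [hj]
  have hiB : ∀ j < m, (hi j ≤ d ↔ j < B) := fun j hj => by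
    rw [← mem_range (m := j), ← hBr, mem_filter, mem_range]
    simp [hj]
  have hAB : A ≤ B := by
    rw [hA, hB]
    exact card_le_card fun j hj => by
      rw [mem_filter] at hj ⊢
      exact ⟨hj.1, hj.2.le⟩
  have hBm : B ≤ m := by
    rw [hB]
    simpa using card_filter_le (range m) fun j => hi j ≤ d
  obtain ⟨k, rfl⟩ := Nat.exists_eq_add_of_le hAB
  obtain ⟨r, rfl⟩ := Nat.exists_eq_add_of_le hBm
  rw [card_filter, sum_range_add, sum_range_add, Nat.add_sub_cancel_left, card_filter]
  have h₁ : ∑ j ∈ range A, (if hi j < d ∨ hi j = d ∧ lo j ≤ x then 1 else 0) = A := by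
    rw [sum_congr rfl (g := fun _ => 1)]
    · simp
    · intro j hj
      rw [mem_range] at hj
      rw [if_pos (.inl ((hiA j (by omega)).2 hj))]
  have h₂ : ∑ i ∈ range k, (if hi (A + i) < d ∨ hi (A + i) = d ∧ lo (A + i) ≤ x then 1 else 0) =
      ∑ i ∈ range k, if lo (A + i) ≤ x then 1 else 0 := by
    refine sum_congr rfl fun i hi => ?_
    rw [mem_range] at hi
    have e₁ := hiA (A + i) (by omega)
    have e₂ := hiB (A + i) (by omega)
    refine if_congr ?_ rfl rfl
    omega
  have h₃ : ∑ i ∈ range r, (if hi (A + k + i) < d ∨ hi (A + k + i) = d ∧ lo (A + k + i) ≤ x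
      then 1 else 0) = 0 := by
    refine sum_eq_zero fun i hi => ?_
    rw [mem_range] at hi
    have e₁ := hiA (A + k + i) (by omega)
    have e₂ := hiB (A + k + i) (by omega)
    rw [if_neg]
    omega
  rw [h₁, h₂, h₃, Nat.add_zero]

theorem eval_fieldCount {w l lam beta s : ℕ} {M σ : ℕ → ℕ} (h : HasDenseParams w l lam beta s M)
    (hw : 64 ≤ w) (hs : 0 < s) (hsw : (s + 1) * s ≤ w) {z q : Expr} {a : ℕ → ℕ} {v : ℕ}
    (hz : z.eval w M σ = pack (s + 1) s a) (hq : q.eval w M σ = v) (ha : ∀ i < s, a i ≤ s)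
    (hv : v ≤ s) : (fieldCount z q).eval w M σ = #{i ∈ range s | a i ≤ v} := by
  have hww : w < 2 ^ w := Nat.lt_two_pow_self
  have hss : s < 2 ^ s := Nat.lt_two_pow_self
  have hss' : s < 2 ^ (s + 1) := hss.trans (Nat.pow_lt_pow_right (by norm_num) (by omega))
  exact Expr.eval_count hs hsw hss' (eval_param (by omega) h.ones) (eval_param (by omega) h.tops)
    (eval_param (by omega) h.bits) (eval_param (by omega) h.last) (eval_param (by omega) h.mask)
    hz hq (fun i hi => (ha i hi).trans hss.le) (by omega)

theorem eval_spread {w l lam beta s : ℕ} {M σ : ℕ → ℕ} (h : HasDenseParams w l lam beta s M)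
    (hw : 64 ≤ w) (hsw : (s + 1) * s ≤ w) {e : Expr} {v : ℕ} (he : e.eval w M σ = v)
    (hv : v < 2 ^ s) :
    (spread e).eval w M σ = pack (s + 1) s fun i => #{j ∈ range (i + 1) | v.testBit j = false} := by
  have hww : w < 2 ^ w := Nat.lt_two_pow_self
  exact Expr.eval_zeroCounts hsw (eval_param (by omega) h.ones) (eval_param (by omega) h.tops)
    (eval_param (by omega) h.pows) (eval_param (by omega) h.bits) (eval_param (by omega) h.full)
    he hv

theorem card_range_filter_le {i s : ℕ} (hi : i < s) (Q : ℕ → Prop) [DecidablePred Q] :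
    #{j ∈ range (i + 1) | Q j} ≤ s := by
  refine (card_filter_le _ _).trans ?_
  rw [card_range]
  omega

/-- `V` is the unary code of the bucket numbers `hi` of `m` keys. -/
structure IsUnary (s m : ℕ) (hi : ℕ → ℕ) (V : ℕ) : Prop where
  mono : ∀ i j, i ≤ j → j < m → hi i ≤ hi j
  lt : V < 2 ^ s
  bit : ∀ i < s, (V.testBit i = true ↔ ∃ j < m, hi j + j = i)

/-- The zero with index `d` is preceded by `d` zeros and by one bit for each key in the buckets up
to `d`; its position minus `d` is the number of these keys. -/
theorem eval_bucketEnd {w l lam beta s : ℕ} {M σ : ℕ → ℕ} (h : HasDenseParams w l lam beta s M)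
    (hw : 64 ≤ w) (hs : 0 < s) (hsw : (s + 1) * s ≤ w) {z q : Expr} {m V d : ℕ} {hi : ℕ → ℕ}
    (hV : IsUnary s m hi V)
    (hz : z.eval w M σ = pack (s + 1) s fun i => #{j ∈ range (i + 1) | V.testBit j = false})
    (hq : q.eval w M σ = d) (hd : d + #{j ∈ range m | hi j ≤ d} ≤ s) :
    (fieldCount z q - q).eval w M σ = #{j ∈ range m | hi j ≤ d} := by
  have hww : w < 2 ^ w := Nat.lt_two_pow_self
  have hsw' : s ≤ w := (Nat.le_mul_of_pos_left s s.succ_pos).trans hsw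
  have e := eval_fieldCount h hw hs hsw hz hq (fun i hi => card_range_filter_le hi _) (by omega)
  rw [select_zero hV.mono hV.bit hd] at e
  rw [Expr.eval_sub e hq (by omega) (by omega), Nat.add_sub_cancel_left]

/-- The one with index `j` stands at position `hi j + j`. It is found as a zero of the complement `2
^ s - 1 - V`. -/
theorem eval_bucketOf {w l lam beta s : ℕ} {M σ : ℕ → ℕ} (h : HasDenseParams w l lam beta s M)
    (hw : 64 ≤ w) (hs : 0 < s) (hsw : (s + 1) * s ≤ w) {v q : Expr} {m V j : ℕ} {hi : ℕ → ℕ}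
    (hV : IsUnary s m hi V) (hv : v.eval w M σ = V) (hq : q.eval w M σ = j) (hj : j < m)
    (hd : hi j + j ≤ s) :
    (fieldCount (spread (param 16 - v)) q - q).eval w M σ = hi j := by
  have hww : w < 2 ^ w := Nat.lt_two_pow_self
  have hsw' : s ≤ w := (Nat.le_mul_of_pos_left s s.succ_pos).trans hsw
  have hp : 2 ^ s ≤ 2 ^ w := Nat.pow_le_pow_right (by norm_num) hsw'
  have hlt := hV.lt
  have e₁ := Expr.eval_sub (eval_param (M := M) (σ := σ) (by omega) h.bitsMask) hv (by omega)
    (by omega)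
  have e₂ := eval_spread h hw hsw e₁ (by omega)
  rw [pack_congr (b := fun i => #{k ∈ range (i + 1) | V.testBit k = true})] at e₂
  swap
  · intro i his
    refine congrArg card (filter_congr fun k hk => ?_)
    rw [mem_range] at hk
    rw [show 2 ^ s - 1 - V = 2 ^ s - (V + 1) by omega, Nat.testBit_two_pow_sub_succ hlt]
    simp [show k < s by omega]
  have e₃ := eval_fieldCount h hw hs hsw e₂ hq (fun i hi => card_range_filter_le hi _) (by omega)
  rw [select_one (p := fun j => hi j + j) (fun a b hab hb => by
    have := hV.mono a b hab.le hb
    omega) hV.bit hj hd] at e₃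
  rw [Expr.eval_sub e₃ hq (by omega) (by omega), Nat.add_sub_cancel]

end WordRAM

/-! ### Rank of a query within a block. -/

namespace WordRAM
open Finset

/-- Variables `6`, `7`, `8` hold the unary code, the low parts and the bucket `d` of the query; `10`
and `11` become the numbers of keys in buckets up to `d` and before `d`. The low parts of bucket `d`
are cut out, and the remaining fields up to `2 ^ l` are zero and hence counted. This surplus is
corrected by adding the bucket size before subtracting `2 ^ l`, which avoids a negative intermediate
value. -/
def denseRank : Cmd :=
  .seq (.assign 9 (spread (.var 6)))
    (.seq (.assign 10 (fieldCount (.var 9) (.var 8) - .var 8))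
      (.seq (.assign 11 (.ite 0 (.var 8) (fieldCount (.var 9) (.var 8 - 1) - (.var 8 - 1)) 0))
        (.assign 12 (.var 11 + ((lowCount ((Expr.var 7 >>> (.var 11 * param 22)) &&&
          (((1 : Expr) <<< ((.var 10 - .var 11) * param 22)) - 1)) (.var 0 &&& param 6) +
            (.var 10 - .var 11)) - param 23)))))

theorem runs_denseRank {w l lam beta s : ℕ} {M σ : ℕ → ℕ} (h : HasDenseParams w l lam beta s M)
    (hw : 64 ≤ w) (hs : 0 < s) (hsw : (s + 1) * s ≤ w) {m V d x t : ℕ} {hi lo : ℕ → ℕ}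
    (hV : IsUnary s m hi V) (hlo : ∀ j, lo j < 2 ^ l) (htw : (l + 1) * t < w)
    (hlw : (l + 1) * 2 ^ l ≤ w)
    (h0 : σ 0 = x) (h6 : σ 6 = V) (h7 : σ 7 = pack (l + 1) t lo) (h8 : σ 8 = d)
    (hd : d + #{j ∈ range m | hi j ≤ d} ≤ s) (ht : #{j ∈ range m | hi j ≤ d} ≤ t)
    (hbucket : #{j ∈ range m | hi j ≤ d} ≤ #{j ∈ range m | hi j < d} + 2 ^ l) :
    ∃ σ', Runs w M denseRank σ σ' denseRank.lineCost ∧ (∀ i < 9, σ' i = σ i) ∧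
      σ' 12 = #{j ∈ range m | hi j < d ∨ hi j = d ∧ lo j ≤ x % 2 ^ l} := by
  have hww : 4 * w < 2 ^ w := by
    have h₁ : ∀ n, 64 ≤ n → 4 * n < 2 ^ n := by
      intro n hn
      induction n, hn using Nat.le_induction with
      | base => norm_num
      | succ n _ ih => rw [pow_succ]; omega
    exact h₁ w hw
  have hsw' : s ≤ w := (Nat.le_mul_of_pos_left s s.succ_pos).trans hsw
  have hprm : ∀ {i a : ℕ} {σ : ℕ → ℕ}, i < 64 → M i = a → (param i).eval w M σ = a :=
    fun hi e => eval_param (by omega) e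
  have hlit : ∀ {i : ℕ} {σ : ℕ → ℕ}, i < 64 → (OfNat.ofNat i : Expr).eval w M σ = i :=
    fun hi => Expr.eval_lit _ (by omega)
  set B := #{j ∈ range m | hi j ≤ d} with hB
  set A := #{j ∈ range m | hi j < d} with hA
  have hAB : A ≤ B := card_le_card fun j hj => by
    rw [mem_filter] at hj ⊢
    exact ⟨hj.1, hj.2.le⟩
  have r₁ := Runs.line_assign (d := 9) (eval_spread h hw hsw (Expr.eval_var (σ := σ) 6 h6) hV.lt)
  set Z := pack (s + 1) s fun i => #{j ∈ range (i + 1) | V.testBit j = false} with hZ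
  set σ₁ := Function.update σ 9 Z with hσ₁
  have z₁ : (Expr.var 9).eval w M σ₁ = Z := Expr.eval_var 9 (by simp [hσ₁])
  have d₁ : (Expr.var 8).eval w M σ₁ = d := Expr.eval_var 8 (by simp [hσ₁, h8])
  have r₂ := Runs.line_assign (d := 10) (eval_bucketEnd h hw hs hsw hV z₁ d₁ hd)
  rw [← hB] at r₂
  set σ₂ := Function.update σ₁ 10 B with hσ₂
  have z₂ : (Expr.var 9).eval w M σ₂ = Z := Expr.eval_var 9 (by simp [hσ₂, hσ₁])
  have d₂ : (Expr.var 8).eval w M σ₂ = d := Expr.eval_var 8 (by simp [hσ₂, hσ₁, h8])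
  have eA : (Expr.ite 0 (.var 8) (fieldCount (.var 9) (.var 8 - 1) - (.var 8 - 1)) 0).eval w M σ₂ =
      A := by
    refine Expr.eval_ite (hlit (i := 0) (by norm_num)) d₂ (fun hpos => ?_) (fun hpos => ?_)
    · have e : A = #{j ∈ range m | hi j ≤ d - 1} := by
        rw [hA]
        exact congrArg card (filter_congr fun j _ => by omega)
      rw [e]
      refine eval_bucketEnd h hw hs hsw hV z₂ (Expr.eval_sub d₂ (hlit (i := 1) (by norm_num))
        hpos (by omega)) (by omega)
    · have : A = 0 := by
        rw [hA, card_eq_zero, filter_eq_empty_iff]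
        intro j _
        omega
      rw [this]
      exact hlit (i := 0) (by norm_num)
  have r₃ := Runs.line_assign (d := 11) eA
  set σ₃ := Function.update σ₂ 11 A with hσ₃
  have a₃ : (Expr.var 11).eval w M σ₃ = A := Expr.eval_var 11 (by simp [hσ₃])
  have b₃ : (Expr.var 10).eval w M σ₃ = B := Expr.eval_var 10 (by simp [hσ₃, hσ₂])
  have l₃ : (Expr.var 7).eval w M σ₃ = pack (l + 1) t lo :=
    Expr.eval_var 7 (by simp [hσ₃, hσ₂, hσ₁, h7])
  have x₃ : (Expr.var 0).eval w M σ₃ = x := Expr.eval_var 0 (by simp [hσ₃, hσ₂, hσ₁, h0])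
  have hAt : (l + 1) * A < w := (Nat.mul_le_mul_left _ (hAB.trans ht)).trans_lt htw
  have hBt : (l + 1) * (B - A) < w :=
    (Nat.mul_le_mul_left _ ((Nat.sub_le _ _).trans ht)).trans_lt htw
  have e₁ := Expr.eval_sub b₃ a₃ hAB (by omega)
  have e₂ := Expr.eval_shr l₃ (Expr.eval_mul a₃ (hprm (by norm_num) h.field)
    (by rw [Nat.mul_comm]; omega))
  have hlo' : ∀ j, lo j < 2 ^ (l + 1) := fun j =>
    (hlo j).trans (Nat.pow_lt_pow_right (by norm_num) (by omega))
  rw [Nat.mul_comm A, pack_div (fun j _ => hlo' j) (hAB.trans ht)] at e₂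
  have hk : B - A ≤ 2 ^ l := by omega
  have hmaskE : (((1 : Expr) <<< ((.var 10 - .var 11) * param 22)) - 1).eval w M σ₃ =
      2 ^ ((l + 1) * (B - A)) - 1 := by
    have e₃ := Expr.eval_mul e₁ (hprm (σ := σ₃) (by norm_num) h.field)
      (by rw [Nat.mul_comm]; omega)
    rw [Nat.mul_comm (B - A)] at e₃
    have hlt : 2 ^ ((l + 1) * (B - A)) < 2 ^ w := Nat.pow_lt_pow_right (by norm_num) hBt
    have e₄ := Expr.eval_shl (hlit (i := 1) (by norm_num)) e₃ (by omega)
    rw [Nat.one_mul] at e₄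
    exact Expr.eval_sub e₄ (hlit (i := 1) (by norm_num)) Nat.one_le_two_pow hlt
  have e₃ := Expr.eval_mask e₂ hmaskE
  rw [pack_mod (fun j _ => hlo' _) (by omega)] at e₃
  have e₄ : pack (l + 1) (B - A) (fun i => lo (A + i)) =
      pack (l + 1) (2 ^ l) fun i => if i < B - A then lo (A + i) else 0 := by
    obtain ⟨r, hr⟩ := Nat.exists_eq_add_of_le hk
    rw [hr, pack_append, pack_congr (b := fun _ => 0) (s := r)]
    · rw [show pack (l + 1) r (fun _ => 0) = 0 by simp [pack], Nat.mul_zero, Nat.zero_add]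
      exact pack_congr fun i hi => (if_pos hi).symm
    · intro i _
      simp
  rw [e₄] at e₃
  have hl2 : 0 < 2 ^ l := by positivity
  have hl2' : 2 ^ (l + 1) = 2 * 2 ^ l := pow_succ' 2 l
  have e₅ : (lowCount ((Expr.var 7 >>> (.var 11 * param 22)) &&&
      (((1 : Expr) <<< ((.var 10 - .var 11) * param 22)) - 1)) (.var 0 &&& param 6)).eval w M σ₃ =
      #{i ∈ range (2 ^ l) | (if i < B - A then lo (A + i) else 0) ≤ x % 2 ^ l} :=
    Expr.eval_count hl2 hlw (by omega) (hprm (by norm_num) h.lowOnes)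
      (hprm (by norm_num) h.lowTops) (hprm (by norm_num) h.low) (hprm (by norm_num) h.lowLast)
      (hprm (by norm_num) h.fieldMask) e₃
      (Expr.eval_mask x₃ (hprm (by norm_num) h.lowMask))
      (fun i _ => by split_ifs; exacts [(hlo _).le, Nat.zero_le _]) (Nat.mod_lt _ hl2)
  rw [card_padded _ hk] at e₅
  set c := #{i ∈ range (B - A) | lo (A + i) ≤ x % 2 ^ l} with hc
  have hcB : c ≤ B - A := by
    simpa using card_filter_le (range (B - A)) fun i => lo (A + i) ≤ x % 2 ^ l
  have hl2w : 2 ^ l ≤ w := (Nat.le_mul_of_pos_left _ l.succ_pos).trans hlw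
  have e₆ := Expr.eval_add a₃ (Expr.eval_sub (Expr.eval_add e₅ e₁ (by omega))
    (hprm (by norm_num) h.lowNum) (by omega) (by omega)) (by omega)
  have r₄ := Runs.line_assign (d := 12) e₆
  refine ⟨_, r₁.line_seq (r₂.line_seq (r₃.line_seq r₄)), fun i hi => ?_, ?_⟩
  · rw [Function.update_of_ne (by omega), hσ₃, Function.update_of_ne (by omega), hσ₂,
      Function.update_of_ne (by omega), hσ₁, Function.update_of_ne (by omega)]
  · rw [Function.update_self, card_lex hV.mono hA hB]
    omega

end WordRAM

namespace WordRAM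
open Finset

/-! ### Encoding of a superblock -/

/-- Number of keys `z` in front of the block `q`. -/
def blockOffset (z : ℕ → ℕ) (ns l beta q : ℕ) : ℕ := #{t ∈ range ns | z t / 2 ^ l < q * 2 ^ beta}

/-- Low bits of the keys. -/
def lowPart (z : ℕ → ℕ) (ns l t : ℕ) : ℕ := if t < ns then z t % 2 ^ l else 0

/-- Bucket numbers of the keys relative to the block `q`. -/
def bucketNum (z : ℕ → ℕ) (ns l beta q j : ℕ) : ℕ :=
  z (blockOffset z ns l beta q + j) / 2 ^ l - q * 2 ^ beta

/-- Unary code of the bucket numbers. -/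
def unaryCode (z : ℕ → ℕ) (ns l : ℕ) : ℕ := ∑ t ∈ range ns, 2 ^ (z t / 2 ^ l + t)

/-- One more than the last key in front of the block `q`, or `0`. -/
def blockPrev (z : ℕ → ℕ) (ns l beta q : ℕ) : ℕ :=
  if blockOffset z ns l beta q = 0 then 0 else z (blockOffset z ns l beta q - 1) + 1

section Superblock

variable {z : ℕ → ℕ} {ns l beta q : ℕ}

theorem blockOffset_le : blockOffset z ns l beta q ≤ ns := by
  refine (card_filter_le _ _).trans ?_
  rw [card_range]

theorem lowPart_lt (t : ℕ) : lowPart z ns l t < 2 ^ l := by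
  have : 0 < 2 ^ l := by positivity
  rw [lowPart]
  split_ifs
  exacts [Nat.mod_lt _ this, this]

theorem lt_blockOffset_iff (hz : ∀ i j, i < j → j < ns → z i < z j) {t : ℕ} (ht : t < ns) :
    z t / 2 ^ l < q * 2 ^ beta ↔ t < blockOffset z ns l beta q := by
  have hr : {t ∈ range ns | z t / 2 ^ l < q * 2 ^ beta} = range (blockOffset z ns l beta q) :=
    eq_range_card fun a ha b hb => by
      rw [mem_filter, mem_range] at ha ⊢
      exact ⟨by omega, (Nat.div_le_div_right (hz b a hb ha.1).le).trans_lt ha.2⟩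
  rw [← mem_range (m := t), ← hr, mem_filter, mem_range]
  simp [ht]

theorem bucketNum_add (hz : ∀ i j, i < j → j < ns → z i < z j) {j : ℕ}
    (hj : blockOffset z ns l beta q + j < ns) :
    q * 2 ^ beta + bucketNum z ns l beta q j = z (blockOffset z ns l beta q + j) / 2 ^ l := by
  have := lt_blockOffset_iff (l := l) (beta := beta) (q := q) hz hj
  unfold bucketNum
  omega

theorem bucketNum_mono (hz : ∀ i j, i < j → j < ns → z i < z j) {i j : ℕ} (hij : i ≤ j)
    (hj : blockOffset z ns l beta q + j < ns) :
    bucketNum z ns l beta q i ≤ bucketNum z ns l beta q j := by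
  rcases hij.lt_or_eq with h | rfl
  · exact Nat.sub_le_sub_right (Nat.div_le_div_right (hz _ _ (by omega) hj).le) _
  · rfl

/-- In the code of the whole superblock, key `t` has its one at position `z t / 2 ^ l + t`. With `o`
keys before block `q`, cutting at `o + q * 2 ^ beta` drops exactly the ones of these keys and makes
index and bucket number relative to the block. -/
theorem isUnary_unaryCode (hz : ∀ i j, i < j → j < ns → z i < z j) (s : ℕ) :
    IsUnary s (ns - blockOffset z ns l beta q) (bucketNum z ns l beta q)
      (unaryCode z ns l / 2 ^ (blockOffset z ns l beta q + q * 2 ^ beta) % 2 ^ s) := by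
  refine ⟨fun i j hij hj => bucketNum_mono hz hij (by omega), Nat.mod_lt _ (by positivity),
    fun i hi => ?_⟩
  rw [Nat.testBit_mod_two_pow, Nat.testBit_div_two_pow, unaryCode]
  simp only [hi, decide_true, Bool.true_and]
  rw [testBit_sum_two_pow fun a b hab hb => by
    have : z a / 2 ^ l ≤ z b / 2 ^ l := Nat.div_le_div_right (hz a b hab hb).le
    omega]
  constructor
  · rintro ⟨t, ht, e⟩
    have h₁ := lt_blockOffset_iff (l := l) (beta := beta) (q := q) hz ht
    have h₂ : blockOffset z ns l beta q ≤ t := by omega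
    obtain ⟨j, rfl⟩ := Nat.exists_eq_add_of_le h₂
    have := bucketNum_add hz ht
    exact ⟨j, by omega, by omega⟩
  · rintro ⟨j, hj, e⟩
    have := bucketNum_add (l := l) (beta := beta) (q := q) hz (j := j) (by omega)
    exact ⟨blockOffset z ns l beta q + j, by omega, by rw [← this]; omega⟩

/-- Low parts are zero beyond the last key, so a window may extend past the end. -/
theorem pack_lowPart (o t : ℕ) :
    pack (l + 1) ns (lowPart z ns l) / 2 ^ ((l + 1) * o) % 2 ^ ((l + 1) * t) =
      pack (l + 1) t fun j => lowPart z ns l (o + j) := by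
  have hlt : ∀ j, lowPart z ns l j < 2 ^ (l + 1) := fun j =>
    (lowPart_lt j).trans (Nat.pow_lt_pow_right (by norm_num) (by omega))
  have e : pack (l + 1) (ns + (o + t)) (lowPart z ns l) = pack (l + 1) ns (lowPart z ns l) := by
    rw [pack_append, pack_congr (b := fun _ => 0) (s := o + t)]
    · simp [pack]
    · intro i _
      simp [lowPart]
  rw [← e, pack_div (fun i _ => hlt i) (by omega), pack_mod (fun i _ => hlt _) (by omega)]

/-- The keys counted are distinct and lie in the interval of length `2 ^ (beta + l)` covered by the
block. -/
theorem card_bucketNum_le (hz : ∀ i j, i < j → j < ns → z i < z j) {d : ℕ} (hd : d < 2 ^ beta) :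
    #{j ∈ range (ns - blockOffset z ns l beta q) | bucketNum z ns l beta q j ≤ d} ≤
      2 ^ (beta + l) := by
  set o := blockOffset z ns l beta q with ho
  have hpos : 0 < 2 ^ l := by positivity
  have : #(Ico (q * 2 ^ beta * 2 ^ l) (q * 2 ^ beta * 2 ^ l + 2 ^ (beta + l))) =
      2 ^ (beta + l) := by
    simp
  refine le_of_le_of_eq ?_ this
  refine card_le_card_of_injOn (fun j => z (o + j)) (fun j hj => ?_) fun a ha b hb hab => ?_
  · simp only [coe_filter, mem_range, Set.mem_ofPred_eq] at hj
    have e := bucketNum_add (l := l) (beta := beta) (q := q) hz (j := j) (by omega)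
    rw [← ho] at e
    rw [coe_Ico, Set.mem_Ico]
    dsimp only
    constructor
    · exact (Nat.le_div_iff_mul_le hpos).1 (by omega)
    · rw [pow_add, ← Nat.add_mul]
      exact (Nat.div_lt_iff_lt_mul hpos).1 (by omega)
  · simp only [coe_filter, mem_range, Set.mem_ofPred_eq] at ha hb
    rcases lt_trichotomy a b with h | h | h
    · exact absurd hab (hz (o + a) (o + b) (by omega) (by omega)).ne
    · exact h
    · exact absurd hab (hz (o + b) (o + a) (by omega) (by omega)).ne'

/-- Keys in the same bucket differ in their low `l` bits. -/
theorem card_bucket_le (hz : ∀ i j, i < j → j < ns → z i < z j) (d : ℕ) :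
    #{j ∈ range (ns - blockOffset z ns l beta q) | bucketNum z ns l beta q j ≤ d} ≤
      #{j ∈ range (ns - blockOffset z ns l beta q) | bucketNum z ns l beta q j < d} + 2 ^ l := by
  set o := blockOffset z ns l beta q with ho
  have hpos : 0 < 2 ^ l := by positivity
  have hsub : {j ∈ range (ns - o) | bucketNum z ns l beta q j ≤ d} ⊆
      {j ∈ range (ns - o) | bucketNum z ns l beta q j < d} ∪
        {j ∈ range (ns - o) | bucketNum z ns l beta q j = d} := by
    intro j hj
    rw [mem_union, mem_filter, mem_filter]
    rw [mem_filter] at hj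
    rcases hj.2.lt_or_eq with h | h
    exacts [.inl ⟨hj.1, h⟩, .inr ⟨hj.1, h⟩]
  refine (card_le_card hsub).trans ((card_union_le _ _).trans (Nat.add_le_add_left ?_ _))
  have : #(range (2 ^ l)) = 2 ^ l := by simp
  refine le_of_le_of_eq ?_ this
  refine card_le_card_of_injOn (fun j => z (o + j) % 2 ^ l) (fun j hj => ?_) fun a ha b hb hab => ?_
  · rw [coe_range, Set.mem_Iio]
    exact Nat.mod_lt _ hpos
  · simp only [coe_filter, mem_range, Set.mem_ofPred_eq] at ha hb
    have e₁ := bucketNum_add (l := l) (beta := beta) (q := q) hz (j := a) (by omega)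
    have e₂ := bucketNum_add (l := l) (beta := beta) (q := q) hz (j := b) (by omega)
    rw [← ho] at e₁ e₂
    have e : z (o + a) = z (o + b) := by
      rw [← Nat.div_add_mod (z (o + a)) (2 ^ l), ← Nat.div_add_mod (z (o + b)) (2 ^ l), ← e₁, ← e₂,
        ha.2, hb.2]
      dsimp only at hab
      rw [hab]
    rcases lt_trichotomy a b with h | h | h
    · exact absurd e (hz (o + a) (o + b) (by omega) (by omega)).ne
    · exact h
    · exact absurd e (hz (o + b) (o + a) (by omega) (by omega)).ne'

theorem le_iff_div_mod {a b d : ℕ} :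
    a ≤ b ↔ a / d < b / d ∨ a / d = b / d ∧ a % d ≤ b % d := by
  constructor
  · intro h
    rcases (Nat.div_le_div_right (c := d) h).lt_or_eq with h' | h'
    · exact .inl h'
    · exact .inr ⟨h', (mod_le_mod_iff h').2 h⟩
  · rintro (h | ⟨h, h'⟩)
    · by_contra hc
      have := Nat.div_le_div_right (c := d) (Nat.le_of_not_le hc)
      omega
    · exact (mod_le_mod_iff h).1 h'

theorem card_le_eq_block (hz : ∀ i j, i < j → j < ns → z i < z j) {x d : ℕ}
    (hx : x / 2 ^ l = q * 2 ^ beta + d) :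
    #{t ∈ range ns | z t ≤ x} = blockOffset z ns l beta q +
      #{j ∈ range (ns - blockOffset z ns l beta q) | bucketNum z ns l beta q j < d ∨
        bucketNum z ns l beta q j = d ∧
          lowPart z ns l (blockOffset z ns l beta q + j) ≤ x % 2 ^ l} := by
  set o := blockOffset z ns l beta q with ho
  have hons : o ≤ ns := blockOffset_le
  obtain ⟨m, hm⟩ := Nat.exists_eq_add_of_le hons
  have h₁ : ∑ t ∈ range o, (if z t ≤ x then 1 else 0) = o := by
    rw [sum_congr rfl (g := fun _ => 1)]
    · simp
    · intro t ht
      rw [mem_range] at ht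
      have := (lt_blockOffset_iff (l := l) (beta := beta) (q := q) hz (t := t) (by omega)).2 ht
      rw [if_pos ((le_iff_div_mod (d := 2 ^ l)).2 (.inl (by omega)))]
  have hs : ∀ f : ℕ → ℕ, ∑ t ∈ range ns, f t = ∑ t ∈ range o, f t +
      ∑ j ∈ range (ns - o), f (o + j) := fun f => by
    rw [← sum_range_add, Nat.add_sub_cancel' hons]
  rw [card_filter, hs, h₁, card_filter]
  refine congrArg (o + ·) (sum_congr rfl fun j hj => if_congr ?_ rfl rfl)
  rw [mem_range] at hj
  have e := bucketNum_add (l := l) (beta := beta) (q := q) hz (j := j) (by omega)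
  rw [← ho] at e
  rw [le_iff_div_mod (d := 2 ^ l), lowPart, if_pos (by omega), ← e, hx]
  omega

end Superblock

end WordRAM

/-! ### Loading a block and composing the answer. -/

namespace WordRAM
open Finset

def superStart : Expr := (Expr.var 0 >>> param 2) <<< param 2

def blockField (k : ℕ) : Expr := (Expr.read (.var 2 + .const k) >>> (.var 4 * param 7)) &&& param 8

/-- Variable `2` is the address of the superblock record, `3` the query without its low bits, `4`
the block, `5` the number of keys before the block in the superblock, `6` and `7` the unary code and
the low parts from there on, and `8` the bucket within the block. -/
def denseLoad : Cmd :=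
  .seq (.assign 2 (.read (25 + (Expr.var 0 >>> param 2))))
    (.seq (.assign 3 (Expr.var 0 >>> param 1))
      (.seq (.assign 4 ((Expr.var 3 >>> param 3) &&& param 4))
        (.seq (.assign 5 (blockField 2))
          (.seq (.assign 6 (Expr.window (param 24) (.var 2 + 5)
              (.var 5 + (Expr.var 4 <<< param 3)) (param 16)))
            (.seq (.assign 7 (Expr.window (param 24) (.read (.var 2 + 4)) (param 22 * .var 5)
                (param 17)))
              (.assign 8 (.var 3 &&& param 5)))))))

def denseKey : Expr :=
  superStart + (((Expr.var 4 <<< param 3) +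
    (fieldCount (spread (param 16 - .var 6)) (.var 12 - 1) - (.var 12 - 1))) <<< param 1) +
      ((Expr.var 7 >>> (param 22 * (.var 12 - 1))) &&& param 21)

/-- The predecessor lies in the block, or is the last key before the block in the same superblock,
or the last key before the superblock. The field of the second kind holds a key plus one, so that
`0` can signal the third case. -/
def denseFinish : Cmd :=
  .seq (.assign 1 (.read (.var 2) + (.var 5 + .var 12)))
    (.assign 0 (.ite 0 (.var 12) denseKey
      (.ite 0 (blockField 3) (superStart + (blockField 3 - 1)) (.read (.var 2 + 1)))))

/-- Search in the structure for dense sets. -/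
def denseSearch : Cmd := .seq denseLoad (.seq denseRank denseFinish)

/-- The memory contains at `P` the record of a superblock with keys `z`. -/
structure HasSuper (w l lam beta : ℕ) (z : ℕ → ℕ) (ns P R prev : ℕ) (M : ℕ → ℕ) : Prop where
  rank : M P = R
  prev : M (P + 1) = prev
  offsets : M (P + 2) = pack (2 * lam) (2 ^ (lam - beta)) (blockOffset z ns l beta)
  prevs : M (P + 3) = pack (2 * lam) (2 ^ (lam - beta)) (blockPrev z ns l beta)
  lows : ∃ L, M (P + 4) = L ∧ L + (l + 1) * ns / w + 1 < 2 ^ w ∧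
    ∀ i ≤ (l + 1) * ns / w + 1, M (L + i) =
      pack (l + 1) ns (lowPart z ns l) / 2 ^ (w * i) % 2 ^ w
  unary : ∀ i ≤ (ns + 2 ^ lam) / w + 1, M (P + 5 + i) = unaryCode z ns l / 2 ^ (w * i) % 2 ^ w
  lt : P + 5 + (ns + 2 ^ lam) / w + 1 < 2 ^ w

/-- Size constraints of the structure for dense sets. -/
structure DenseBounds (w l lam beta s : ℕ) : Prop where
  word : 64 ≤ w
  bits : s = 2 ^ (beta + l + 1)
  spread_le : (s + 1) * s ≤ w
  lows_lt : (l + 1) * 2 ^ (beta + l) < w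
  low_le : (l + 1) * 2 ^ l ≤ w
  block_le : beta ≤ lam
  low_lt : l < lam
  offsets_le : 2 * lam * 2 ^ (lam - beta) ≤ w
  log_le : 4 * lam ≤ w

theorem block_split {x l lam beta : ℕ} (h : beta ≤ lam) :
    x % 2 ^ (l + lam) / 2 ^ l =
      x / 2 ^ l / 2 ^ beta % 2 ^ (lam - beta) * 2 ^ beta + x / 2 ^ l % 2 ^ beta := by
  rw [pow_add, Nat.mod_mul_right_div_self, show 2 ^ lam = 2 ^ beta * 2 ^ (lam - beta) by
    rw [← pow_add]; congr 1; omega, Nat.mod_mul, Nat.add_comm, Nat.mul_comm]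

section

variable {w l lam beta s : ℕ} {M σ : ℕ → ℕ} {z : ℕ → ℕ} {ns P R prev x : ℕ}

theorem eval_blockField (hb : DenseBounds w l lam beta s) (h : HasDenseParams w l lam beta s M)
    {k q : ℕ} {a : ℕ → ℕ} (h2 : σ 2 = P) (h4 : σ 4 = q) (hk : P + k < 2 ^ w)
    (hM : M (P + k) = pack (2 * lam) (2 ^ (lam - beta)) a) (hq : q < 2 ^ (lam - beta))
    (ha : ∀ i, a i < 2 ^ (2 * lam)) : (blockField k).eval w M σ = a q := by
  have hww : w < 2 ^ w := Nat.lt_two_pow_self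
  have hw := hb.word
  have hql : q * (2 * lam) ≤ w := by
    rw [Nat.mul_comm]
    exact (Nat.mul_le_mul_left _ hq.le).trans hb.offsets_le
  have e := Expr.eval_mask (Expr.eval_shr (Expr.eval_read (Expr.eval_add (Expr.eval_var 2 h2)
    (show (Expr.const k).eval w M σ = k from Nat.mod_eq_of_lt (by omega)) hk) hM)
    (Expr.eval_mul (Expr.eval_var 4 h4) (eval_param (by omega) h.offset) (by omega)))
    (eval_param (by omega) h.offsetMask)
  rw [blockField, e, Nat.mul_comm q, pack_field (fun i _ => ha i) hq]

theorem runs_denseLoad (hb : DenseBounds w l lam beta s) (h : HasDenseParams w l lam beta s M)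
    (hx : x < 2 ^ w) (h0 : σ 0 = x) (hdir : 25 + x / 2 ^ (l + lam) < 2 ^ w)
    (hP : M (25 + x / 2 ^ (l + lam)) = P) (hs : HasSuper w l lam beta z ns P R prev M)
    (hns : ns ≤ 2 ^ (l + lam)) {q : ℕ} (hq : q = x / 2 ^ l / 2 ^ beta % 2 ^ (lam - beta)) :
    ∃ σ', Runs w M denseLoad σ σ' denseLoad.lineCost ∧ σ' 0 = x ∧ σ' 2 = P ∧ σ' 4 = q ∧
      σ' 5 = blockOffset z ns l beta q ∧
      σ' 6 = unaryCode z ns l / 2 ^ (blockOffset z ns l beta q + q * 2 ^ beta) % 2 ^ s ∧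
      σ' 7 = (pack (l + 1) (2 ^ (beta + l)) fun j =>
        lowPart z ns l (blockOffset z ns l beta q + j)) ∧
      σ' 8 = x / 2 ^ l % 2 ^ beta := by
  have hww : w < 2 ^ w := Nat.lt_two_pow_self
  have hw := hb.word
  have hll := hb.low_lt
  have hlog := hb.log_le
  have hsw : s ≤ w := (Nat.le_mul_of_pos_left s s.succ_pos).trans hb.spread_le
  have hprm : ∀ {i a : ℕ} {σ : ℕ → ℕ}, i < 64 → M i = a → (param i).eval w M σ = a :=
    fun hi e => eval_param (by omega) e
  have hlit : ∀ {i : ℕ} {σ : ℕ → ℕ}, i < 64 → (OfNat.ofNat i : Expr).eval w M σ = i :=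
    fun hi => Expr.eval_lit _ (by omega)
  have hq' : q < 2 ^ (lam - beta) := hq ▸ Nat.mod_lt _ (by positivity)
  have hqb : q * 2 ^ beta ≤ 2 ^ lam := by
    rw [show 2 ^ lam = 2 ^ (lam - beta) * 2 ^ beta by
      rw [← pow_add, Nat.sub_add_cancel hb.block_le]]
    exact Nat.mul_le_mul_right _ hq'.le
  have hp₁ : 2 ^ (l + lam) < 2 ^ (2 * lam) := Nat.pow_lt_pow_right (by norm_num) (by omega)
  have hp₂ : 2 ^ (2 * lam) * 2 ^ lam ≤ 2 ^ w := by
    rw [← pow_add]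
    exact Nat.pow_le_pow_right (by norm_num) (by omega)
  have hp₃ : l + 1 ≤ 2 ^ lam := (Nat.succ_le_of_lt hll).trans Nat.lt_two_pow_self.le
  have hp₄ : 2 ^ lam ≤ 2 ^ (2 * lam) := Nat.pow_le_pow_right (by norm_num) (by omega)
  have hp₅ : 4 * 2 ^ (2 * lam) ≤ 2 ^ w := by
    rw [show 4 = 2 ^ 2 by norm_num, ← pow_add]
    exact Nat.pow_le_pow_right (by norm_num) (by omega)
  have hPw := hs.lt
  have hd₁ : 0 ≤ (ns + 2 ^ lam) / w := Nat.zero_le _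
  have hd₂ : 0 ≤ (l + 1) * ns / w := Nat.zero_le _
  set o := blockOffset z ns l beta q with ho
  have hons : o ≤ ns := blockOffset_le
  have r₁ := Runs.line_assign (d := 2) (Expr.eval_read (Expr.eval_add (hlit (i := 25) (σ := σ)
    (by norm_num)) (Expr.eval_shr (Expr.eval_var 0 h0) (hprm (by norm_num) h.super)) hdir) hP)
  set σ₁ := Function.update σ 2 P with hσ₁
  have r₂ := Runs.line_assign (d := 3) (Expr.eval_shr (Expr.eval_var (σ := σ₁) (x := x) 0
    (by simp [hσ₁, h0])) (hprm (by norm_num) h.low))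
  set σ₂ := Function.update σ₁ 3 (x / 2 ^ l) with hσ₂
  have r₃ := Runs.line_assign (d := 4) (Expr.eval_mask (Expr.eval_shr (Expr.eval_var (σ := σ₂)
    (x := x / 2 ^ l) 3 (by simp [hσ₂])) (hprm (by norm_num) h.block)) (hprm (by norm_num) h.blocks))
  rw [← hq] at r₃
  set σ₃ := Function.update σ₂ 4 q with hσ₃
  have r₄ := Runs.line_assign (d := 5) (eval_blockField (σ := σ₃) (P := P) (k := 2) (q := q) hb h
    (by simp [hσ₃, hσ₂, hσ₁]) (by simp [hσ₃]) (by omega) hs.offsets hq'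
    fun i => blockOffset_le.trans_lt (by omega))
  rw [← ho] at r₄
  set σ₄ := Function.update σ₃ 5 o with hσ₄
  have h42 : σ₄ 2 = P := by simp [hσ₄, hσ₃, hσ₂, hσ₁]
  have hpos : o + q * 2 ^ beta ≤ ns + 2 ^ lam := by omega
  have hidx : (o + q * 2 ^ beta) / w ≤ (ns + 2 ^ lam) / w := Nat.div_le_div_right hpos
  have r₅ := Runs.line_assign (d := 6) (Expr.eval_window (σ := σ₄) (N := unaryCode z ns l)
    (B := P + 5) (v := o + q * 2 ^ beta) (len := s) (by omega) (hprm (by norm_num) h.word)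
    (Expr.eval_add (Expr.eval_var 2 h42) (hlit (i := 5) (by norm_num)) (by omega))
    (Expr.eval_add (Expr.eval_var 5 (by simp [hσ₄])) (Expr.eval_shl (Expr.eval_var (x := q) 4
      (by simp [hσ₄, hσ₃])) (hprm (by norm_num) h.block) (by omega)) (by omega))
    (hprm (by norm_num) h.bitsMask) hsw (by omega) (by omega)
    (hs.unary _ (by omega)) (by rw [Nat.add_assoc (P + 5)]; exact hs.unary _ (by omega)))
  set V := unaryCode z ns l / 2 ^ (o + q * 2 ^ beta) % 2 ^ s with hV
  set σ₅ := Function.update σ₄ 6 V with hσ₅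
  have h52 : σ₅ 2 = P := by simp [hσ₅, h42]
  obtain ⟨L, hL, hLw, hLM⟩ := hs.lows
  have hol : (l + 1) * o ≤ (l + 1) * ns := Nat.mul_le_mul_left _ hons
  have holw : (l + 1) * ns < 2 ^ w := by
    calc (l + 1) * ns ≤ 2 ^ lam * 2 ^ (l + lam) := Nat.mul_le_mul hp₃ hns
      _ < 2 ^ lam * 2 ^ (2 * lam) := Nat.mul_lt_mul_of_pos_left hp₁ (by positivity)
      _ ≤ 2 ^ w := by rw [Nat.mul_comm]; exact hp₂
  have hidx' : (l + 1) * o / w ≤ (l + 1) * ns / w := Nat.div_le_div_right hol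
  have r₆ := Runs.line_assign (d := 7) (Expr.eval_window (σ := σ₅)
    (N := pack (l + 1) ns (lowPart z ns l)) (B := L) (v := (l + 1) * o)
    (len := (l + 1) * 2 ^ (beta + l)) (by omega) (hprm (by norm_num) h.word)
    (Expr.eval_read (Expr.eval_add (Expr.eval_var 2 h52) (hlit (i := 4) (by norm_num))
      (by omega)) hL)
    (Expr.eval_mul (hprm (by norm_num) h.field) (Expr.eval_var 5 (by simp [hσ₅, hσ₄])) (by omega))
    (hprm (by norm_num) h.lowsMask) hb.lows_lt.le (by omega) (by omega)
    (hLM _ (by omega)) (by rw [Nat.add_assoc L]; exact hLM _ (by omega)))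
  rw [pack_lowPart] at r₆
  set W := pack (l + 1) (2 ^ (beta + l)) fun j => lowPart z ns l (o + j) with hW
  set σ₆ := Function.update σ₅ 7 W with hσ₆
  have r₇ := Runs.line_assign (d := 8) (Expr.eval_mask (Expr.eval_var (σ := σ₆)
    (x := x / 2 ^ l) 3 (by simp [hσ₆, hσ₅, hσ₄, hσ₃, hσ₂])) (hprm (by norm_num) h.bucket))
  refine ⟨_, r₁.line_seq (r₂.line_seq (r₃.line_seq (r₄.line_seq (r₅.line_seq
    (r₆.line_seq r₇))))), ?_⟩
  simp [hσ₆, hσ₅, hσ₄, hσ₃, hσ₂, hσ₁, h0]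

theorem runs_denseFinish (hb : DenseBounds w l lam beta s) (h : HasDenseParams w l lam beta s M)
    (hx : x < 2 ^ w) (h0 : σ 0 = x) (hs : HasSuper w l lam beta z ns P R prev M)
    (hns : ns ≤ 2 ^ (l + lam)) (hR : R + ns < 2 ^ w)
    (hz : ∀ i j, i < j → j < ns → z i < z j) (hzlt : ∀ t < ns, z t < 2 ^ (l + lam))
    {q : ℕ} (hq : q = x / 2 ^ l / 2 ^ beta % 2 ^ (lam - beta)) (h2 : σ 2 = P) (h4 : σ 4 = q)
    (h5 : σ 5 = blockOffset z ns l beta q)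
    (h6 : σ 6 = unaryCode z ns l / 2 ^ (blockOffset z ns l beta q + q * 2 ^ beta) % 2 ^ s)
    (h7 : σ 7 = (pack (l + 1) (2 ^ (beta + l)) fun j =>
        lowPart z ns l (blockOffset z ns l beta q + j))) {cnt : ℕ} (h12 : σ 12 = cnt)
    (hcnt : blockOffset z ns l beta q + cnt = #{t ∈ range ns | z t ≤ x % 2 ^ (l + lam)})
    (hcnt' : cnt ≤ 2 ^ (beta + l)) :
    ∃ σ', Runs w M denseFinish σ σ' denseFinish.lineCost ∧
      σ' 0 = (if #{t ∈ range ns | z t ≤ x % 2 ^ (l + lam)} = 0 then prev else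
        x / 2 ^ (l + lam) * 2 ^ (l + lam) + z (#{t ∈ range ns | z t ≤ x % 2 ^ (l + lam)} - 1)) ∧
      σ' 1 = R + #{t ∈ range ns | z t ≤ x % 2 ^ (l + lam)} := by
  have hww : w < 2 ^ w := Nat.lt_two_pow_self
  have hw := hb.word
  have hll := hb.low_lt
  have hlog := hb.log_le
  have hsw : s ≤ w := (Nat.le_mul_of_pos_left s s.succ_pos).trans hb.spread_le
  have hprm : ∀ {i a : ℕ} {σ : ℕ → ℕ}, i < 64 → M i = a → (param i).eval w M σ = a :=
    fun hi e => eval_param (by omega) e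
  have hlit : ∀ {i : ℕ} {σ : ℕ → ℕ}, i < 64 → (OfNat.ofNat i : Expr).eval w M σ = i :=
    fun hi => Expr.eval_lit _ (by omega)
  have hq' : q < 2 ^ (lam - beta) := hq ▸ Nat.mod_lt _ (by positivity)
  have hsplit := block_split (x := x) (l := l) hb.block_le
  rw [← hq] at hsplit
  have hd : x / 2 ^ l % 2 ^ beta < 2 ^ beta := Nat.mod_lt _ (by positivity)
  have hPw := hs.lt
  have hd₁ : 0 ≤ (ns + 2 ^ lam) / w := Nat.zero_le _
  have hp₁ : 2 ^ (l + lam) < 2 ^ (2 * lam) := Nat.pow_lt_pow_right (by norm_num) (by omega)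
  have hp₅ : 4 * 2 ^ (2 * lam) ≤ 2 ^ w := by
    rw [show 4 = 2 ^ 2 by norm_num, ← pow_add]
    exact Nat.pow_le_pow_right (by norm_num) (by omega)
  have hss : s = 2 * 2 ^ (beta + l) := by rw [hb.bits, pow_succ']
  have hbT : 2 ^ beta ≤ 2 ^ (beta + l) := Nat.pow_le_pow_right (by norm_num) (by omega)
  set C := #{t ∈ range ns | z t ≤ x % 2 ^ (l + lam)} with hC
  set o := blockOffset z ns l beta q with ho
  have hCr : {t ∈ range ns | z t ≤ x % 2 ^ (l + lam)} = range C := eq_range_card fun a ha b hb => by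
    rw [mem_filter, mem_range] at ha ⊢
    exact ⟨by omega, (hz b a hb ha.1).le.trans ha.2⟩
  have hCiff : ∀ t < C, t < ns ∧ z t ≤ x % 2 ^ (l + lam) := fun t ht => by
    rw [← mem_range, ← hCr, mem_filter, mem_range] at ht
    exact ht
  have hCns : C ≤ ns := by
    simpa using card_filter_le (range ns) fun t => z t ≤ x % 2 ^ (l + lam)
  have hx' := Nat.div_add_mod' x (2 ^ (l + lam))
  have r₁ := Runs.line_assign (d := 1) (Expr.eval_add (Expr.eval_read
    (Expr.eval_var (w := w) (σ := σ) 2 h2) hs.rank)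
    (Expr.eval_add (Expr.eval_var 5 h5) (Expr.eval_var 12 h12) (by omega)) (by omega))
  rw [hcnt] at r₁
  set σ₁ := Function.update σ 1 (R + C) with hσ₁
  have h12' : (Expr.var 12).eval w M σ₁ = cnt := Expr.eval_var 12 (by simp [hσ₁, h12])
  have x₁ : (Expr.var 0).eval w M σ₁ = x := Expr.eval_var 0 (by simp [hσ₁, h0])
  have q₁ : (Expr.var 4).eval w M σ₁ = q := Expr.eval_var 4 (by simp [hσ₁, h4])
  have eS : superStart.eval w M σ₁ = x / 2 ^ (l + lam) * 2 ^ (l + lam) :=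
    Expr.eval_shl (Expr.eval_shr x₁ (hprm (by norm_num) h.super)) (hprm (by norm_num) h.super)
      (by omega)
  have eF := eval_blockField (σ := σ₁) (P := P) (k := 3) (q := q) hb h (by simp [hσ₁, h2])
    (by simp [hσ₁, h4]) (by omega) hs.prevs hq' fun i => by
      rw [blockPrev]
      split_ifs with h'
      · positivity
      · have h₁ := blockOffset_le (z := z) (ns := ns) (l := l) (beta := beta) (q := i)
        have h₂ := hzlt (blockOffset z ns l beta i - 1) (by omega)
        omega
  have hfinal : (Expr.ite 0 (.var 12) denseKey (.ite 0 (blockField 3)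
      (superStart + (blockField 3 - 1)) (.read (.var 2 + 1)))).eval w M σ₁ =
      if C = 0 then prev else x / 2 ^ (l + lam) * 2 ^ (l + lam) + z (C - 1) := by
    refine Expr.eval_ite (hlit (i := 0) (by norm_num)) h12' (fun hpos => ?_) (fun hpos => ?_)
    · rw [if_neg (by omega)]
      obtain ⟨j, rfl⟩ : ∃ j, cnt = j + 1 := ⟨cnt - 1, by omega⟩
      obtain ⟨h₁, h₂⟩ := hCiff (o + j) (by omega)
      rw [show C - 1 = o + j by omega]
      have e₁ := Expr.eval_sub h12' (hlit (i := 1) (by norm_num)) (by omega) (by omega)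
      rw [Nat.add_sub_cancel] at e₁
      have hadd := bucketNum_add (l := l) (beta := beta) (q := q) hz (j := j) (by omega)
      rw [← ho] at hadd
      have h₃ : z (o + j) / 2 ^ l ≤ x % 2 ^ (l + lam) / 2 ^ l := Nat.div_le_div_right h₂
      have h₄ := Nat.div_add_mod' (z (o + j)) (2 ^ l)
      have h₅ : z (o + j) / 2 ^ l ≤ z (o + j) := Nat.div_le_self _ _
      have hzj := hzlt (o + j) h₁
      have e₂ := eval_bucketOf h hw (by rw [hss]; positivity) hb.spread_le
        (isUnary_unaryCode (l := l) (beta := beta) (q := q) hz s)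
        (Expr.eval_var (σ := σ₁) 6 (by simp [hσ₁, h6, ho])) e₁ (by omega)
        (by omega)
      have e₃ := Expr.eval_shl (Expr.eval_add (Expr.eval_shl q₁ (hprm (by norm_num) h.block)
        (by omega)) e₂ (by omega)) (hprm (by norm_num) h.low) (by rw [hadd]; omega)
      rw [hadd] at e₃
      have hjw : (l + 1) * j ≤ w := (Nat.mul_le_mul_left _ (by omega)).trans hb.lows_lt.le
      have e₄ := Expr.eval_mask (Expr.eval_shr (Expr.eval_var (σ := σ₁) 7 (by simp [hσ₁, h7]; rfl))
        (Expr.eval_mul (hprm (by norm_num) h.field) e₁ (by omega)))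
        (hprm (by norm_num) h.fieldMask)
      rw [pack_field (fun i _ => (lowPart_lt _).trans (Nat.pow_lt_pow_right (by norm_num)
        (by omega))) (by omega), lowPart, if_pos h₁] at e₄
      have e₅ := Expr.eval_add (Expr.eval_add eS e₃ (by omega)) e₄ (by omega)
      rw [denseKey, e₅]
      omega
    · have hoC : o = C := by omega
      refine Expr.eval_ite (hlit (i := 0) (by norm_num)) eF (fun hpos' => ?_) (fun hpos' => ?_)
      · rw [blockPrev, ← ho, hoC] at hpos' eF
        have hne : C ≠ 0 := by
          rintro h'
          rw [if_pos h'] at hpos'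
          omega
        rw [if_neg hne] at eF ⊢
        obtain ⟨h₁, h₂⟩ := hCiff (C - 1) (by omega)
        have hzj := hzlt (C - 1) h₁
        exact Expr.eval_add eS (Expr.eval_sub eF (hlit (i := 1) (by norm_num)) (by omega)
          (by omega)) (by omega)
      · rw [blockPrev, ← ho, hoC] at hpos'
        have hC0 : C = 0 := by
          by_contra h'
          rw [if_neg h'] at hpos'
          omega
        rw [if_pos hC0]
        exact Expr.eval_read (Expr.eval_add (Expr.eval_var (x := P) 2 (by simp [hσ₁, h2]))
          (hlit (i := 1) (by norm_num)) (by omega)) hs.prev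
  have r₂ := Runs.line_assign (d := 0) hfinal
  refine ⟨_, r₁.line_seq r₂, by simp, by simp [hσ₁]⟩

end

end WordRAM

/-! ### The query for dense sets, its records and its parameters. -/

namespace WordRAM
open Finset

theorem runs_denseSearch {w l lam beta s : ℕ} {M : ℕ → ℕ} {z : ℕ → ℕ} {ns P R prev x : ℕ}
    (hb : DenseBounds w l lam beta s) (h : HasDenseParams w l lam beta s M)
    (hx : x < 2 ^ w) (hdir : 25 + x / 2 ^ (l + lam) < 2 ^ w)
    (hP : M (25 + x / 2 ^ (l + lam)) = P) (hs : HasSuper w l lam beta z ns P R prev M)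
    (hns : ns ≤ 2 ^ (l + lam)) (hR : R + ns < 2 ^ w)
    (hz : ∀ i j, i < j → j < ns → z i < z j) (hzlt : ∀ t < ns, z t < 2 ^ (l + lam)) :
    ∃ σ', Runs w M denseSearch (start x) σ' denseSearch.lineCost ∧
      σ' 0 = (if #{t ∈ range ns | z t ≤ x % 2 ^ (l + lam)} = 0 then prev else
        x / 2 ^ (l + lam) * 2 ^ (l + lam) + z (#{t ∈ range ns | z t ≤ x % 2 ^ (l + lam)} - 1)) ∧
      σ' 1 = R + #{t ∈ range ns | z t ≤ x % 2 ^ (l + lam)} := by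
  obtain ⟨q, hq⟩ : ∃ q, q = x / 2 ^ l / 2 ^ beta % 2 ^ (lam - beta) := ⟨_, rfl⟩
  obtain ⟨σ₁, r₁, h0, h2, h4, h5, h6, h7, h8⟩ := runs_denseLoad (σ := start x) hb h hx
    (by simp [start]) hdir hP hs hns hq
  have hd : x / 2 ^ l % 2 ^ beta < 2 ^ beta := Nat.mod_lt _ (by positivity)
  have hsplit := block_split (x := x) (l := l) hb.block_le
  rw [← hq] at hsplit
  have hss : s = 2 * 2 ^ (beta + l) := by rw [hb.bits, pow_succ']
  have hbT : 2 ^ beta ≤ 2 ^ (beta + l) := Nat.pow_le_pow_right (by norm_num) (by omega)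
  have hB := card_bucketNum_le (l := l) (q := q) hz hd
  obtain ⟨σ₂, r₂, hsame, h12⟩ := runs_denseRank (σ := σ₁) (x := x) h hb.word
    (by rw [hss]; positivity) hb.spread_le (isUnary_unaryCode hz s) (fun j => lowPart_lt _)
    hb.lows_lt hb.low_le h0 h6 h7 h8 (by omega) hB (card_bucket_le hz _)
  have hmod : x % 2 ^ (l + lam) % 2 ^ l = x % 2 ^ l :=
    Nat.mod_mod_of_dvd _ (pow_dvd_pow 2 (by omega))
  have hcnt := card_le_eq_block hz hsplit
  rw [hmod] at hcnt
  obtain ⟨σ₃, r₃, e₀, e₁⟩ := runs_denseFinish (σ := σ₂) hb h hx ((hsame 0 (by norm_num)).trans h0)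
    hs hns hR hz hzlt hq ((hsame 2 (by norm_num)).trans h2) ((hsame 4 (by norm_num)).trans h4)
    ((hsame 5 (by norm_num)).trans h5) ((hsame 6 (by norm_num)).trans h6)
    ((hsame 7 (by norm_num)).trans h7) h12 hcnt.symm (by
      refine (card_le_card fun j hj => ?_).trans hB
      rw [mem_filter] at hj ⊢
      exact ⟨hj.1, by omega⟩)
  exact ⟨σ₃, r₁.line_seq (r₂.line_seq r₃), e₀, e₁⟩

/-! ### Construction for dense sets -/

/-- Key `t` of the superblock `K` relative to the start of the superblock. -/
def superKey (K : Finset ℕ) (e t : ℕ) : ℕ := enum K t % 2 ^ e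

/-- The words of the number `N`. -/
def wordList (w N k : ℕ) : List ℕ := (List.range k).map fun i => N / 2 ^ (w * i) % 2 ^ w

/-- A window reads the word in which it starts and the next one, and it may start right behind the
last field; hence two words more than the rounded-down quotient. -/
def lowRecord (w l e : ℕ) (K : Finset ℕ) : List ℕ :=
  wordList w (pack (l + 1) #K (lowPart (superKey K e) #K l)) ((l + 1) * #K / w + 2)

def superRecord (w l lam beta : ℕ) (K : Finset ℕ) (R prev L : ℕ) : List ℕ :=
  [R, prev, pack (2 * lam) (2 ^ (lam - beta)) (blockOffset (superKey K (l + lam)) #K l beta),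
    pack (2 * lam) (2 ^ (lam - beta)) (blockPrev (superKey K (l + lam)) #K l beta), L] ++
  wordList w (unaryCode (superKey K (l + lam)) #K l) ((#K + 2 ^ lam) / w + 2)

def denseHeader (w l lam beta s : ℕ) : List ℕ :=
  [3, l, l + lam, beta, 2 ^ (lam - beta) - 1, 2 ^ beta - 1, 2 ^ l - 1, 2 * lam,
    2 ^ (2 * lam) - 1, 2 ^ ((s + 1) * s) - 1, pack (s + 1) s fun _ => 1,
    pack (s + 1) s fun _ => 2 ^ s, pack (s + 1) s fun i => 2 ^ i, s, (s + 1) * (s - 1),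
    2 ^ (s + 1) - 1, 2 ^ s - 1, 2 ^ ((l + 1) * 2 ^ (beta + l)) - 1,
    pack (l + 1) (2 ^ l) fun _ => 1, pack (l + 1) (2 ^ l) fun _ => 2 ^ l, (l + 1) * (2 ^ l - 1),
    2 ^ (l + 1) - 1, l + 1, 2 ^ l, w]

theorem hasDenseParams {w l lam beta s : ℕ} {M : ℕ → ℕ}
    (hM : ∀ i < 25, M i = (denseHeader w l lam beta s).getD i 0) :
    HasDenseParams w l lam beta s M :=
  ⟨hM 1 (by norm_num), hM 2 (by norm_num), hM 3 (by norm_num), hM 4 (by norm_num),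
    hM 5 (by norm_num), hM 6 (by norm_num), hM 7 (by norm_num), hM 8 (by norm_num),
    hM 9 (by norm_num), hM 10 (by norm_num), hM 11 (by norm_num), hM 12 (by norm_num),
    hM 13 (by norm_num), hM 14 (by norm_num), hM 15 (by norm_num), hM 16 (by norm_num),
    hM 17 (by norm_num), hM 18 (by norm_num), hM 19 (by norm_num), hM 20 (by norm_num),
    hM 21 (by norm_num), hM 22 (by norm_num), hM 23 (by norm_num), hM 24 (by norm_num)⟩

/-- With `beta = lam / 8` and `l ≤ lam / 8` all packed sizes are powers of two with exponent at most
`lam`. The offsets of the blocks fit in a word since `2 * lam ≤ 2 ^ beta`, which follows from `16 *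
beta + 14 ≤ 2 ^ beta` for `beta ≥ 8`; this is where `w ≥ 2 ^ 64` is used. -/
theorem denseBounds {w l : ℕ} (hw : 2 ^ 64 ≤ w) (hl : 8 * l ≤ Nat.log 2 w) :
    DenseBounds w l (Nat.log 2 w) (Nat.log 2 w / 8) (2 ^ (Nat.log 2 w / 8 + l + 1)) := by
  set lam := Nat.log 2 w with hlam
  have hlam64 : 64 ≤ lam := Nat.le_log_of_pow_le (by norm_num) hw
  have hw0 : w ≠ 0 := by positivity
  have hp₁ : 2 ^ lam ≤ w := Nat.pow_log_le_self 2 hw0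
  have hle : ∀ e ≤ lam, 2 ^ e ≤ w := fun e he =>
    (Nat.pow_le_pow_right (by norm_num) he).trans hp₁
  have hlow : (l + 1) * 2 ^ (lam / 8 + l) < w := by
    calc (l + 1) * 2 ^ (lam / 8 + l) ≤ 2 ^ l * 2 ^ (lam / 8 + l) :=
          Nat.mul_le_mul_right _ Nat.lt_two_pow_self
      _ = 2 ^ (l + (lam / 8 + l)) := (pow_add _ _ _).symm
      _ < 2 ^ lam := Nat.pow_lt_pow_right (by norm_num) (by omega)
      _ ≤ w := hp₁
  have h2 : ∀ b, 8 ≤ b → 16 * b + 14 ≤ 2 ^ b := by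
    intro b hb
    induction b, hb using Nat.le_induction with
    | base => norm_num
    | succ b _ ih => rw [pow_succ]; omega
  have hb2 := h2 (lam / 8) (by omega)
  refine ⟨le_trans (by norm_num) hw, rfl, ?_, hlow, ?_, by omega, by omega, ?_, ?_⟩
  · calc (2 ^ (lam / 8 + l + 1) + 1) * 2 ^ (lam / 8 + l + 1)
        ≤ (2 * 2 ^ (lam / 8 + l + 1)) * 2 ^ (lam / 8 + l + 1) :=
          Nat.mul_le_mul_right _ (by have := Nat.one_le_two_pow (n := lam / 8 + l + 1); omega)
      _ = 2 ^ (1 + (lam / 8 + l + 1) + (lam / 8 + l + 1)) := by ring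
      _ ≤ w := hle _ (by omega)
  · refine le_trans (Nat.mul_le_mul_left _ ?_) hlow.le
    exact Nat.pow_le_pow_right (by norm_num) (by omega)
  · calc 2 * lam * 2 ^ (lam - lam / 8) ≤ 2 ^ (lam / 8) * 2 ^ (lam - lam / 8) :=
          Nat.mul_le_mul_right _ (by omega)
      _ = 2 ^ lam := by rw [← pow_add]; congr 1; omega
      _ ≤ w := hp₁
  · have h4 : ∀ m, 64 ≤ m → 4 * m ≤ 2 ^ m := by
      intro m hm
      induction m, hm using Nat.le_induction with
      | base => norm_num
      | succ m _ ih => rw [pow_succ]; omega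
    exact (h4 lam hlam64).trans hp₁

theorem denseHeader_lt {w l lam beta s : ℕ} (hb : DenseBounds w l lam beta s) :
    ∀ t ∈ denseHeader w l lam beta s, t < 2 ^ w := by
  have hww : w < 2 ^ w := Nat.lt_two_pow_self
  have hle : ∀ e ≤ w, 2 ^ e ≤ 2 ^ w := fun e he => Nat.pow_le_pow_right (by norm_num) he
  have hs : 0 < s := by rw [hb.bits]; positivity
  have hs₁ : s + 1 ≤ w := (Nat.le_mul_of_pos_right _ hs).trans hb.spread_le
  have hl2 : 2 ^ l ≤ w := (Nat.le_mul_of_pos_left _ l.succ_pos).trans hb.low_le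
  have hl₁ : l + 1 ≤ w := (Nat.le_mul_of_pos_right _ (by positivity)).trans hb.low_le
  have h₁ : (pack (s + 1) s fun _ => 1) < 2 ^ w :=
    (pack_lt fun _ _ => Nat.one_lt_two_pow (by omega)).trans_le (hle _ hb.spread_le)
  have h₂ : (pack (s + 1) s fun _ => 2 ^ s) < 2 ^ w :=
    (pack_lt fun _ _ => Nat.pow_lt_pow_right (by norm_num) (by omega)).trans_le
      (hle _ hb.spread_le)
  have h₃ : (pack (s + 1) s fun i => 2 ^ i) < 2 ^ w :=
    (pack_lt fun i hi => Nat.pow_lt_pow_right (by norm_num) (by omega)).trans_le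
      (hle _ hb.spread_le)
  have h₄ : (pack (l + 1) (2 ^ l) fun _ => 1) < 2 ^ w :=
    (pack_lt fun _ _ => Nat.one_lt_two_pow (by omega)).trans_le (hle _ hb.low_le)
  have h₅ : (pack (l + 1) (2 ^ l) fun _ => 2 ^ l) < 2 ^ w :=
    (pack_lt fun _ _ => Nat.pow_lt_pow_right (by norm_num) (by omega)).trans_le (hle _ hb.low_le)
  have h₆ : (s + 1) * (s - 1) ≤ w := (Nat.mul_le_mul_left _ (Nat.sub_le _ _)).trans hb.spread_le
  have h₇ : (l + 1) * (2 ^ l - 1) ≤ w := (Nat.mul_le_mul_left _ (Nat.sub_le _ _)).trans hb.low_le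
  have hlam := hb.log_le
  have hbl := hb.block_le
  have hll := hb.low_lt
  have hw := hb.word
  have p₁ := hle (lam - beta) (by omega)
  have p₂ := hle beta (by omega)
  have p₃ := hle l (by omega)
  have p₄ := hle (2 * lam) (by omega)
  have p₅ := hle _ hb.spread_le
  have p₆ := hle _ hs₁
  have p₇ := hle s (by omega)
  have p₈ := hle _ hb.lows_lt.le
  have p₉ := hle _ hl₁
  simp only [denseHeader, List.forall_mem_cons, List.not_mem_nil, false_imp_iff, implies_true,
    and_true]
  refine ⟨?_, ?_, ?_, ?_, ?_, ?_, ?_, ?_, ?_, ?_, ?_, ?_, ?_, ?_, ?_, ?_, ?_, ?_, ?_, ?_, ?_, ?_,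
    ?_, ?_, ?_⟩ <;> omega

end WordRAM

/-! ### Memory layout and correctness for dense sets. -/

namespace WordRAM
open Finset

section SuperKey

variable {K : Finset ℕ} {e i : ℕ}

theorem superKey_lt (t : ℕ) : superKey K e t < 2 ^ e := Nat.mod_lt _ (by positivity)

theorem superKey_lt_superKey (hK : ∀ a ∈ K, a / 2 ^ e = i) {s t : ℕ} (hst : s < t) (ht : t < #K) :
    superKey K e s < superKey K e t := by
  have h₁ := enum_lt_enum hst ht
  have h₂ := hK _ (enum_mem ht)
  have h₃ := hK _ (enum_mem (hst.trans ht))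
  by_contra hc
  have := (mod_le_mod_iff (h₂.trans h₃.symm)).1 (Nat.le_of_not_lt hc)
  omega

theorem card_super_le (hK : ∀ a ∈ K, a / 2 ^ e = i) : #K ≤ 2 ^ e := by
  have : #(range (2 ^ e)) = 2 ^ e := by simp
  refine le_of_le_of_eq ?_ this
  refine card_le_card_of_injOn (· % 2 ^ e) (fun a _ => ?_) fun a ha b hb hab => ?_
  · rw [coe_range, Set.mem_Iio]
    exact Nat.mod_lt _ (by positivity)
  · rw [← Nat.div_add_mod a (2 ^ e), ← Nat.div_add_mod b (2 ^ e), hK a ha, hK b hb]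
    dsimp only at hab
    rw [hab]

theorem card_superKey_le {x : ℕ} (hK : ∀ a ∈ K, a / 2 ^ e = x / 2 ^ e) :
    #{t ∈ range #K | superKey K e t ≤ x % 2 ^ e} = #(K.filter (· ≤ x)) := by
  rw [← card_filter_enum K (· ≤ x)]
  refine congrArg card (filter_congr fun t ht => ?_)
  rw [superKey, mod_le_mod_iff (hK _ (enum_mem (mem_range.1 ht)))]

end SuperKey

/-- There are so few superblocks that a constant number of words for each is affordable. Low parts
take `(l + 1) * n` bits and the unary codes `n` bits plus `2 ^ lam ≤ w` bits per superblock. -/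
theorem exists_dense {w u l : ℕ} {S : Finset ℕ} (hw : 2 ^ 64 ≤ w) (hu : u < 2 ^ w)
    (hS : S ⊆ Icc 1 u) (hl1 : 1 ≤ l) (hl : 8 * l ≤ Nat.log 2 w) (hul : u ≤ #S * 2 ^ l)
    (hlu : #S * 2 ^ l ≤ 2 * u) :
    ∃ T : List ℕ, T.length * w ≤ 100 * (#S * l + w) ∧ (∀ t ∈ T, t < 2 ^ w) ∧
      T.getD 0 0 = 3 ∧ ∀ M : ℕ → ℕ, (∀ i < T.length, M i = T.getD i 0) →
        Solves w u S M denseSearch denseSearch.lineCost := by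
  have hb := denseBounds hw hl
  have hp₁ : 2 ^ Nat.log 2 w ≤ w := Nat.pow_log_le_self 2 (by positivity)
  have hp₂ : w < 2 ^ (Nat.log 2 w + 1) := Nat.lt_pow_succ_log_self (by norm_num) w
  have hw6 : 1000000 ≤ w := le_trans (by norm_num) hw
  have hww : w < 2 ^ w := Nat.lt_two_pow_self
  generalize Nat.log 2 w = lam at *
  generalize lam / 8 = beta at *
  generalize 2 ^ (beta + l + 1) = s at *
  clear hw
  have h2w : 1000 * w ≤ 2 ^ w := by
    have h₁ : ∀ m, 64 ≤ m → 1000 * m ≤ 2 ^ m := by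
      intro m hm
      induction m, hm using Nat.le_induction with
      | base => norm_num
      | succ m _ ih => rw [pow_succ 2 m]; omega
    exact h₁ w (by omega)
  have hl' : #S * l ≤ 2 * 2 ^ w := by
    have := Nat.mul_le_mul_left #S (Nat.lt_two_pow_self (n := l)).le
    omega
  have hSl : #S * 1 ≤ #S * l := Nat.mul_le_mul_left _ hl1
  have hSu : ∀ a ∈ S, a ≤ u := fun a ha => (mem_Icc.1 (hS ha)).2
  have hnu : #S ≤ u := by simpa using card_le_card hS
  set N := u / 2 ^ (l + lam) + 1 with hN
  -- A superblock has length `2 ^ (l + lam)`, so at most `n / 2 ^ lam` full ones fit below `u`, and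
  -- `w < 2 * 2 ^ lam`.
  have hNw : N * w ≤ 2 * #S + w := by
    have h₃ : u / 2 ^ (l + lam) * 2 ^ lam ≤ #S := by
      have h₄ : u / 2 ^ (l + lam) * 2 ^ (l + lam) ≤ #S * 2 ^ l :=
        (Nat.div_mul_le_self _ _).trans hul
      rw [show 2 ^ (l + lam) = 2 ^ lam * 2 ^ l by rw [pow_add, Nat.mul_comm],
        ← Nat.mul_assoc] at h₄
      rw [show 2 ^ (l + lam) = 2 ^ lam * 2 ^ l by rw [pow_add, Nat.mul_comm]]
      exact Nat.le_of_mul_le_mul_right h₄ (by positivity)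
    have h₅ := Nat.mul_le_mul_left (u / 2 ^ (l + lam)) hp₂.le
    rw [pow_succ, ← Nat.mul_assoc] at h₅
    rw [hN, Nat.succ_mul]
    omega
  set K : ℕ → Finset ℕ := fun i => S.filter (· / 2 ^ (l + lam) = i) with hK
  have hKi : ∀ i, ∀ a ∈ K i, a / 2 ^ (l + lam) = i := fun i a ha => (mem_filter.1 ha).2
  have hsum : ∑ i ∈ range N, #(K i) ≤ #S := by
    rw [← card_biUnion]
    · exact card_le_card (biUnion_subset.2 fun i _ => filter_subset _ _)
    · intro i _ j _ hij
      rw [Function.onFun, disjoint_filter]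
      rintro a - rfl
      exact hij
  have hsumdiv : ∀ f : ℕ → ℕ, (∑ i ∈ range N, f i / w) * w ≤ ∑ i ∈ range N, f i := fun f => by
    rw [sum_mul]
    exact sum_le_sum fun i _ => Nat.div_mul_le_self _ _
  obtain ⟨TL, offL, hTL, hTLmem, hTLget⟩ := exists_concat (range N) fun i =>
    lowRecord w l (l + lam) (K i)
  have hTLlen : TL.length * w ≤ (l + 1) * #S + 2 * (N * w) := by
    have h₁ := hsumdiv fun i => (l + 1) * #(K i)
    rw [← mul_sum] at h₁
    have h₂ := Nat.mul_le_mul_left (l + 1) hsum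
    rw [hTL]
    simp only [lowRecord, wordList, List.length_map, List.length_range, sum_add_distrib, sum_const,
      card_range, smul_eq_mul, Nat.add_mul]
    simp only [Nat.add_mul] at h₁ h₂
    nlinarith
  obtain ⟨TR, offR, hTR, hTRmem, hTRget⟩ := exists_concat (range N) fun i =>
    superRecord w l lam beta (K i) #(S.filter (· / 2 ^ (l + lam) < i))
      ((S.filter (· / 2 ^ (l + lam) < i)).sup id) (25 + N + offL i)
  have hTRlen : TR.length * w ≤ #S + 8 * (N * w) := by
    have h₁ := hsumdiv fun i => #(K i) + 2 ^ lam
    rw [sum_add_distrib, sum_const, card_range, smul_eq_mul] at h₁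
    have h₂ := Nat.mul_le_mul_left N hp₁
    rw [hTR]
    simp only [superRecord, wordList, List.length_append, List.length_cons, List.length_nil,
      List.length_map, List.length_range, sum_add_distrib, sum_const, card_range, smul_eq_mul,
      Nat.add_mul]
    nlinarith
  set H := denseHeader w l lam beta s with hH
  have hHlen : H.length = 25 := rfl
  set Dir := (List.range N).map fun i => 25 + N + TL.length + offR i with hDir
  have hDlen : Dir.length = N := by simp [hDir]
  have hlen : (H ++ Dir ++ TL ++ TR).length = 25 + N + TL.length + TR.length := by
    simp only [List.length_append, hHlen, hDlen]
  have hspace : (25 + N + TL.length + TR.length) * w ≤ 25 * (#S * l) + 36 * w := by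
    rw [Nat.add_mul _ 1] at hTLlen
    rw [Nat.add_mul, Nat.add_mul, Nat.add_mul]
    rw [Nat.mul_comm l] at hTLlen
    omega
  have hsmall : 1000 * (25 + N + TL.length + TR.length) ≤ 2 ^ w := by
    have := Nat.mul_le_mul_right (25 + N + TL.length + TR.length) hw6
    rw [Nat.mul_comm w] at this
    omega
  have hp₃ : 2 ^ (l + lam) < 2 ^ (2 * lam) :=
    Nat.pow_lt_pow_right (by norm_num) (by have := hb.low_lt; omega)
  have hoffs : ∀ a : ℕ → ℕ, (∀ i, a i < 2 ^ (2 * lam)) →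
      pack (2 * lam) (2 ^ (lam - beta)) a < 2 ^ w := fun a ha =>
    (pack_lt fun i _ => ha i).trans_le (Nat.pow_le_pow_right (by norm_num) hb.offsets_le)
  have hwl : ∀ A k, ∀ t ∈ wordList w A k, t < 2 ^ w := fun A k t ht => by
    obtain ⟨i, -, rfl⟩ := List.mem_map.1 ht
    exact Nat.mod_lt _ (by positivity)
  have hLoff : ∀ i < N, offL i + ((l + 1) * #(K i) / w + 2) ≤ TL.length := fun i hi => by
    simpa [lowRecord, wordList] using (hTLget i (mem_range.2 hi)).1
  have hRoff : ∀ i < N, offR i + ((#(K i) + 2 ^ lam) / w + 7) ≤ TR.length := fun i hi => by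
    simpa [superRecord, wordList] using (hTRget i (mem_range.2 hi)).1
  have hd₁ : ∀ i, 0 ≤ (l + 1) * #(K i) / w := fun i => Nat.zero_le _
  have hd₂ : ∀ i, 0 ≤ (#(K i) + 2 ^ lam) / w := fun i => Nat.zero_le _
  refine ⟨H ++ Dir ++ TL ++ TR, by rw [hlen]; omega, fun t ht => ?_, rfl, fun M hM x _ hx => ?_⟩
  · rcases List.mem_append.1 ht with ht | ht
    · rcases List.mem_append.1 ht with ht | ht
      · rcases List.mem_append.1 ht with ht | ht
        · exact denseHeader_lt hb t ht
        · obtain ⟨i, hi, rfl⟩ := List.mem_map.1 ht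
          have h₁ := hRoff i (by simpa using hi)
          have h₂ := hd₂ i
          omega
      · obtain ⟨i, -, hi⟩ := hTLmem t ht
        exact hwl _ _ t hi
    · obtain ⟨i, hiN, hi⟩ := hTRmem t ht
      rcases List.mem_append.1 hi with hi | hi
      · have h₁ := hLoff i (mem_range.1 hiN)
        have h₂ := hd₁ i
        have h₃ : #(S.filter (· / 2 ^ (l + lam) < i)) ≤ #S := card_filter_le _ _
        have h₄ : (S.filter (· / 2 ^ (l + lam) < i)).sup id ≤ u :=
          Finset.sup_le fun a ha => hSu a (mem_filter.1 ha).1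
        have h₅ := card_super_le (hKi i)
        have h₆ := hoffs (blockOffset (superKey (K i) (l + lam)) #(K i) l beta) fun q =>
          blockOffset_le.trans_lt (by omega)
        have h₇ := hoffs (blockPrev (superKey (K i) (l + lam)) #(K i) l beta) fun q => by
          have := superKey_lt (K := K i) (e := l + lam)
            (blockOffset (superKey (K i) (l + lam)) #(K i) l beta q - 1)
          rw [blockPrev]
          split_ifs
          · positivity
          · omega
        simp only [List.mem_cons, List.not_mem_nil, or_false] at hi
        omega
      · exact hwl _ _ t hi
  · rw [hlen] at hM
    have hM₁ : ∀ i < 25, M i = H.getD i 0 := by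
      intro i hi
      rw [hM i (by omega), List.append_assoc, List.append_assoc,
        List.getD_append _ _ _ _ (by omega)]
    have hM₂ : ∀ i < N, M (25 + i) = 25 + N + TL.length + offR i := by
      intro i hi
      rw [hM _ (by omega), List.append_assoc, List.getD_append _ _ _ _
        (by rw [List.length_append]; omega)]
      exact (getD_append_right' (l₁ := H) i).trans (getD_map_range _ hi)
    have hM₃ : ∀ i < TL.length, M (25 + N + i) = TL.getD i 0 := by
      intro i hi
      rw [hM _ (by omega), List.getD_append _ _ _ _ (by simp only [List.length_append]; omega),
        ← getD_append_right' (l₁ := H ++ Dir) (l₂ := TL) i, List.length_append, hHlen, hDlen]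
    have hM₄ : ∀ i < TR.length, M (25 + N + TL.length + i) = TR.getD i 0 := by
      intro i hi
      rw [hM _ (by omega), ← getD_append_right' (l₁ := H ++ Dir ++ TL) (l₂ := TR) i,
        List.length_append, List.length_append, hHlen, hDlen]
    obtain ⟨i, hi⟩ : ∃ i, i = x / 2 ^ (l + lam) := ⟨_, rfl⟩
    have hiN : i < N := by
      rw [hi, hN]
      exact Nat.lt_succ_of_le (Nat.div_le_div_right hx)
    have hLi := hLoff i hiN
    have hRi := hRoff i hiN
    have hdi₁ := hd₁ i
    have hdi₂ := hd₂ i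
    have hLget : ∀ j < (l + 1) * #(K i) / w + 2, M (25 + N + offL i + j) =
        (lowRecord w l (l + lam) (K i)).getD j 0 := by
      intro j hj
      rw [Nat.add_assoc, hM₃ _ (by omega)]
      exact (hTLget i (mem_range.2 hiN)).2 j (by simpa [lowRecord, wordList] using hj)
    have hRget : ∀ j < (#(K i) + 2 ^ lam) / w + 7, M (25 + N + TL.length + offR i + j) =
        (superRecord w l lam beta (K i) #(S.filter (· / 2 ^ (l + lam) < i))
          ((S.filter (· / 2 ^ (l + lam) < i)).sup id) (25 + N + offL i)).getD j 0 := by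
      intro j hj
      rw [Nat.add_assoc, hM₄ _ (by omega)]
      exact (hTRget i (mem_range.2 hiN)).2 j (by
        simp only [superRecord, wordList, List.length_append, List.length_cons, List.length_nil,
          List.length_map, List.length_range]
        omega)
    have hsuper : HasSuper w l lam beta (superKey (K i) (l + lam)) #(K i)
        (25 + N + TL.length + offR i) #(S.filter (· / 2 ^ (l + lam) < i))
        ((S.filter (· / 2 ^ (l + lam) < i)).sup id) M := by
      refine ⟨hRget 0 (by omega), hRget 1 (by omega), hRget 2 (by omega), hRget 3 (by omega),
        ⟨25 + N + offL i, hRget 4 (by omega), by omega, fun j hj => ?_⟩, fun j hj => ?_, by omega⟩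
      · rw [hLget j (by omega), lowRecord, wordList, getD_map_range _ (by omega)]
      · rw [Nat.add_assoc _ 5 j, hRget _ (by omega), superRecord]
        exact (getD_append_right' j).trans (getD_map_range _ (by omega))
    have hKx : ∀ a ∈ K i, a / 2 ^ (l + lam) = x / 2 ^ (l + lam) := fun a ha =>
      (hKi i a ha).trans hi
    have hmono : Monotone fun a : ℕ => a / 2 ^ (l + lam) := fun a b hab =>
      Nat.div_le_div_right hab
    have hrank := rank_eq_group (S := S) hmono x
    have hpred := pred_eq_group (S := S) hmono x
    rw [← hi] at hrank hpred
    have hRn : #(S.filter (· / 2 ^ (l + lam) < i)) + #(K i) ≤ #S := by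
      rw [← card_union_of_disjoint]
      · exact card_le_card (union_subset (filter_subset _ _) (filter_subset _ _))
      · rw [disjoint_filter]
        intro a _ h₁ h₂
        omega
    obtain ⟨σ', r, e₀, e₁⟩ := runs_denseSearch (x := x) hb (hasDenseParams hM₁) (by omega)
      (by omega) (by rw [← hi]; exact hM₂ i hiN) hsuper (card_super_le (hKi i)) (by omega)
      (fun a b hab h' => superKey_lt_superKey (hKi i) hab h') (fun t _ => superKey_lt t)
    rw [card_superKey_le hKx] at e₀ e₁
    refine ⟨σ', _, r, le_rfl, ?_, ?_⟩
    · rw [e₀, hpred]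
      split_ifs with h
      · rfl
      · have hlt : #((K i).filter (· ≤ x)) - 1 < #(K i) := by
          have : #((K i).filter (· ≤ x)) ≤ #(K i) := card_filter_le _ _
          omega
        rw [superKey, ← hKx _ (enum_mem hlt), Nat.div_add_mod']
    · rw [e₁, hrank]

end WordRAM

namespace WordRAM
open Finset

/-! ### The query program -/

/-- The query program; the word at address `0` tells which structure is used. -/
def search : Cmd :=
  -- The parity test comes first because it needs only the constants `0` and `1`; for `w = 2` the
  -- constant `4` would be reduced to `0`.
  .ite (.read 0 &&& 1) 1 scan
    (.ite (.read 0) 2 answerNone (.ite (.read 0) 4 denseSearch sparseSearch))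

section Search

variable {w u T : ℕ} {S : Finset ℕ} {M : ℕ → ℕ}

theorem Solves.mono {c : Cmd} {T' : ℕ} (h : Solves w u S M c T) (hT : T ≤ T') :
    Solves w u S M c T' := fun x h₁ h₂ =>
  let ⟨σ', t, r, ht, e⟩ := h x h₁ h₂
  ⟨σ', t, r, ht.trans hT, e⟩

theorem Solves.iteTrue {a b : Expr} {c d : Cmd} (h : Solves w u S M c T)
    (hab : ∀ σ, a.eval w M σ < b.eval w M σ) :
    Solves w u S M (.ite a b c d) (T + (a.cost + b.cost + 2)) := fun x h₁ h₂ =>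
  let ⟨σ', t, r, ht, e⟩ := h x h₁ h₂
  ⟨σ', _, .iteTrue (hab _) r, by omega, e⟩

theorem Solves.iteFalse {a b : Expr} {c d : Cmd} (h : Solves w u S M d T)
    (hab : ∀ σ, ¬ a.eval w M σ < b.eval w M σ) :
    Solves w u S M (.ite a b c d) (T + (a.cost + b.cost + 2)) := fun x h₁ h₂ =>
  let ⟨σ', t, r, ht, e⟩ := h x h₁ h₂
  ⟨σ', _, .iteFalse (hab _) r, by omega, e⟩

theorem eval_mode (hw : 2 ≤ w) (σ : ℕ → ℕ) :
    (Expr.read 0 &&& 1 : Expr).eval w M σ = M 0 % 2 := by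
  have h1 : 1 < 2 ^ w := Nat.one_lt_two_pow (by omega)
  simpa using Expr.eval_mask (y := 1) (Expr.eval_read_lit (M := M) (σ := σ) 0 (by omega))
    (Expr.eval_lit 1 h1)

theorem Solves.search_of_scan (hw : 2 ≤ w) (h : Solves w u S M scan T) (h0 : M 0 % 2 = 0) :
    Solves w u S M search (T + 30) := by
  have h1 : 1 < 2 ^ w := Nat.one_lt_two_pow (by omega)
  refine (h.iteTrue fun σ => ?_).mono (T' := T + 30) ?_
  · rw [eval_mode hw, Expr.eval_lit 1 h1]
    omega
  · change T + (1 + 1 + 1 + 1 + 1 + 2) ≤ _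
    omega

theorem Solves.search_of_none (hw : 64 ≤ w) (h : Solves w u S M answerNone T) (h0 : M 0 = 1) :
    Solves w u S M search (T + 30) := by
  have hww : w < 2 ^ w := Nat.lt_two_pow_self
  refine ((h.iteTrue (a := .read 0) (b := 2) fun σ => ?_).iteFalse fun σ => ?_).mono
    (T' := T + 30) ?_
  · rw [Expr.eval_read_lit 0 (by omega), Expr.eval_lit 2 (by omega)]
    omega
  · rw [eval_mode (by omega), Expr.eval_lit 1 (by omega)]
    omega
  · change T + (1 + 1 + 1 + 2) + (1 + 1 + 1 + 1 + 1 + 2) ≤ _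
    omega

theorem Solves.search_of_dense (hw : 64 ≤ w) (h : Solves w u S M denseSearch T) (h0 : M 0 = 3) :
    Solves w u S M search (T + 30) := by
  have hww : w < 2 ^ w := Nat.lt_two_pow_self
  refine (((h.iteTrue (a := .read 0) (b := 4) fun σ => ?_).iteFalse (a := .read 0) (b := 2)
    fun σ => ?_).iteFalse fun σ => ?_).mono (T' := T + 30) ?_
  · rw [Expr.eval_read_lit 0 (by omega), Expr.eval_lit 4 (by omega)]
    omega
  · rw [Expr.eval_read_lit 0 (by omega), Expr.eval_lit 2 (by omega)]
    omega
  · rw [eval_mode (by omega), Expr.eval_lit 1 (by omega)]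
    omega
  · change T + (1 + 1 + 1 + 2) + (1 + 1 + 1 + 2) + (1 + 1 + 1 + 1 + 1 + 2) ≤ _
    omega

theorem Solves.search_of_sparse (hw : 64 ≤ w) (h : Solves w u S M sparseSearch T) (h0 : M 0 = 5) :
    Solves w u S M search (T + 30) := by
  have hww : w < 2 ^ w := Nat.lt_two_pow_self
  refine (((h.iteFalse (a := .read 0) (b := 4) fun σ => ?_).iteFalse (a := .read 0) (b := 2)
    fun σ => ?_).iteFalse fun σ => ?_).mono (T' := T + 30) ?_
  · rw [Expr.eval_read_lit 0 (by omega), Expr.eval_lit 4 (by omega)]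
    omega
  · rw [Expr.eval_read_lit 0 (by omega), Expr.eval_lit 2 (by omega)]
    omega
  · rw [eval_mode (by omega), Expr.eval_lit 1 (by omega)]
    omega
  · change T + (1 + 1 + 1 + 2) + (1 + 1 + 1 + 2) + (1 + 1 + 1 + 1 + 1 + 2) ≤ _
    omega

end Search

theorem exists_scan {w u : ℕ} {S : Finset ℕ} (hw : 2 ≤ w) (hu : u < 2 ^ w) (hS : S ⊆ Icc 1 u) :
    ∃ D : List (BitVec w), bits D = 2 ^ (w - 1) * w ∧
      Solves w u S (memory D) search (100 * 2 ^ w + 130) := by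
  have hp : 2 ^ 2 ≤ 2 ^ w := Nat.pow_le_pow_right (by norm_num) hw
  have hlt : ∀ t ∈ bitTable w S, t < 2 ^ w := by
    intro t ht
    obtain ⟨i, -, rfl⟩ := List.mem_map.1 ht
    split_ifs <;> omega
  refine ⟨(bitTable w S).map (BitVec.ofNat w), by simp [bits, bitTable], ?_⟩
  refine (solves_scan hw hu hS fun i _ => memory_map hlt i).search_of_scan hw ?_
  rw [memory_map hlt, bitTable, getD_map_range _ (by positivity)]
  have : 2 * 0 ∉ S := fun h => by simpa using hS h
  rw [if_neg this]
  omega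

theorem exists_none {w u : ℕ} (hw : 64 ≤ w) :
    ∃ D : List (BitVec w), bits D = w ∧ Solves w u ∅ (memory D) search 40 := by
  have hww : w < 2 ^ w := Nat.lt_two_pow_self
  have hlt : ∀ t ∈ [1], t < 2 ^ w := by simp; omega
  refine ⟨[1].map (BitVec.ofNat w), by simp [bits], ?_⟩
  exact (solves_answerNone _).search_of_none hw (memory_map hlt 0)

/-- Data structure for all sets; `l` is the rounded logarithm of `u / n`. -/
theorem exists_structure : ∃ C : ℕ, ∀ (w u : ℕ) (S : Finset ℕ), 2 ≤ w → u < 2 ^ w → S ⊆ Icc 1 u →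
    ∀ l, 1 ≤ l → (0 < #S → u ≤ #S * 2 ^ l ∧ #S * 2 ^ l ≤ 2 * u) →
      ∃ D : List (BitVec w), bits D ≤ C * (#S * l + w) ∧
        Solves w u S (memory D) search (C * (Nat.log 2 (l / Nat.log 2 w) + 1)) := by
  -- `W` stays opaque, so that `2 ^ W` is never evaluated.
  obtain ⟨W, hW⟩ : ∃ W, W = 2 ^ 64 := ⟨_, rfl⟩
  refine ⟨100 * 2 ^ W + 2 ^ W * W + 20000 + (denseSearch.lineCost + 16 * (trieCost + groupCost)) +
    130, fun w u S hw hu hS l hl hul => ?_⟩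
  have hcost : ∀ {K E : ℕ}, K ≤ E → K ≤ E * (Nat.log 2 (l / Nat.log 2 w) + 1) := fun h =>
    h.trans (Nat.le_mul_of_pos_right _ (Nat.succ_pos _))
  generalize hK₁ : denseSearch.lineCost = K₁
  generalize hK₂ : 16 * (trieCost + groupCost) = K₂
  rcases Nat.lt_or_ge w W with hwW | hwW
  · obtain ⟨D, hD, hsol⟩ := exists_scan hw hu hS
    have hp₁ : 2 ^ w ≤ 2 ^ W := Nat.pow_le_pow_right (by norm_num) hwW.le
    have hp₂ : 2 ^ (w - 1) ≤ 2 ^ W := Nat.pow_le_pow_right (by norm_num) (by omega)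
    refine ⟨D, ?_, hsol.mono (hcost (by omega))⟩
    rw [hD]
    exact (Nat.mul_le_mul hp₂ hwW.le).trans ((by omega : _ ≤ _).trans
      (Nat.le_mul_of_pos_right _ (by omega : 0 < #S * l + w)))
  have hw64 : 2 ^ 64 ≤ w := hW ▸ hwW
  have hw' : 64 ≤ w := le_trans (by norm_num) hw64
  have hfin : ∀ L : List ℕ, L.length * w ≤ 20000 * (#S * l + w) →
      bits (L.map (BitVec.ofNat w)) ≤ (100 * 2 ^ W + 2 ^ W * W + 20000 + (K₁ + K₂) + 130) *
        (#S * l + w) := fun L hL => by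
    rw [bits, List.length_map]
    exact hL.trans (Nat.mul_le_mul_right _ (by omega))
  rcases Nat.eq_zero_or_pos #S with hn | hn
  · rw [card_eq_zero] at hn
    subst hn
    obtain ⟨D, hD, hsol⟩ := exists_none (u := u) hw'
    refine ⟨D, ?_, hsol.mono (hcost (by omega))⟩
    rw [hD]
    exact (by omega : w ≤ #(∅ : Finset ℕ) * l + w).trans (Nat.le_mul_of_pos_left _ (by omega))
  obtain ⟨hul, hlu⟩ := hul hn
  rcases Nat.lt_or_ge (Nat.log 2 w) (8 * l) with hbig | hsmall
  · obtain ⟨L, hL, hlt, h0, hsol⟩ := exists_sparse hw64 hu hS hn hbig hul hlu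
    refine ⟨_, hfin L hL, ((hsol _ fun i _ => memory_map hlt i).search_of_sparse hw'
      ((memory_map hlt 0).trans h0)).mono ?_⟩
    rw [hK₂]
    generalize Nat.log 2 (l / Nat.log 2 w) = q
    have h₁ : (K₂ + 30) * (q + 1) ≤ (100 * 2 ^ W + 2 ^ W * W + 20000 + (K₁ + K₂) + 130) * (q + 1) :=
      Nat.mul_le_mul_right _ (by omega)
    rw [Nat.add_mul] at h₁
    omega
  · obtain ⟨L, hL, hlt, h0, hsol⟩ := exists_dense hw64 hu hS hl hsmall hul hlu
    rw [hK₁] at hsol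
    exact ⟨_, hfin L (hL.trans (by omega)),
      ((hsol _ fun i _ => memory_map hlt i).search_of_dense hw'
      ((memory_map hlt 0).trans h0)).mono (hcost (by omega))⟩

/-! ### Logarithms -/

/-- The least `l ≥ 1` with `u ≤ n * 2 ^ l`. Minimality gives `n * 2 ^ l ≤ 2 * u` for `l ≥ 2`, and
for `l = 1` it follows from `n ≤ u`. -/
theorem exists_log {u n : ℕ} (hn : 0 < n) (hnu : n ≤ u) :
    ∃ l, 1 ≤ l ∧ u ≤ n * 2 ^ l ∧ n * 2 ^ l ≤ 2 * u ∧ (2 ≤ l → n * 2 ^ (l - 1) < u) := by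
  have hex : ∃ l, 1 ≤ l ∧ u ≤ n * 2 ^ l := ⟨u + 1, by omega,
    (Nat.lt_two_pow_self.le.trans (Nat.pow_le_pow_right (by norm_num) (by omega))).trans
      (Nat.le_mul_of_pos_left _ hn)⟩
  classical
  obtain ⟨h₁, h₂⟩ := Nat.find_spec hex
  have hmin : 2 ≤ Nat.find hex → n * 2 ^ (Nat.find hex - 1) < u := fun h => by
    have := Nat.find_min hex (m := Nat.find hex - 1) (by omega)
    by_contra hc
    exact this ⟨by omega, by omega⟩
  refine ⟨Nat.find hex, h₁, h₂, ?_, hmin⟩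
  rcases h₁.lt_or_eq with h | h
  · have := hmin h
    have e : 2 ^ Nat.find hex = 2 ^ (Nat.find hex - 1) * 2 := by
      rw [← pow_succ]; congr 1; omega
    rw [e, ← Nat.mul_assoc]
    omega
  · rw [← h]
    omega

theorem le_logb_of_log {u n l : ℕ} (hn : 0 < n) (hl : 2 ≤ l) (h : n * 2 ^ (l - 1) < u) :
    (l : ℝ) - 1 ≤ Real.logb 2 ((u : ℝ) / n) := by
  have hn' : (0 : ℝ) < n := by exact_mod_cast hn
  have h' : (n : ℝ) * 2 ^ (l - 1) < u := by exact_mod_cast h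
  have h₁ : (2 : ℝ) ^ (l - 1) ≤ u / n := by
    rw [le_div_iff₀ hn', mul_comm]
    exact h'.le
  have h₂ : Real.logb 2 ((2 : ℝ) ^ (l - 1)) ≤ Real.logb 2 ((u : ℝ) / n) :=
    Real.logb_le_logb_of_le (by norm_num) (by positivity) h₁
  rw [Real.logb_pow, Real.logb_self_eq_one (by norm_num), mul_one, Nat.cast_sub (by omega),
    Nat.cast_one] at h₂
  exact h₂

/-- Let `q = l / lam`. For `q < 2` the left side is `1`. Otherwise `l - 1 ≥ l / 2` and `lg w ≤ 2 *
lam`, so `L / lg w ≥ q / 4` and `lg q` exceeds the logarithm on the right by at most `2`. -/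
theorem log_div_le {w l : ℕ} {L : ℝ} (hw : 2 ≤ w) (hL : 2 ≤ l → (l : ℝ) - 1 ≤ L) :
    ((Nat.log 2 (l / Nat.log 2 w) + 1 : ℕ) : ℝ) ≤ 4 * max 1 (Real.logb 2 (L / Real.logb 2 w)) := by
  set lam := Nat.log 2 w with hlam
  have hlam1 : 1 ≤ lam := Nat.le_log_of_pow_le (by norm_num) (by simpa using hw)
  have hmax : (1 : ℝ) ≤ max 1 (Real.logb 2 (L / Real.logb 2 w)) := le_max_left _ _
  rcases Nat.lt_or_ge (l / lam) 2 with hq | hq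
  · rw [Nat.log_of_lt hq]
    push_cast
    linarith
  have hll : l / lam * lam ≤ l := Nat.div_mul_le_self _ _
  have hl2 : 2 ≤ l := hq.trans (Nat.div_le_self _ _)
  have hL' := hL hl2
  have hl2' : (2 : ℝ) ≤ l := by exact_mod_cast hl2
  have hlam1' : (1 : ℝ) ≤ lam := by exact_mod_cast hlam1
  have hw0 : (0 : ℝ) < w := by positivity
  have hlw₁ : Real.logb 2 w ≤ lam + 1 := by
    have h₁ : (w : ℝ) ≤ 2 ^ (lam + 1) := by
      exact_mod_cast (Nat.lt_pow_succ_log_self (by norm_num) w).le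
    have h₂ := Real.logb_le_logb_of_le (b := 2) (by norm_num) hw0 h₁
    rw [Real.logb_pow, Real.logb_self_eq_one (by norm_num), mul_one] at h₂
    exact_mod_cast h₂
  have hlw₀ : 0 < Real.logb 2 w := Real.logb_pos (by norm_num) (by exact_mod_cast hw)
  set q := l / lam with hqdef
  have hq0 : (0 : ℝ) < q := by exact_mod_cast (by omega : 0 < q)
  have hqlam : (q : ℝ) * lam ≤ l := by exact_mod_cast hll
  have key : (q : ℝ) / 4 ≤ L / Real.logb 2 w := by
    rw [le_div_iff₀ hlw₀]
    have h₁ : (q : ℝ) / 4 * Real.logb 2 w ≤ q / 4 * (2 * lam) :=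
      mul_le_mul_of_nonneg_left (by linarith) (by positivity)
    have h₂ : (q : ℝ) / 4 * (2 * lam) = q * lam / 2 := by ring
    linarith
  have h₁ : (Nat.log 2 q : ℝ) ≤ Real.logb 2 q := by
    have h₂ : ((2 : ℝ) ^ Nat.log 2 q) ≤ q := by
      exact_mod_cast Nat.pow_log_le_self 2 (by omega)
    have h₃ := Real.logb_le_logb_of_le (b := 2) (by norm_num) (by positivity) h₂
    rwa [Real.logb_pow, Real.logb_self_eq_one (by norm_num), mul_one] at h₃
  have h₂ : Real.logb 2 ((q : ℝ) / 4) = Real.logb 2 q - 2 := by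
    rw [Real.logb_div hq0.ne' (by norm_num), show (4 : ℝ) = 2 ^ 2 by norm_num, Real.logb_pow,
      Real.logb_self_eq_one (by norm_num)]
    norm_num
  have h₃ := Real.logb_le_logb_of_le (b := 2) (by norm_num) (by positivity) key
  have h₄ : Real.logb 2 (L / Real.logb 2 w) ≤ max 1 (Real.logb 2 (L / Real.logb 2 w)) :=
    le_max_right _ _
  push_cast
  linarith

end WordRAM

theorem mainTheorem12 :
    ∃ (P : WordRAM.Program) (C : ℝ), 0 < C ∧
      ∀ (w u : ℕ) (S : Finset ℕ), 2 ≤ w → u < 2 ^ w → S ⊆ Finset.Icc 1 u →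
        ∃ D : List (BitVec w),
          (WordRAM.bits D : ℝ) ≤
            C * ((S.card : ℝ) * max 1 (Real.logb 2 ((u : ℝ) / (S.card : ℝ))) + (w : ℝ)) ∧
          ∀ x ∈ Finset.Icc 1 u, ∃ y r : ℕ,
            IsPredecessorAnswer S x y r ∧
            WordRAM.Returns P D x
              (C * max 1 (Real.logb 2
                (Real.logb 2 ((u : ℝ) / (S.card : ℝ)) / Real.logb 2 (w : ℝ)))) y r := by
  obtain ⟨C, hC⟩ := WordRAM.exists_structure
  refine ⟨WordRAM.search.program, 4 * C + 1, by positivity, fun w u S hw hu hS => ?_⟩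
  obtain ⟨l, hl, hul, hlog⟩ : ∃ l : ℕ, 1 ≤ l ∧ (0 < S.card → u ≤ S.card * 2 ^ l ∧
      S.card * 2 ^ l ≤ 2 * u) ∧
      (2 ≤ l → (l : ℝ) - 1 ≤ Real.logb 2 ((u : ℝ) / (S.card : ℝ))) := by
    -- For `n = 0` the quotient `u / 0` and its logarithm are `0` by convention, so both maxima in
    -- the bounds are `1`, in accordance with `l = 1`.
    rcases Nat.eq_zero_or_pos S.card with hn | hn
    · exact ⟨1, le_rfl, by omega, by omega⟩
    · obtain ⟨l, h₁, h₂, h₃, h₄⟩ := WordRAM.exists_log hn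
        (by simpa using Finset.card_le_card hS : S.card ≤ u)
      exact ⟨l, h₁, fun _ => ⟨h₂, h₃⟩, fun h => WordRAM.le_logb_of_log hn h (h₄ h)⟩
  obtain ⟨D, hD, hsol⟩ := hC w u S hw hu hS l hl hul
  have hC0 : (0 : ℝ) ≤ C := Nat.cast_nonneg C
  have hn0 : (0 : ℝ) ≤ S.card := Nat.cast_nonneg _
  have hw0 : (0 : ℝ) ≤ w := Nat.cast_nonneg _
  refine ⟨D, ?_, fun x hx => ?_⟩
  · have h₁ : (l : ℝ) ≤ 2 * max 1 (Real.logb 2 ((u : ℝ) / (S.card : ℝ))) := by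
      have hm₁ := le_max_left 1 (Real.logb 2 ((u : ℝ) / (S.card : ℝ)))
      have hm₂ := le_max_right 1 (Real.logb 2 ((u : ℝ) / (S.card : ℝ)))
      rcases hl.lt_or_eq with h | h
      · have := hlog h
        have : (2 : ℝ) ≤ l := by exact_mod_cast h
        linarith
      · rw [← h]
        push_cast
        linarith
    have hm : (0 : ℝ) ≤ max 1 (Real.logb 2 ((u : ℝ) / (S.card : ℝ))) :=
      zero_le_one.trans (le_max_left _ _)
    generalize max 1 (Real.logb 2 ((u : ℝ) / (S.card : ℝ))) = m at *
    have h₂ : (WordRAM.bits D : ℝ) ≤ C * (S.card * l + w) := by exact_mod_cast hD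
    have h₃ : (S.card : ℝ) * l ≤ S.card * (2 * m) := mul_le_mul_of_nonneg_left h₁ hn0
    have h₄ : (0 : ℝ) ≤ S.card * m := mul_nonneg hn0 hm
    calc (WordRAM.bits D : ℝ) ≤ C * (S.card * l + w) := h₂
      _ ≤ C * (4 * (S.card * m + w)) := mul_le_mul_of_nonneg_left (by linarith) hC0
      _ ≤ (4 * C + 1) * (S.card * m + w) := by linarith
  · obtain ⟨hx₁, hx₂⟩ := Finset.mem_Icc.1 hx
    obtain ⟨σ', t, r, ht, e₀, e₁⟩ := hsol x hx₁ hx₂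
    refine ⟨WordRAM.pred S x, WordRAM.rank S x, WordRAM.isPredecessorAnswer x, ?_⟩
    rw [← e₀, ← e₁]
    refine r.returns (by omega) ?_
    have h₁ := WordRAM.log_div_le hw hlog
    have h₂ : (t : ℝ) ≤ C * ((Nat.log 2 (l / Nat.log 2 w) + 1 : ℕ) : ℝ) := by exact_mod_cast ht
    have h₃ : (0 : ℝ) ≤ max 1 (Real.logb 2
        (Real.logb 2 ((u : ℝ) / (S.card : ℝ)) / Real.logb 2 (w : ℝ))) :=
      zero_le_one.trans (le_max_left _ _)
    have h₄ := mul_le_mul_of_nonneg_left h₁ hC0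
    linarith
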